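/- Let $H$ be a bialgebra over a field $k$, and let $\mathfrak{M}^{C}$ denote the category of right comodules over a coalgebra $C$. The category $\mathfrak{M}^{H}$ is monoidal with coaction $x\otimes y\mapsto x_{(0)}\otimes y_{(0)}\otimes x_{(1)}y_{(1)}$ on tensor products. If $C$ is a left $H$-module coalgebra (a coalgebra with a left $H$-module structure such that $\Delta(hc)=h_{(1)}c_{(1)}\otimes h_{(2)}c_{(2)}$ and $\varepsilon(hc)=\varepsilon(h)\varepsilon(c)$), then $\mathfrak{M}^{C}$ is a left $\mathfrak{M}^{H}$-module category: for $X\in\mathfrak{M}^{H}$ and $W\in\mathfrak{M}^{C}$ one gives $X\otimes W$ the coaction $x\otimes w\mapsto x_{(0)}\otimes w_{(0)}\otimes x_{(1)}w_{(1)}$. Consider the following two bicategories. * $H\text{-}\mathbf{Coalg}$: the 0-cells are the left $H$-module coalgebras. The category of 1-cells from $C$ to $D$ is ${}^{C}_{H}\mathfrak{M}^{D}$, the category of $C$-$D$-bicomodules $M$ with a left $H$-module structure such that the coactions $M\to C\otimes M$ and $M\to M\otimes D$ are $H$-linear ($H$ acting diagonally); its morphisms are the $H$-linear bicomodule maps.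 The composite of $M\in{}^{C}_{H}\mathfrak{M}^{D}$ and $N\in{}^{D}_{H}\mathfrak{M}^{E}$ is the cotensor product $M\square_{D}N\in{}^{C}_{H}\mathfrak{M}^{E}$, and the identity 1-cell of $C$ is $C$. * $\mathfrak{M}^{H}\text{-}\mathbf{Mod}$: the 0-cells are the $k$-linear left $\mathfrak{M}^{H}$-module categories that are equivalent, as left $\mathfrak{M}^{H}$-module categories, to $\mathfrak{M}^{C}$ for some left $H$-module coalgebra $C$. The 1-cells from $\mathcal{M}$ to $\mathcal{N}$ are the lax left $\mathfrak{M}^{H}$-module functors $F:\mathcal{M}\to\mathcal{N}$ (with structure morphisms $X\otimes F(W)\to F(X\otimes W)$, not assumed invertible) of type $\mathscr{L}$, i.e. such that the underlying functor is $k$-linear, left exact and preserves small coproducts. The 2-cells are the morphisms of lax module functors (natural transformations commuting with the structure morphisms). 1-cells are composed as functors. For a bicategory $\mathcal{K}$, let $\mathcal{K}^{\mathrm{op}}$ be the bicategory obtained by reversing the order in which composites of 1-cells are written (so that the composite of $F:\mathcal{M}\to\mathcal{N}$ and $G:\mathcal{N}\to\mathcal{P}$, which is $G\circ F$ in $\mathfrak{M}^{H}\text{-}\mathbf{Mod}$,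 is the product of $F$ and $G$ in this order), the categories of 1-cells and the composition of 2-cells being unchanged. Then for every 1-cell $M\in{}^{C}_{H}\mathfrak{M}^{D}$ the functor $-\,\square_{C}M:\mathfrak{M}^{C}\to\mathfrak{M}^{D}$, with the lax module structure $X\otimes(W\square_{C}M)\to(X\otimes W)\square_{C}M$ induced by $x\otimes(w\otimes m)\mapsto(x_{(0)}\otimes w)\otimes x_{(1)}m$, is of type $\mathscr{L}$, and the assignments $C\mapsto\mathfrak{M}^{C}$, $M\mapsto(-\,\square_{C}M)$, $f\mapsto(-\,\square_{C}f)$ extend to a pseudofunctor $$H\text{-}\mathbf{Coalg}\longrightarrow(\mathfrak{M}^{H}\text{-}\mathbf{Mod})^{\mathrm{op}}$$ that is a biequivalence: it induces equivalences ${}^{C}_{H}\mathfrak{M}^{D}\approx\mathscr{L}^{\mathrm{lax}}_{\mathfrak{M}^{H}}(\mathfrak{M}^{C},\mathfrak{M}^{D})$ between the categories of 1-cells, where $\mathscr{L}^{\mathrm{lax}}_{\mathfrak{M}^{H}}(\mathfrak{M}^{C},\mathfrak{M}^{D})$ is the category of 1-cells from $\mathfrak{M}^{C}$ to $\mathfrak{M}^{D}$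 in $\mathfrak{M}^{H}\text{-}\mathbf{Mod}$, and every 0-cell of the target is equivalent, in the target bicategory, to some $\mathfrak{M}^{C}$. -/

import Mathlib

universe u

set_option linter.unusedSectionVars false
set_option linter.unusedVariables false

open CategoryTheory
open scoped TensorProduct

namespace HopfModCat

section Algebra

variable {k : Type u} [Field k]

section Actions

variable {H : Type u} [Ring H] [Bialgebra k H]
variable {A B E A' B' : Type u} [AddCommGroup A] [Module k A] [AddCommGroup B] [Module k B]
  [AddCommGroup E] [Module k E]
  [AddCommGroup A'] [Module k A'] [AddCommGroup B'] [Module k B']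

/-- The tensor product of two left `H`-modules: `h • (x ⊗ y) = h₍₁₎ x ⊗ h₍₂₎ y`.
A left `H`-module structure on a vector space `A` is an algebra map `H → End_k(A)`. -/
noncomputable def diag (a : H →ₐ[k] Module.End k A) (b : H →ₐ[k] Module.End k B) :
    H →ₐ[k] Module.End k (A ⊗[k] B) :=
  (Module.endTensorEndAlgHom (R := k) (S := k) (A := k) (M := A) (N := B)).comp
    ((Algebra.TensorProduct.map a b).comp (Bialgebra.comulAlgHom k H))

theorem diag_apply (a : H →ₐ[k] Module.End k A) (b : H →ₐ[k] Module.End k B) (h : H)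
    (t : A ⊗[k] B) : diag a b h t =
      TensorProduct.map (TensorProduct.lift a.toLinearMap) (TensorProduct.lift b.toLinearMap)
        (TensorProduct.tensorTensorTensorComm k H H A B (Coalgebra.comul h ⊗ₜ t)) := by
  have key : ∀ s : H ⊗[k] H, Module.endTensorEndAlgHom (R := k) (S := k) (A := k) (M := A) (N := B)
      (Algebra.TensorProduct.map a b s) t = TensorProduct.map (TensorProduct.lift a.toLinearMap)
        (TensorProduct.lift b.toLinearMap)
        (TensorProduct.tensorTensorTensorComm k H H A B (s ⊗ₜ t)) := by
    intro s
    induction t with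
    | zero => simp
    | add x y hx hy => simp only [map_add, hx, hy, TensorProduct.tmul_add]
    | tmul x y =>
      induction s with
      | zero => simp
      | add p q hp hq =>
        simp only [map_add, LinearMap.add_apply, hp, hq, TensorProduct.add_tmul]
      | tmul p q => rfl
  exact key _

/-- `f` is `H`-linear. -/
def Equivar (a : H →ₐ[k] Module.End k A) (b : H →ₐ[k] Module.End k B) (f : A →ₗ[k] B) : Prop :=
  ∀ h x, f (a h x) = b h (f x)

theorem Equivar.comp {a : H →ₐ[k] Module.End k A} {b : H →ₐ[k] Module.End k B}
    {e : H →ₐ[k] Module.End k E} {g : B →ₗ[k] E} {f : A →ₗ[k] B}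
    (hg : Equivar b e g) (hf : Equivar a b f) : Equivar a e (g ∘ₗ f) := by
  intro h x; simp [hf h x, hg h]

theorem Equivar.map {a : H →ₐ[k] Module.End k A} {b : H →ₐ[k] Module.End k B}
    {a' : H →ₐ[k] Module.End k A'} {b' : H →ₐ[k] Module.End k B'}
    {f : A →ₗ[k] A'} {g : B →ₗ[k] B'} (hf : Equivar a a' f) (hg : Equivar b b' g) :
    Equivar (diag a b) (diag a' b') (TensorProduct.map f g) := by
  intro h x
  simp only [diag_apply]
  generalize (Coalgebra.comul h : H ⊗[k] H) = s
  induction x with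
  | zero => simp
  | add x y hx hy => simp only [map_add, hx, hy, TensorProduct.tmul_add]
  | tmul x y =>
    induction s with
    | zero => simp
    | add p q hp hq => simp only [map_add, hp, hq, TensorProduct.add_tmul]
    | tmul p q =>
      simp only [TensorProduct.tensorTensorTensorComm_tmul, TensorProduct.map_tmul,
        TensorProduct.lift.tmul, AlgHom.toLinearMap_apply, hf p x, hg q y]

theorem equivar_id (a : H →ₐ[k] Module.End k A) : Equivar a a LinearMap.id := fun _ _ => rfl

theorem equivar_assoc (a : H →ₐ[k] Module.End k A) (b : H →ₐ[k] Module.End k B)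
    (e : H →ₐ[k] Module.End k E) :
    Equivar (diag (diag a b) e) (diag a (diag b e)) (TensorProduct.assoc k A B E).toLinearMap := by
  intro h t
  induction t with
  | zero => simp
  | add x y hx hy => simp only [map_add, hx, hy]
  | tmul t z =>
  induction t with
  | zero => simp
  | add x y hx hy => simp only [TensorProduct.add_tmul, map_add, hx, hy]
  | tmul x y =>
  let Ψ : H ⊗[k] (H ⊗[k] H) →ₗ[k] A ⊗[k] (B ⊗[k] E) :=
    TensorProduct.map (a.toLinearMap.flip x)
      (TensorProduct.map (b.toLinearMap.flip y) (e.toLinearMap.flip z))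
  have h1 : ∀ s : H ⊗[k] H, TensorProduct.assoc k A B E (TensorProduct.map
      (TensorProduct.lift (diag a b).toLinearMap) (TensorProduct.lift e.toLinearMap)
      (TensorProduct.tensorTensorTensorComm k H H (A ⊗[k] B) E (s ⊗ₜ ((x ⊗ₜ y) ⊗ₜ z)))) =
      Ψ (TensorProduct.assoc k H H H (Coalgebra.comul.rTensor H s)) := by
    intro s
    induction s with
    | zero => simp
    | add p q hp hq => simp only [map_add, hp, hq, TensorProduct.add_tmul]
    | tmul p q =>
      simp only [TensorProduct.tensorTensorTensorComm_tmul, TensorProduct.map_tmul,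
        TensorProduct.lift.tmul, AlgHom.toLinearMap_apply, diag_apply, LinearMap.rTensor_tmul]
      generalize (Coalgebra.comul p : H ⊗[k] H) = s
      induction s with
      | zero => simp
      | add p q hp hq => simp only [map_add, hp, hq, TensorProduct.add_tmul]
      | tmul p q => rfl
  have h2 : ∀ s : H ⊗[k] H, TensorProduct.map
      (TensorProduct.lift a.toLinearMap) (TensorProduct.lift (diag b e).toLinearMap)
      (TensorProduct.tensorTensorTensorComm k H H A (B ⊗[k] E) (s ⊗ₜ (x ⊗ₜ (y ⊗ₜ z)))) =
      Ψ (Coalgebra.comul.lTensor H s) := by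
    intro s
    induction s with
    | zero => simp
    | add p q hp hq => simp only [map_add, hp, hq, TensorProduct.add_tmul]
    | tmul p q =>
      simp only [TensorProduct.tensorTensorTensorComm_tmul, TensorProduct.map_tmul,
        TensorProduct.lift.tmul, AlgHom.toLinearMap_apply, diag_apply, LinearMap.lTensor_tmul]
      generalize (Coalgebra.comul q : H ⊗[k] H) = s
      induction s with
      | zero => simp
      | add p q hp hq =>
        simp only [map_add, hp, hq, TensorProduct.add_tmul, TensorProduct.tmul_add]
      | tmul p q => rfl
  simp only [LinearEquiv.coe_coe, TensorProduct.assoc_tmul]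
  rw [diag_apply (diag a b) e, diag_apply a (diag b e), h1, h2, Coalgebra.coassoc_apply]

theorem Equivar.of_comp {a : H →ₐ[k] Module.End k A} {b : H →ₐ[k] Module.End k B}
    {e : H →ₐ[k] Module.End k E} {g : B →ₗ[k] E} {f : A →ₗ[k] B} (hi : Function.Injective g)
    (hg : Equivar b e g) (h : Equivar a e (g ∘ₗ f)) : Equivar a b f := by
  intro x y
  apply hi
  rw [hg]
  exact h x y

theorem Equivar.symm {a : H →ₐ[k] Module.End k A} {b : H →ₐ[k] Module.End k B}
    {f : A ≃ₗ[k] B} (hf : Equivar a b f.toLinearMap) : Equivar b a f.symm.toLinearMap := by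
  intro h x
  apply f.injective
  have := hf h (f.symm x)
  simp at this
  simp [this]

end Actions

section Linear

open TensorProduct

variable {A B U V W V' W' C D M N : Type u}
  [AddCommGroup A] [Module k A] [AddCommGroup B] [Module k B] [AddCommGroup U] [Module k U]
  [AddCommGroup V] [Module k V] [AddCommGroup W] [Module k W]
  [AddCommGroup V'] [Module k V'] [AddCommGroup W'] [Module k W']
  [AddCommGroup C] [Module k C] [Coalgebra k C] [AddCommGroup D] [Module k D] [Coalgebra k D]
  [AddCommGroup M] [Module k M] [AddCommGroup N] [Module k N]

theorem lTensor_inj (A : Type u) [AddCommGroup A] [Module k A] {f : V →ₗ[k] W}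
    (hf : Function.Injective f) : Function.Injective (f.lTensor A) :=
  Module.Flat.lTensor_preserves_injective_linearMap f hf

theorem rTensor_inj (A : Type u) [AddCommGroup A] [Module k A] {f : V →ₗ[k] W}
    (hf : Function.Injective f) : Function.Injective (f.rTensor A) :=
  Module.Flat.rTensor_preserves_injective_linearMap f hf

/-- Over a field, a linear map into `A ⊗ V` that is killed by `A ⊗ f` factors through
`A ⊗ ker f`. -/
noncomputable def liftL (f : V →ₗ[k] W) (g : U →ₗ[k] A ⊗[k] V) (hg : ∀ u, f.lTensor A (g u) = 0) :
    U →ₗ[k] A ⊗[k] LinearMap.ker f :=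
  (LinearEquiv.ofInjective ((LinearMap.ker f).subtype.lTensor A)
    (lTensor_inj A (Submodule.injective_subtype _))).symm.toLinearMap ∘ₗ
    g.codRestrict _ fun u =>
      (Module.Flat.lTensor_exact A (LinearMap.exact_subtype_ker_map f) (g u)).1 (hg u)

theorem lTensor_liftL (f : V →ₗ[k] W) (g : U →ₗ[k] A ⊗[k] V) (hg : ∀ u, f.lTensor A (g u) = 0)
    (u : U) : (LinearMap.ker f).subtype.lTensor A (liftL f g hg u) = g u :=
  congrArg Subtype.val (LinearEquiv.apply_symm_apply (LinearEquiv.ofInjective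
    ((LinearMap.ker f).subtype.lTensor A) (lTensor_inj A (Submodule.injective_subtype _))) _)

/-- The version of `liftL` with the factors interchanged. -/
noncomputable def liftR (f : V →ₗ[k] W) (g : U →ₗ[k] V ⊗[k] A) (hg : ∀ u, f.rTensor A (g u) = 0) :
    U →ₗ[k] LinearMap.ker f ⊗[k] A :=
  (LinearEquiv.ofInjective ((LinearMap.ker f).subtype.rTensor A)
    (rTensor_inj A (Submodule.injective_subtype _))).symm.toLinearMap ∘ₗ
    g.codRestrict _ fun u =>
      (Module.Flat.rTensor_exact A (LinearMap.exact_subtype_ker_map f) (g u)).1 (hg u)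

theorem rTensor_liftR (f : V →ₗ[k] W) (g : U →ₗ[k] V ⊗[k] A) (hg : ∀ u, f.rTensor A (g u) = 0)
    (u : U) : (LinearMap.ker f).subtype.rTensor A (liftR f g hg u) = g u :=
  congrArg Subtype.val (LinearEquiv.apply_symm_apply (LinearEquiv.ofInjective
    ((LinearMap.ker f).subtype.rTensor A) (rTensor_inj A (Submodule.injective_subtype _))) _)

/-- `ρ` is a (coassociative and counital) right coaction of the coalgebra `C` on `M`. -/
structure IsRightCoaction (ρ : M →ₗ[k] M ⊗[k] C) : Prop where
  coassoc : ∀ m, TensorProduct.assoc k M C C (ρ.rTensor C (ρ m)) =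
    (Coalgebra.comul (R := k) (A := C)).lTensor M (ρ m)
  counit : ∀ m, TensorProduct.rid k M ((Coalgebra.counit (R := k) (A := C)).lTensor M (ρ m)) = m

/-- `l` is a (coassociative and counital) left coaction of the coalgebra `C` on `M`. -/
structure IsLeftCoaction (l : M →ₗ[k] C ⊗[k] M) : Prop where
  coassoc : ∀ m, TensorProduct.assoc k C C M ((Coalgebra.comul (R := k) (A := C)).rTensor M (l m)) =
    l.lTensor C (l m)
  counit : ∀ m, TensorProduct.lid k M ((Coalgebra.counit (R := k) (A := C)).rTensor M (l m)) = m

/-- A left and a right coaction on `M` commute. -/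
def Commuting (l : M →ₗ[k] C ⊗[k] M) (ρ : M →ₗ[k] M ⊗[k] D) : Prop :=
  ∀ m, TensorProduct.assoc k C M D (l.rTensor D (ρ m)) = ρ.lTensor C (l m)

/-- `f` commutes with right coactions. -/
def RColin (ρ : V →ₗ[k] V ⊗[k] C) (ρ' : W →ₗ[k] W ⊗[k] C) (f : V →ₗ[k] W) : Prop :=
  ∀ v, ρ' (f v) = f.rTensor C (ρ v)

/-- `f` commutes with left coactions. -/
def LColin (l : V →ₗ[k] C ⊗[k] V) (l' : W →ₗ[k] C ⊗[k] W) (f : V →ₗ[k] W) : Prop :=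
  ∀ v, l' (f v) = f.lTensor C (l v)


theorem RColin.comp {ρ : U →ₗ[k] U ⊗[k] C} {ρ' : V →ₗ[k] V ⊗[k] C} {ρ'' : W →ₗ[k] W ⊗[k] C}
    {g : V →ₗ[k] W} {f : U →ₗ[k] V} (hg : RColin ρ' ρ'' g) (hf : RColin ρ ρ' f) :
    RColin ρ ρ'' (g ∘ₗ f) := by
  intro v
  rw [LinearMap.comp_apply, hg, hf, LinearMap.rTensor_comp_apply]

theorem LColin.comp {l : U →ₗ[k] C ⊗[k] U} {l' : V →ₗ[k] C ⊗[k] V} {l'' : W →ₗ[k] C ⊗[k] W}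
    {g : V →ₗ[k] W} {f : U →ₗ[k] V} (hg : LColin l' l'' g) (hf : LColin l l' f) :
    LColin l l'' (g ∘ₗ f) := by
  intro v
  rw [LinearMap.comp_apply, hg, hf, LinearMap.lTensor_comp_apply]

theorem RColin.of_comp {ρ : U →ₗ[k] U ⊗[k] C} {ρ' : V →ₗ[k] V ⊗[k] C} {ρ'' : W →ₗ[k] W ⊗[k] C}
    {g : V →ₗ[k] W} {f : U →ₗ[k] V} (hi : Function.Injective g) (hg : RColin ρ' ρ'' g)
    (h : RColin ρ ρ'' (g ∘ₗ f)) : RColin ρ ρ' f := by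
  intro v
  apply rTensor_inj C hi
  rw [← hg, ← LinearMap.rTensor_comp_apply]
  exact h v

theorem LColin.of_comp {l : U →ₗ[k] C ⊗[k] U} {l' : V →ₗ[k] C ⊗[k] V} {l'' : W →ₗ[k] C ⊗[k] W}
    {g : V →ₗ[k] W} {f : U →ₗ[k] V} (hi : Function.Injective g) (hg : LColin l' l'' g)
    (h : LColin l l'' (g ∘ₗ f)) : LColin l l' f := by
  intro v
  apply lTensor_inj C hi
  rw [← hg, ← LinearMap.lTensor_comp_apply]
  exact h v

theorem RColin.sub {ρ : V →ₗ[k] V ⊗[k] C} {ρ' : W →ₗ[k] W ⊗[k] C} {f g : V →ₗ[k] W}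
    (hf : RColin ρ ρ' f) (hg : RColin ρ ρ' g) : RColin ρ ρ' (f - g) := by
  intro v
  rw [LinearMap.rTensor_sub]
  simp [hf v, hg v]

theorem LColin.sub {l : V →ₗ[k] C ⊗[k] V} {l' : W →ₗ[k] C ⊗[k] W} {f g : V →ₗ[k] W}
    (hf : LColin l l' f) (hg : LColin l l' g) : LColin l l' (f - g) := by
  intro v
  rw [LinearMap.lTensor_sub]
  simp [hf v, hg v]

/-! Right and left coactions on a kernel. -/

/-- The right coaction on the kernel of a colinear map. -/
noncomputable def kerR (ρ : V →ₗ[k] V ⊗[k] C) (ρ' : W →ₗ[k] W ⊗[k] C) (d : V →ₗ[k] W)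
    (hd : RColin ρ ρ' d) : LinearMap.ker d →ₗ[k] LinearMap.ker d ⊗[k] C :=
  liftR d (ρ ∘ₗ (LinearMap.ker d).subtype) fun u => by
    rw [LinearMap.comp_apply, ← hd]; simp

/-- The left coaction on the kernel of a colinear map. -/
noncomputable def kerL (l : V →ₗ[k] C ⊗[k] V) (l' : W →ₗ[k] C ⊗[k] W) (d : V →ₗ[k] W)
    (hd : LColin l l' d) : LinearMap.ker d →ₗ[k] C ⊗[k] LinearMap.ker d :=
  liftL d (l ∘ₗ (LinearMap.ker d).subtype) fun u => by
    rw [LinearMap.comp_apply, ← hd]; simp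

theorem rcolin_ker (ρ : V →ₗ[k] V ⊗[k] C) (ρ' : W →ₗ[k] W ⊗[k] C) (d : V →ₗ[k] W)
    (hd : RColin ρ ρ' d) : RColin (kerR ρ ρ' d hd) ρ (LinearMap.ker d).subtype :=
  fun u => (rTensor_liftR d (ρ ∘ₗ (LinearMap.ker d).subtype) _ u).symm

theorem lcolin_ker (l : V →ₗ[k] C ⊗[k] V) (l' : W →ₗ[k] C ⊗[k] W) (d : V →ₗ[k] W)
    (hd : LColin l l' d) : LColin (kerL l l' d hd) l (LinearMap.ker d).subtype :=
  fun u => (lTensor_liftL d (l ∘ₗ (LinearMap.ker d).subtype) _ u).symm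

theorem assoc_rTensor (i : V →ₗ[k] W) (t : (V ⊗[k] A) ⊗[k] B) :
    i.rTensor (A ⊗[k] B) (TensorProduct.assoc k V A B t) =
      TensorProduct.assoc k W A B ((i.rTensor A).rTensor B t) :=
  LinearMap.congr_fun (TensorProduct.ext_threefold (g := i.rTensor (A ⊗[k] B) ∘ₗ
    (TensorProduct.assoc k V A B).toLinearMap) (h := (TensorProduct.assoc k W A B).toLinearMap ∘ₗ
    (i.rTensor A).rTensor B) fun _ _ _ => rfl) t

theorem assoc_mTensor (i : V →ₗ[k] W) (t : (A ⊗[k] V) ⊗[k] B) :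
    (i.rTensor B).lTensor A (TensorProduct.assoc k A V B t) =
      TensorProduct.assoc k A W B ((i.lTensor A).rTensor B t) :=
  LinearMap.congr_fun (TensorProduct.ext_threefold (g := (i.rTensor B).lTensor A ∘ₗ
    (TensorProduct.assoc k A V B).toLinearMap) (h := (TensorProduct.assoc k A W B).toLinearMap ∘ₗ
    (i.lTensor A).rTensor B) fun _ _ _ => rfl) t

theorem assoc_lTensor (i : V →ₗ[k] W) (t : (A ⊗[k] B) ⊗[k] V) :
    (i.lTensor B).lTensor A (TensorProduct.assoc k A B V t) =
      TensorProduct.assoc k A B W (i.lTensor (A ⊗[k] B) t) :=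
  LinearMap.congr_fun (TensorProduct.ext_threefold (g := (i.lTensor B).lTensor A ∘ₗ
    (TensorProduct.assoc k A B V).toLinearMap) (h := (TensorProduct.assoc k A B W).toLinearMap ∘ₗ
    i.lTensor (A ⊗[k] B)) fun _ _ _ => rfl) t

theorem lr_comm (f : A →ₗ[k] B) (g : V →ₗ[k] W) (t : A ⊗[k] V) :
    f.rTensor W (g.lTensor A t) = g.lTensor B (f.rTensor V t) := by
  rw [← LinearMap.comp_apply, ← LinearMap.comp_apply, LinearMap.lTensor_comp_rTensor,
    LinearMap.rTensor_comp_lTensor]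

theorem RColin.nat {ρ : V →ₗ[k] V ⊗[k] C} {ρ' : W →ₗ[k] W ⊗[k] C} {i : V →ₗ[k] W}
    (h : RColin ρ ρ' i) (v : V) :
    TensorProduct.assoc k W C C (ρ'.rTensor C (ρ' (i v))) =
      i.rTensor (C ⊗[k] C) (TensorProduct.assoc k V C C (ρ.rTensor C (ρ v))) ∧
    (Coalgebra.comul (R := k) (A := C)).lTensor W (ρ' (i v)) =
      i.rTensor (C ⊗[k] C) ((Coalgebra.comul (R := k) (A := C)).lTensor V (ρ v)) ∧
    TensorProduct.rid k W ((Coalgebra.counit (R := k) (A := C)).lTensor W (ρ' (i v))) =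
      i (TensorProduct.rid k V ((Coalgebra.counit (R := k) (A := C)).lTensor V (ρ v))) := by
  have e2 : i.rTensor C ∘ₗ ρ = ρ' ∘ₗ i := LinearMap.ext fun v => (h v).symm
  refine ⟨?_, ?_, ?_⟩
  · rw [assoc_rTensor, ← LinearMap.rTensor_comp_apply, e2, LinearMap.rTensor_comp_apply, ← h]
  · rw [lr_comm, ← h]
  · rw [h, ← lr_comm]
    generalize (Coalgebra.counit (R := k) (A := C)).lTensor V (ρ v) = t
    induction t with
    | zero => simp
    | add x y hx hy => simp only [map_add, hx, hy]
    | tmul t c => simp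

theorem LColin.nat {l : V →ₗ[k] C ⊗[k] V} {l' : W →ₗ[k] C ⊗[k] W} {i : V →ₗ[k] W}
    (h : LColin l l' i) (v : V) :
    l'.lTensor C (l' (i v)) = (i.lTensor C).lTensor C (l.lTensor C (l v)) ∧
    TensorProduct.assoc k C C W ((Coalgebra.comul (R := k) (A := C)).rTensor W (l' (i v))) =
      (i.lTensor C).lTensor C
        (TensorProduct.assoc k C C V ((Coalgebra.comul (R := k) (A := C)).rTensor V (l v))) ∧
    TensorProduct.lid k W ((Coalgebra.counit (R := k) (A := C)).rTensor W (l' (i v))) =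
      i (TensorProduct.lid k V ((Coalgebra.counit (R := k) (A := C)).rTensor V (l v))) := by
  have e2 : i.lTensor C ∘ₗ l = l' ∘ₗ i := LinearMap.ext fun v => (h v).symm
  refine ⟨?_, ?_, ?_⟩
  · rw [← LinearMap.lTensor_comp_apply, e2, LinearMap.lTensor_comp_apply, ← h]
  · rw [assoc_lTensor, h, lr_comm]
  · rw [h, lr_comm]
    generalize (Coalgebra.counit (R := k) (A := C)).rTensor V (l v) = t
    induction t with
    | zero => simp
    | add x y hx hy => simp only [map_add, hx, hy]
    | tmul t c => simp

theorem IsRightCoaction.of_inj {ρ : V →ₗ[k] V ⊗[k] C} {ρ' : W →ₗ[k] W ⊗[k] C} {i : V →ₗ[k] W}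
    (hi : Function.Injective i) (h : RColin ρ ρ' i) (hW : IsRightCoaction ρ') :
    IsRightCoaction ρ where
  coassoc v := rTensor_inj (C ⊗[k] C) hi <| by
    rw [← (h.nat v).1, ← (h.nat v).2.1, hW.coassoc]
  counit v := hi <| by rw [← (h.nat v).2.2, hW.counit]

theorem IsLeftCoaction.of_inj {l : V →ₗ[k] C ⊗[k] V} {l' : W →ₗ[k] C ⊗[k] W} {i : V →ₗ[k] W}
    (hi : Function.Injective i) (h : LColin l l' i) (hW : IsLeftCoaction l') :
    IsLeftCoaction l where
  coassoc v := lTensor_inj C (lTensor_inj C hi) <| by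
    rw [← (h.nat v).1, ← (h.nat v).2.1, hW.coassoc]
  counit v := hi <| by rw [← (h.nat v).2.2, hW.counit]

theorem Commuting.of_inj {l : V →ₗ[k] C ⊗[k] V} {l' : W →ₗ[k] C ⊗[k] W}
    {ρ : V →ₗ[k] V ⊗[k] D} {ρ' : W →ₗ[k] W ⊗[k] D} {i : V →ₗ[k] W}
    (hi : Function.Injective i) (hl : LColin l l' i) (hr : RColin ρ ρ' i)
    (hW : Commuting l' ρ') : Commuting l ρ := by
  intro v
  apply lTensor_inj C (rTensor_inj D hi)
  have el : i.lTensor C ∘ₗ l = l' ∘ₗ i := LinearMap.ext fun v => (hl v).symm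
  have er : i.rTensor D ∘ₗ ρ = ρ' ∘ₗ i := LinearMap.ext fun v => (hr v).symm
  rw [assoc_mTensor, ← LinearMap.rTensor_comp_apply, ← LinearMap.lTensor_comp_apply, el, er,
    LinearMap.rTensor_comp_apply, ← hr, hW, hl, LinearMap.lTensor_comp_apply]

/-! Coactions on `M ⊗ N` coming from the outer factors. -/

/-- The left coaction of `C` on `M ⊗ N` through `M`. -/
noncomputable def outL (N : Type u) [AddCommGroup N] [Module k N] (l : M →ₗ[k] C ⊗[k] M) :
    M ⊗[k] N →ₗ[k] C ⊗[k] (M ⊗[k] N) :=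
  (TensorProduct.assoc k C M N).toLinearMap ∘ₗ l.rTensor N

/-- The right coaction of `C` on `M ⊗ N` through `N`. -/
noncomputable def outR (M : Type u) [AddCommGroup M] [Module k M] (ρ : N →ₗ[k] N ⊗[k] C) :
    M ⊗[k] N →ₗ[k] (M ⊗[k] N) ⊗[k] C :=
  (TensorProduct.assoc k M N C).symm.toLinearMap ∘ₗ ρ.lTensor M

theorem outL_tmul (l : M →ₗ[k] C ⊗[k] M) (m : M) (n : N) :
    outL N l (m ⊗ₜ n) = ((TensorProduct.mk k M N).flip n).lTensor C (l m) := by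
  simp only [outL, LinearMap.comp_apply, LinearMap.rTensor_tmul]
  generalize l m = t
  induction t with
  | zero => simp
  | add x y hx hy => simp only [TensorProduct.add_tmul, map_add, hx, hy]
  | tmul x y => rfl

theorem outR_tmul (ρ : N →ₗ[k] N ⊗[k] C) (m : M) (n : N) :
    outR M ρ (m ⊗ₜ n) = (TensorProduct.mk k M N m).rTensor C (ρ n) := by
  simp only [outR, LinearMap.comp_apply, LinearMap.lTensor_tmul]
  generalize ρ n = t
  induction t with
  | zero => simp
  | add x y hx hy => simp only [TensorProduct.tmul_add, map_add, hx, hy]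
  | tmul x y => rfl

theorem lcolin_mk (l : M →ₗ[k] C ⊗[k] M) (n : N) :
    LColin l (outL N l) ((TensorProduct.mk k M N).flip n) := fun m => outL_tmul l m n

theorem rcolin_mk (ρ : N →ₗ[k] N ⊗[k] C) (m : M) :
    RColin ρ (outR M ρ) (TensorProduct.mk k M N m) := fun n => outR_tmul ρ m n

theorem IsLeftCoaction.outL {l : M →ₗ[k] C ⊗[k] M} (hl : IsLeftCoaction l) :
    IsLeftCoaction (outL N l) where
  coassoc t := by
    induction t with
    | zero => simp
    | add x y hx hy => simp only [map_add, hx, hy]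
    | tmul m n =>
      have h := (lcolin_mk l n).nat m
      simp only [LinearMap.flip_apply, TensorProduct.mk_apply] at h
      rw [h.1, h.2.1, hl.coassoc]
  counit t := by
    induction t with
    | zero => simp
    | add x y hx hy => simp only [map_add, hx, hy]
    | tmul m n =>
      have h := (lcolin_mk l n).nat m
      simp only [LinearMap.flip_apply, TensorProduct.mk_apply] at h
      rw [h.2.2, hl.counit]

theorem IsRightCoaction.outR {ρ : N →ₗ[k] N ⊗[k] C} (hρ : IsRightCoaction ρ) :
    IsRightCoaction (outR M ρ) where
  coassoc t := by
    induction t with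
    | zero => simp
    | add x y hx hy => simp only [map_add, hx, hy]
    | tmul m n =>
      have h := (rcolin_mk ρ m).nat n
      simp only [TensorProduct.mk_apply] at h
      rw [h.1, h.2.1, hρ.coassoc]
  counit t := by
    induction t with
    | zero => simp
    | add x y hx hy => simp only [map_add, hx, hy]
    | tmul m n =>
      have h := (rcolin_mk ρ m).nat n
      simp only [TensorProduct.mk_apply] at h
      rw [h.2.2, hρ.counit]

theorem commuting_out (l : M →ₗ[k] C ⊗[k] M) (ρ : N →ₗ[k] N ⊗[k] D) :
    Commuting (outL N l) (outR M ρ) := by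
  intro t
  induction t with
  | zero => simp
  | add x y hx hy => simp only [map_add, hx, hy]
  | tmul m n =>
    simp only [outL_tmul, outR_tmul]
    have key : ∀ (s : C ⊗[k] M) (t : N ⊗[k] D), (∀ n', outL N l (m ⊗ₜ n') =
        ((TensorProduct.mk k M N).flip n').lTensor C s) → (∀ m', outR M ρ (m' ⊗ₜ n) =
        (TensorProduct.mk k M N m').rTensor D t) →
        TensorProduct.assoc k C (M ⊗[k] N) D
          ((outL N l).rTensor D ((TensorProduct.mk k M N m).rTensor D t)) =
        (outR M ρ).lTensor C (((TensorProduct.mk k M N).flip n).lTensor C s) := by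
      intro s t hs ht
      rw [← LinearMap.rTensor_comp_apply, ← LinearMap.lTensor_comp_apply]
      have h1 : outL N l ∘ₗ TensorProduct.mk k M N m =
          (TensorProduct.assoc k C M N).toLinearMap ∘ₗ TensorProduct.mk k (C ⊗[k] M) N s := by
        ext n'
        simp only [LinearMap.comp_apply, TensorProduct.mk_apply, hs]
        clear hs
        induction s with
        | zero => simp
        | add x y hx hy => simp only [TensorProduct.add_tmul, map_add, hx, hy]
        | tmul x y => rfl
      have h2 : outR M ρ ∘ₗ (TensorProduct.mk k M N).flip n =
          (TensorProduct.assoc k M N D).symm.toLinearMap ∘ₗ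
            (TensorProduct.mk k M (N ⊗[k] D)).flip t := by
        ext m'
        simp only [LinearMap.comp_apply, TensorProduct.mk_apply, LinearMap.flip_apply, ht]
        clear ht
        induction t with
        | zero => simp
        | add x y hx hy => simp only [TensorProduct.tmul_add, map_add, hx, hy]
        | tmul x y => rfl
      rw [h1, h2]
      clear hs ht h1 h2
      induction s with
      | zero =>
        have : TensorProduct.mk k (C ⊗[k] M) N 0 = 0 := map_zero _
        simp [this]
      | add x y hx hy =>
        simp only [map_add, LinearMap.comp_add, LinearMap.rTensor_add, LinearMap.add_apply, hx, hy]
      | tmul c m' =>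
        induction t with
        | zero =>
          have : (TensorProduct.mk k M (N ⊗[k] D)).flip 0 = 0 := map_zero _
          simp [this]
        | add x y hx hy =>
          simp only [map_add, LinearMap.comp_add, LinearMap.lTensor_add, LinearMap.add_apply, hx,
            hy]
        | tmul x y => rfl
    exact key (l m) (ρ n) (fun n' => outL_tmul l m n') fun m' => outR_tmul ρ m' n

theorem LColin.map {l : V →ₗ[k] C ⊗[k] V} {l' : W →ₗ[k] C ⊗[k] W} {f : V →ₗ[k] W}
    (h : LColin l l' f) (g : M →ₗ[k] N) :
    LColin (outL M l) (outL N l') (TensorProduct.map f g) := by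
  intro t
  induction t with
  | zero => simp
  | add x y hx hy => simp only [map_add, hx, hy]
  | tmul v m =>
    rw [TensorProduct.map_tmul, outL_tmul, outL_tmul, h, ← LinearMap.lTensor_comp_apply,
      ← LinearMap.lTensor_comp_apply]
    rfl

theorem RColin.map {ρ : V →ₗ[k] V ⊗[k] C} {ρ' : W →ₗ[k] W ⊗[k] C} {f : V →ₗ[k] W}
    (h : RColin ρ ρ' f) (g : M →ₗ[k] N) :
    RColin (outR M ρ) (outR N ρ') (TensorProduct.map g f) := by
  intro t
  induction t with
  | zero => simp
  | add x y hx hy => simp only [map_add, hx, hy]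
  | tmul m v =>
    rw [TensorProduct.map_tmul, outR_tmul, outR_tmul, h, ← LinearMap.rTensor_comp_apply,
      ← LinearMap.rTensor_comp_apply]
    rfl

theorem lcolin_assoc (l : M →ₗ[k] C ⊗[k] M) :
    LColin (outL V (outL N l)) (outL (N ⊗[k] V) l) (TensorProduct.assoc k M N V).toLinearMap := by
  intro t
  induction t with
  | zero => simp
  | add x y hx hy => simp only [map_add, hx, hy]
  | tmul t v =>
  induction t with
  | zero => simp
  | add x y hx hy => simp only [TensorProduct.add_tmul, map_add, hx, hy]
  | tmul m n =>
    simp only [LinearEquiv.coe_coe, TensorProduct.assoc_tmul]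
    rw [outL_tmul, outL_tmul, outL_tmul, ← LinearMap.lTensor_comp_apply,
      ← LinearMap.lTensor_comp_apply]
    rfl

theorem rcolin_assoc (ρ : V →ₗ[k] V ⊗[k] C) :
    RColin (outR (M ⊗[k] N) ρ) (outR M (outR N ρ)) (TensorProduct.assoc k M N V).toLinearMap := by
  intro t
  induction t with
  | zero => simp
  | add x y hx hy => simp only [map_add, hx, hy]
  | tmul t v =>
  induction t with
  | zero => simp
  | add x y hx hy => simp only [TensorProduct.add_tmul, map_add, hx, hy]
  | tmul m n =>
    simp only [LinearEquiv.coe_coe, TensorProduct.assoc_tmul]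
    rw [outR_tmul, outR_tmul, outR_tmul, ← LinearMap.rTensor_comp_apply,
      ← LinearMap.rTensor_comp_apply]
    rfl

end Linear

section Kernel

variable {H : Type u} [Ring H] [Bialgebra k H]
variable {A B : Type u} [AddCommGroup A] [Module k A] [AddCommGroup B] [Module k B]

/-- The kernel of an `H`-linear map as an `H`-module. -/
def kerAct (a : H →ₐ[k] Module.End k A) (b : H →ₐ[k] Module.End k B) (d : A →ₗ[k] B)
    (hd : Equivar a b d) : H →ₐ[k] Module.End k (LinearMap.ker d) :=
  AlgHom.ofLinearMap
    { toFun := fun h => (a h).restrict (p := LinearMap.ker d) (q := LinearMap.ker d) fun x hx => by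
        rw [LinearMap.mem_ker] at hx ⊢
        rw [hd, hx, map_zero]
      map_add' := fun x y => by ext; simp
      map_smul' := fun x y => by ext; simp }
    (by ext; simp) (fun x y => by ext; simp)

theorem equivar_ker (a : H →ₐ[k] Module.End k A) (b : H →ₐ[k] Module.End k B) (d : A →ₗ[k] B)
    (hd : Equivar a b d) : Equivar (kerAct a b d hd) a (LinearMap.ker d).subtype :=
  fun _ _ => rfl

end Kernel

end Algebra

variable (k : Type u) [Field k] (H : Type u) [Ring H] [Bialgebra k H]

/-- A left `H`-module coalgebra, i.e. a coalgebra in the monoidal category of left `H`-modules: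
a coalgebra with an `H`-action such that `Δ(hc) = h₍₁₎c₍₁₎ ⊗ h₍₂₎c₍₂₎` and `ε(hc) = ε(h)ε(c)`.
These are the 0-cells of the bicategory `H-Coalg`. -/
structure HCoalg where
  carrier : Type u
  [addCommGroup : AddCommGroup carrier]
  [module : Module k carrier]
  [coalgebra : Coalgebra k carrier]
  act : H →ₐ[k] Module.End k carrier
  comul_act : ∀ h c, Coalgebra.comul (R := k) (act h c) = diag act act h (Coalgebra.comul c)
  counit_act : ∀ h c, Coalgebra.counit (R := k) (act h c) =
    Coalgebra.counit (R := k) h * Coalgebra.counit (R := k) c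

attribute [instance] HCoalg.addCommGroup HCoalg.module HCoalg.coalgebra

variable {k H}

/-- An object of `^C_H 𝔐^D`: a `C`-`D`-bicomodule in the monoidal category of left `H`-modules. -/
structure Bicomod (C D : HCoalg k H) where
  carrier : Type u
  [addCommGroup : AddCommGroup carrier]
  [module : Module k carrier]
  /-- the left `H`-action -/
  act : H →ₐ[k] Module.End k carrier
  /-- the left `C`-coaction -/
  lam : carrier →ₗ[k] C.carrier ⊗[k] carrier
  /-- the right `D`-coaction -/
  rho : carrier →ₗ[k] carrier ⊗[k] D.carrier
  isLeft : IsLeftCoaction lam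
  isRight : IsRightCoaction rho
  commuting : Commuting lam rho
  lam_act : Equivar act (diag C.act act) lam
  rho_act : Equivar act (diag act D.act) rho

attribute [instance] Bicomod.addCommGroup Bicomod.module

namespace Bicomod

variable {C D E F : HCoalg k H}

/-- A morphism of `^C_H 𝔐^D`: an `H`-linear, left `C`-colinear and right `D`-colinear map. -/
@[ext]
structure Hom (M N : Bicomod C D) where
  lin : M.carrier →ₗ[k] N.carrier
  act : Equivar M.act N.act lin
  lam : LColin M.lam N.lam lin
  rho : RColin M.rho N.rho lin

instance : Category (Bicomod C D) where
  Hom := Hom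
  id M := ⟨LinearMap.id, fun _ _ => rfl, fun _ => by simp, fun _ => by simp⟩
  comp f g := ⟨g.lin ∘ₗ f.lin, g.act.comp f.act, g.lam.comp f.lam, g.rho.comp f.rho⟩

theorem hom_ext {M N : Bicomod C D} {f g : M ⟶ N} (h : ∀ x, f.lin x = g.lin x) : f = g :=
  Hom.ext (LinearMap.ext h)

@[simp] theorem id_lin (M : Bicomod C D) : Hom.lin (𝟙 M) = LinearMap.id := rfl

@[simp] theorem comp_lin {M N P : Bicomod C D} (f : M ⟶ N) (g : N ⟶ P) :
    Hom.lin (f ≫ g) = g.lin ∘ₗ f.lin := rfl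

/-- A linear map whose composite with an injective morphism is a morphism is a morphism. -/
def ofInj {M N P : Bicomod C D} (i : N ⟶ P) (hi : Function.Injective i.lin) (g : M ⟶ P)
    (f : M.carrier →ₗ[k] N.carrier) (h : ∀ x, i.lin (f x) = g.lin x) : M ⟶ N :=
  have e : i.lin ∘ₗ f = g.lin := LinearMap.ext h
  { lin := f
    act := fun a x => hi <| by rw [h, i.act, h, g.act]
    lam := LColin.of_comp hi i.lam (e ▸ g.lam)
    rho := RColin.of_comp hi i.rho (e ▸ g.rho) }

/-- A bijective morphism is an isomorphism. -/
def isoOf {M N : Bicomod C D} (f : M ⟶ N) (g : N.carrier →ₗ[k] M.carrier)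
    (h₁ : ∀ x, g (f.lin x) = x) (h₂ : ∀ y, f.lin (g y) = y) : M ≅ N where
  hom := f
  inv := ofInj f (Function.LeftInverse.injective h₁) (𝟙 N) g h₂
  hom_inv_id := hom_ext h₁
  inv_hom_id := hom_ext h₂

/-- `C` as a `C`-`C`-bicomodule. -/
noncomputable def unit (C : HCoalg k H) : Bicomod C C where
  carrier := C.carrier
  act := C.act
  lam := Coalgebra.comul
  rho := Coalgebra.comul
  isLeft := ⟨fun m => by simp, fun m => by simp⟩
  isRight := ⟨fun m => by simp, fun m => by simp⟩
  commuting := fun m => by simp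
  lam_act := C.comul_act
  rho_act := C.comul_act

/-- The bicomodule `M ⊗ N`, with the left coaction of `M` and the right coaction of `N`. -/
noncomputable def ext (M : Bicomod C D) (N : Bicomod D E) : Bicomod C E where
  carrier := M.carrier ⊗[k] N.carrier
  act := diag M.act N.act
  lam := outL N.carrier M.lam
  rho := outR M.carrier N.rho
  isLeft := M.isLeft.outL
  isRight := N.isRight.outR
  commuting := commuting_out _ _
  lam_act := (equivar_assoc _ _ _).comp (M.lam_act.map (equivar_id _))
  rho_act := (equivar_assoc _ _ _).symm.comp ((equivar_id _).map N.rho_act)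

noncomputable def extMap {M M' : Bicomod C D} {N N' : Bicomod D E} (f : M ⟶ M') (g : N ⟶ N') :
    ext M N ⟶ ext M' N' where
  lin := TensorProduct.map f.lin g.lin
  act := f.act.map g.act
  lam := f.lam.map g.lin
  rho := g.rho.map f.lin

noncomputable def extAssoc (M : Bicomod C D) (N : Bicomod D E) (P : Bicomod E F) :
    ext (ext M N) P ≅ ext M (ext N P) :=
  isoOf ⟨(TensorProduct.assoc k M.carrier N.carrier P.carrier).toLinearMap,
    equivar_assoc _ _ _, lcolin_assoc _, rcolin_assoc _⟩
    (TensorProduct.assoc k M.carrier N.carrier P.carrier).symm.toLinearMap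
    (fun _ => LinearEquiv.symm_apply_apply _ _) (fun _ => LinearEquiv.apply_symm_apply _ _)

/-- The right coaction as a morphism `M ⟶ M ⊗ D`. -/
noncomputable def rhoHom (M : Bicomod C D) : M ⟶ ext M (unit D) where
  lin := M.rho
  act := M.rho_act
  lam := M.commuting
  rho := fun m => by
    apply (TensorProduct.assoc k M.carrier D.carrier D.carrier).injective
    exact (LinearEquiv.apply_symm_apply _ _).trans (M.isRight.coassoc m).symm

/-- The left coaction as a morphism `N ⟶ D ⊗ N`. -/
noncomputable def lamHom (N : Bicomod D E) : N ⟶ ext (unit D) N where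
  lin := N.lam
  act := N.lam_act
  lam := N.isLeft.coassoc
  rho := fun m => by
    apply (TensorProduct.assoc k D.carrier N.carrier E.carrier).injective
    exact (LinearEquiv.apply_symm_apply _ _).trans (N.commuting m).symm

/-- `ρ_M ⊗ N - M ⊗ λ_N : M ⊗ N → M ⊗ D ⊗ N`. -/
noncomputable def cotDiff {M N D : Type u} [AddCommGroup M] [Module k M] [AddCommGroup N]
    [Module k N] [AddCommGroup D] [Module k D] (ρ : M →ₗ[k] M ⊗[k] D) (l : N →ₗ[k] D ⊗[k] N) :
    M ⊗[k] N →ₗ[k] M ⊗[k] (D ⊗[k] N) :=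
  (TensorProduct.assoc k M D N).toLinearMap ∘ₗ ρ.rTensor N - l.lTensor M

theorem mem_cot {M N D : Type u} [AddCommGroup M] [Module k M] [AddCommGroup N]
    [Module k N] [AddCommGroup D] [Module k D] {ρ : M →ₗ[k] M ⊗[k] D} {l : N →ₗ[k] D ⊗[k] N}
    {t : M ⊗[k] N} : cotDiff ρ l t = 0 ↔
      TensorProduct.assoc k M D N (ρ.rTensor N t) = l.lTensor M t := by
  simp [cotDiff, sub_eq_zero]

theorem cotDiff_act (M : Bicomod C D) (N : Bicomod D E) : Equivar (ext M N).act
    (ext M (ext (unit D) N)).act (cotDiff M.rho N.lam) := by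
  intro h x
  exact (congrArg₂ (· - ·) ((extMap (rhoHom M) (𝟙 N) ≫ (extAssoc _ _ _).hom).act h x)
    ((extMap (𝟙 M) (lamHom N)).act h x)).trans (map_sub _ _ _).symm

theorem cotDiff_lam (M : Bicomod C D) (N : Bicomod D E) : LColin (ext M N).lam
    (ext M (ext (unit D) N)).lam (cotDiff M.rho N.lam) :=
  (extMap (rhoHom M) (𝟙 N) ≫ (extAssoc _ _ _).hom).lam.sub (extMap (𝟙 M) (lamHom N)).lam

theorem cotDiff_rho (M : Bicomod C D) (N : Bicomod D E) : RColin (ext M N).rho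
    (ext M (ext (unit D) N)).rho (cotDiff M.rho N.lam) :=
  (extMap (rhoHom M) (𝟙 N) ≫ (extAssoc _ _ _).hom).rho.sub (extMap (𝟙 M) (lamHom N)).rho

/-- The cotensor product `M □_D N`: the kernel of `ρ_M ⊗ N - M ⊗ λ_N` with the `H`-action, the left
`C`-coaction and the right `E`-coaction inherited from `M ⊗ N`. -/
noncomputable def cotensor (M : Bicomod C D) (N : Bicomod D E) : Bicomod C E where
  carrier := LinearMap.ker (cotDiff M.rho N.lam)
  act := kerAct _ _ _ (cotDiff_act M N)
  lam := kerL _ _ _ (cotDiff_lam M N)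
  rho := kerR _ _ _ (cotDiff_rho M N)
  isLeft := (ext M N).isLeft.of_inj (Submodule.injective_subtype _) (lcolin_ker _ _ _ _)
  isRight := (ext M N).isRight.of_inj (Submodule.injective_subtype _) (rcolin_ker _ _ _ _)
  commuting := (ext M N).commuting.of_inj (Submodule.injective_subtype _) (lcolin_ker _ _ _ _)
    (rcolin_ker _ _ _ _)
  lam_act := Equivar.of_comp (lTensor_inj _ (Submodule.injective_subtype _))
    ((equivar_id _).map (equivar_ker _ _ _ (cotDiff_act M N))) <| by
    have h : (LinearMap.ker (cotDiff M.rho N.lam)).subtype.lTensor C.carrier ∘ₗ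
        kerL _ _ _ (cotDiff_lam M N) = (ext M N).lam ∘ₗ Submodule.subtype _ :=
      LinearMap.ext fun x => (lcolin_ker _ _ _ (cotDiff_lam M N) x).symm
    exact h ▸ (ext M N).lam_act.comp (equivar_ker _ _ _ (cotDiff_act M N))
  rho_act := Equivar.of_comp (rTensor_inj _ (Submodule.injective_subtype _))
    ((equivar_ker _ _ _ (cotDiff_act M N)).map (equivar_id _)) <| by
    have h : (LinearMap.ker (cotDiff M.rho N.lam)).subtype.rTensor E.carrier ∘ₗ
        kerR _ _ _ (cotDiff_rho M N) = (ext M N).rho ∘ₗ Submodule.subtype _ :=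
      LinearMap.ext fun x => (rcolin_ker _ _ _ (cotDiff_rho M N) x).symm
    exact h ▸ (ext M N).rho_act.comp (equivar_ker _ _ _ (cotDiff_act M N))

end Bicomod

namespace Bicomod

variable {C D E F : HCoalg k H}

section

variable {M N P M' N' D E : Type u} [AddCommGroup M] [Module k M] [AddCommGroup N] [Module k N]
  [AddCommGroup P] [Module k P] [AddCommGroup M'] [Module k M'] [AddCommGroup N'] [Module k N']
  [AddCommGroup D] [Module k D] [AddCommGroup E] [Module k E]

theorem cotDiff_nat {ρ : M →ₗ[k] M ⊗[k] D} {l : N →ₗ[k] D ⊗[k] N} {ρ' : M' →ₗ[k] M' ⊗[k] D}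
    {l' : N' →ₗ[k] D ⊗[k] N'} {f : M →ₗ[k] M'} {g : N →ₗ[k] N'}
    (hf : ∀ m, ρ' (f m) = f.rTensor D (ρ m)) (hg : ∀ n, l' (g n) = g.lTensor D (l n))
    (t : M ⊗[k] N) : cotDiff ρ' l' (TensorProduct.map f g t) =
      TensorProduct.map f (g.lTensor D) (cotDiff ρ l t) := by
  induction t with
  | zero => simp
  | add x y hx hy => simp only [map_add, hx, hy]
  | tmul m n =>
    simp only [cotDiff, LinearMap.sub_apply, LinearMap.comp_apply, TensorProduct.map_tmul,
      LinearMap.rTensor_tmul, LinearMap.lTensor_tmul, hf, hg, map_sub]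
    congr 1
    generalize ρ m = t
    induction t with
    | zero => simp
    | add x y hx hy => simp only [map_add, TensorProduct.add_tmul, hx, hy]
    | tmul x y => rfl

theorem cotDiff_natR {ρ : M →ₗ[k] M ⊗[k] D} {l : N →ₗ[k] D ⊗[k] N}
    {l' : N' →ₗ[k] D ⊗[k] N'} {g : N →ₗ[k] N'} (hg : ∀ n, l' (g n) = g.lTensor D (l n))
    (t : M ⊗[k] N) : cotDiff ρ l' (g.lTensor M t) = (g.lTensor D).lTensor M (cotDiff ρ l t) :=
  cotDiff_nat (f := LinearMap.id) (fun m => by simp) hg t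

theorem cotDiff_natL {ρ : M →ₗ[k] M ⊗[k] D} {l : N →ₗ[k] D ⊗[k] N} {ρ' : M' →ₗ[k] M' ⊗[k] D}
    {f : M →ₗ[k] M'} (hf : ∀ m, ρ' (f m) = f.rTensor D (ρ m))
    (t : M ⊗[k] N) : cotDiff ρ' l (f.rTensor N t) = f.rTensor (D ⊗[k] N) (cotDiff ρ l t) := by
  have := cotDiff_nat (l := l) (l' := l) (g := LinearMap.id) hf (fun m => by simp) t
  rwa [LinearMap.lTensor_id] at this

theorem lTensor_zero_of {f : M →ₗ[k] N} {g : N →ₗ[k] P} (h : ∀ x, g (f x) = 0) (t : D ⊗[k] M) :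
    g.lTensor D (f.lTensor D t) = 0 := by
  rw [← LinearMap.lTensor_comp_apply, (LinearMap.ext h : g ∘ₗ f = 0), LinearMap.lTensor_zero,
    LinearMap.zero_apply]

theorem rTensor_zero_of {f : M →ₗ[k] N} {g : N →ₗ[k] P} (h : ∀ x, g (f x) = 0) (t : M ⊗[k] D) :
    g.rTensor D (f.rTensor D t) = 0 := by
  rw [← LinearMap.rTensor_comp_apply, (LinearMap.ext h : g ∘ₗ f = 0), LinearMap.rTensor_zero,
    LinearMap.zero_apply]

theorem counit_lTensor [Coalgebra k D] (l : M →ₗ[k] N) (t : D ⊗[k] M) :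
    TensorProduct.lid k N ((Coalgebra.counit (R := k) (A := D)).rTensor N (l.lTensor D t)) =
      l (TensorProduct.lid k M ((Coalgebra.counit (R := k) (A := D)).rTensor M t)) := by
  induction t with
  | zero => simp
  | add x y hx hy => simp only [map_add, hx, hy]
  | tmul m n => simp

theorem rTensor_counit [Coalgebra k D] (l : M →ₗ[k] N) (t : M ⊗[k] D) :
    TensorProduct.rid k N ((Coalgebra.counit (R := k) (A := D)).lTensor N (l.rTensor D t)) =
      l (TensorProduct.rid k M ((Coalgebra.counit (R := k) (A := D)).lTensor M t)) := by
  induction t with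
  | zero => simp
  | add x y hx hy => simp only [map_add, hx, hy]
  | tmul m n => simp

theorem cotDiff_assocR (ρ : N →ₗ[k] N ⊗[k] E) (l : P →ₗ[k] E ⊗[k] P) (t : (M ⊗[k] N) ⊗[k] P) :
    TensorProduct.assoc k M N (E ⊗[k] P)
      (cotDiff ((TensorProduct.assoc k M N E).symm.toLinearMap ∘ₗ ρ.lTensor M) l t) =
      (cotDiff ρ l).lTensor M (TensorProduct.assoc k M N P t) := by
  induction t with
  | zero => simp
  | add x y hx hy => simp only [map_add, hx, hy]
  | tmul t p =>
  induction t with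
  | zero => simp
  | add x y hx hy => simp only [TensorProduct.add_tmul, map_add, hx, hy]
  | tmul m n =>
    simp only [cotDiff, LinearMap.sub_apply, LinearMap.comp_apply, map_sub, LinearMap.lTensor_sub,
      LinearMap.rTensor_tmul, LinearMap.lTensor_tmul, TensorProduct.assoc_tmul, LinearEquiv.coe_coe]
    congr 1
    generalize ρ n = t
    induction t with
    | zero => simp
    | add x y hx hy => simp only [map_add, TensorProduct.add_tmul, TensorProduct.tmul_add, hx, hy]
    | tmul x y => rfl

theorem cotDiff_assocL (ρ : M →ₗ[k] M ⊗[k] D) (l : N →ₗ[k] D ⊗[k] N) (t : (M ⊗[k] N) ⊗[k] P) :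
    cotDiff ρ ((TensorProduct.assoc k D N P).toLinearMap ∘ₗ l.rTensor P)
      (TensorProduct.assoc k M N P t) =
      (TensorProduct.assoc k D N P).toLinearMap.lTensor M
        (TensorProduct.assoc k M (D ⊗[k] N) P ((cotDiff ρ l).rTensor P t)) := by
  induction t with
  | zero => simp
  | add x y hx hy => simp only [map_add, hx, hy]
  | tmul t p =>
  induction t with
  | zero => simp
  | add x y hx hy => simp only [TensorProduct.add_tmul, map_add, hx, hy]
  | tmul m n =>
    simp only [cotDiff, LinearMap.sub_apply, LinearMap.comp_apply, map_sub, LinearMap.rTensor_sub,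
      LinearMap.rTensor_tmul, LinearMap.lTensor_tmul, TensorProduct.assoc_tmul, LinearEquiv.coe_coe]
    congr 1
    generalize ρ m = t
    induction t with
    | zero => simp
    | add x y hx hy => simp only [map_add, TensorProduct.add_tmul, hx, hy]
    | tmul x y => rfl

end

/-- The inclusion `M □_D N ⟶ M ⊗ N`. -/
noncomputable def incl (M : Bicomod C D) (N : Bicomod D E) : cotensor M N ⟶ ext M N where
  lin := Submodule.subtype _
  act := fun _ _ => rfl
  lam := lcolin_ker _ _ _ (cotDiff_lam M N)
  rho := rcolin_ker _ _ _ (cotDiff_rho M N)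

theorem incl_inj (M : Bicomod C D) (N : Bicomod D E) : Function.Injective (incl M N).lin :=
  Submodule.injective_subtype _

noncomputable def cotLift {M : Bicomod C D} {N : Bicomod D E} {T : Bicomod C E} (f : T ⟶ ext M N)
    (h : ∀ x, cotDiff M.rho N.lam (f.lin x) = 0) : T ⟶ cotensor M N :=
  ofInj (incl M N) (incl_inj M N) f (f.lin.codRestrict _ h) fun _ => rfl

theorem incl_cotLift {M : Bicomod C D} {N : Bicomod D E} {T : Bicomod C E} (f : T ⟶ ext M N)
    (h : ∀ x, cotDiff M.rho N.lam (f.lin x) = 0) (x : T.carrier) :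
    (incl M N).lin ((cotLift f h).lin x) = f.lin x := rfl

theorem cotDiff_incl {M : Bicomod C D} {N : Bicomod D E} (x : (cotensor M N).carrier) :
    cotDiff M.rho N.lam ((incl M N).lin x) = 0 := x.2

/-- The cotensor product of two morphisms. -/
noncomputable def cotMap {M M' : Bicomod C D} {N N' : Bicomod D E} (f : M ⟶ M') (g : N ⟶ N') :
    cotensor M N ⟶ cotensor M' N' :=
  cotLift (incl M N ≫ extMap f g) fun x =>
    (cotDiff_nat f.rho g.lam _).trans (by rw [cotDiff_incl, map_zero])

theorem incl_cotMap {M M' : Bicomod C D} {N N' : Bicomod D E} (f : M ⟶ M') (g : N ⟶ N')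
    (x : (cotensor M N).carrier) : (incl M' N').lin ((cotMap f g).lin x) =
      TensorProduct.map f.lin g.lin ((incl M N).lin x) := rfl

/-- `M □ (N □ P) → M ⊗ (N ⊗ P)` -/
noncomputable def inclR (M : Bicomod C D) (N : Bicomod D E) (P : Bicomod E F) :
    cotensor M (cotensor N P) ⟶ ext M (ext N P) := incl _ _ ≫ extMap (𝟙 M) (incl N P)

/-- `(M □ N) □ P → (M ⊗ N) ⊗ P` -/
noncomputable def inclL (M : Bicomod C D) (N : Bicomod D E) (P : Bicomod E F) :
    cotensor (cotensor M N) P ⟶ ext (ext M N) P := incl _ _ ≫ extMap (incl M N) (𝟙 P)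

theorem inclR_inj (M : Bicomod C D) (N : Bicomod D E) (P : Bicomod E F) :
    Function.Injective (inclR M N P).lin :=
  (lTensor_inj M.carrier (incl_inj N P)).comp (incl_inj _ _)

theorem inclL_inj (M : Bicomod C D) (N : Bicomod D E) (P : Bicomod E F) :
    Function.Injective (inclL M N P).lin :=
  (rTensor_inj P.carrier (incl_inj M N)).comp (incl_inj _ _)

theorem inclR_apply (M : Bicomod C D) (N : Bicomod D E) (P : Bicomod E F)
    (x : (cotensor M (cotensor N P)).carrier) : (inclR M N P).lin x =
      (incl N P).lin.lTensor M.carrier ((incl _ _).lin x) := rfl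

theorem inclL_apply (M : Bicomod C D) (N : Bicomod D E) (P : Bicomod E F)
    (x : (cotensor (cotensor M N) P).carrier) : (inclL M N P).lin x =
      (incl M N).lin.rTensor P.carrier ((incl _ _).lin x) := rfl

noncomputable def liftR3 {M : Bicomod C D} {N : Bicomod D E} {P : Bicomod E F} {T : Bicomod C F}
    (f : T ⟶ ext M (ext N P)) (h₁ : ∀ x, (cotDiff N.rho P.lam).lTensor M.carrier (f.lin x) = 0)
    (h₂ : ∀ x, cotDiff M.rho (ext N P).lam (f.lin x) = 0) : T ⟶ cotensor M (cotensor N P) :=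
  cotLift (ofInj (extMap (𝟙 M) (incl N P)) (lTensor_inj M.carrier (incl_inj N P)) f
    (liftL (cotDiff N.rho P.lam) f.lin h₁) (lTensor_liftL _ f.lin h₁)) fun x => by
    apply lTensor_inj M.carrier (lTensor_inj D.carrier (incl_inj N P))
    refine (cotDiff_natR (incl N P).lam _).symm.trans ?_
    rw [map_zero, ← h₂ x]
    exact congrArg _ (lTensor_liftL (cotDiff N.rho P.lam) f.lin h₁ x)

theorem inclR_liftR3 {M : Bicomod C D} {N : Bicomod D E} {P : Bicomod E F} {T : Bicomod C F}
    (f : T ⟶ ext M (ext N P)) (h₁ : ∀ x, (cotDiff N.rho P.lam).lTensor M.carrier (f.lin x) = 0)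
    (h₂ : ∀ x, cotDiff M.rho (ext N P).lam (f.lin x) = 0) (x : T.carrier) :
    (inclR M N P).lin ((liftR3 f h₁ h₂).lin x) = f.lin x :=
  lTensor_liftL (cotDiff N.rho P.lam) f.lin h₁ x

noncomputable def liftL3 {M : Bicomod C D} {N : Bicomod D E} {P : Bicomod E F} {T : Bicomod C F}
    (f : T ⟶ ext (ext M N) P) (h₁ : ∀ x, (cotDiff M.rho N.lam).rTensor P.carrier (f.lin x) = 0)
    (h₂ : ∀ x, cotDiff (ext M N).rho P.lam (f.lin x) = 0) : T ⟶ cotensor (cotensor M N) P :=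
  cotLift (ofInj (extMap (incl M N) (𝟙 P)) (rTensor_inj P.carrier (incl_inj M N)) f
    (HopfModCat.liftR (cotDiff M.rho N.lam) f.lin h₁) (rTensor_liftR _ f.lin h₁)) fun x => by
    apply rTensor_inj (E.carrier ⊗[k] P.carrier) (incl_inj M N)
    refine (cotDiff_natL (incl M N).rho _).symm.trans ?_
    rw [map_zero, ← h₂ x]
    exact congrArg _ (rTensor_liftR (cotDiff M.rho N.lam) f.lin h₁ x)

theorem inclL_liftL3 {M : Bicomod C D} {N : Bicomod D E} {P : Bicomod E F} {T : Bicomod C F}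
    (f : T ⟶ ext (ext M N) P) (h₁ : ∀ x, (cotDiff M.rho N.lam).rTensor P.carrier (f.lin x) = 0)
    (h₂ : ∀ x, cotDiff (ext M N).rho P.lam (f.lin x) = 0) (x : T.carrier) :
    (inclL M N P).lin ((liftL3 f h₁ h₂).lin x) = f.lin x :=
  rTensor_liftR (cotDiff M.rho N.lam) f.lin h₁ x

theorem cond_R (M : Bicomod C D) (N : Bicomod D E) (P : Bicomod E F)
    (x : (cotensor M (cotensor N P)).carrier) :
    (cotDiff N.rho P.lam).lTensor M.carrier ((inclR M N P).lin x) = 0 ∧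
    cotDiff M.rho (ext N P).lam ((inclR M N P).lin x) = 0 := by
  constructor
  · exact lTensor_zero_of cotDiff_incl _
  · refine (cotDiff_natR (incl N P).lam _).trans ?_
    rw [cotDiff_incl, map_zero]

theorem cond_L (M : Bicomod C D) (N : Bicomod D E) (P : Bicomod E F)
    (x : (cotensor (cotensor M N) P).carrier) :
    (cotDiff M.rho N.lam).rTensor P.carrier ((inclL M N P).lin x) = 0 ∧
    cotDiff (ext M N).rho P.lam ((inclL M N P).lin x) = 0 := by
  constructor
  · exact rTensor_zero_of cotDiff_incl _
  · refine (cotDiff_natL (incl M N).rho _).trans ?_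
    rw [cotDiff_incl, map_zero]

noncomputable def cotAssocHom (M : Bicomod C D) (N : Bicomod D E) (P : Bicomod E F) :
    cotensor (cotensor M N) P ⟶ cotensor M (cotensor N P) :=
  liftR3 (inclL M N P ≫ (extAssoc M N P).hom)
    (fun x => (cotDiff_assocR N.rho P.lam _).symm.trans <|
      (congrArg (TensorProduct.assoc k M.carrier N.carrier (E.carrier ⊗[k] P.carrier))
        (cond_L M N P x).2).trans (map_zero _))
    (fun x => (cotDiff_assocL M.rho N.lam _).trans <|
      (congrArg (fun t => (TensorProduct.assoc k D.carrier N.carrier P.carrier).toLinearMap.lTensor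
        M.carrier (TensorProduct.assoc k M.carrier (D.carrier ⊗[k] N.carrier) P.carrier t))
        (cond_L M N P x).1).trans (by rw [map_zero, map_zero]; rfl))

noncomputable def cotAssocInv (M : Bicomod C D) (N : Bicomod D E) (P : Bicomod E F) :
    cotensor M (cotensor N P) ⟶ cotensor (cotensor M N) P :=
  liftL3 (inclR M N P ≫ (extAssoc M N P).inv)
    (fun x => by
      apply (TensorProduct.assoc k M.carrier (D.carrier ⊗[k] N.carrier) P.carrier).injective
      apply lTensor_inj M.carrier
        (TensorProduct.assoc k D.carrier N.carrier P.carrier).injective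
      refine (cotDiff_assocL M.rho N.lam _).symm.trans ?_
      rw [map_zero, map_zero]
      exact (congrArg _ (LinearEquiv.apply_symm_apply _ _)).trans (cond_R M N P x).2)
    (fun x => by
      apply (TensorProduct.assoc k M.carrier N.carrier (E.carrier ⊗[k] P.carrier)).injective
      refine (cotDiff_assocR N.rho P.lam _).trans ?_
      refine Eq.trans ?_ (map_zero _).symm
      exact (congrArg _ (LinearEquiv.apply_symm_apply _ _)).trans (cond_R M N P x).1)

theorem inclR_cotAssoc (M : Bicomod C D) (N : Bicomod D E) (P : Bicomod E F)
    (x : (cotensor (cotensor M N) P).carrier) :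
    (inclR M N P).lin ((cotAssocHom M N P).lin x) =
      TensorProduct.assoc k M.carrier N.carrier P.carrier ((inclL M N P).lin x) :=
  inclR_liftR3 (inclL M N P ≫ (extAssoc M N P).hom) _ _ x

theorem inclL_cotAssoc (M : Bicomod C D) (N : Bicomod D E) (P : Bicomod E F)
    (x : (cotensor M (cotensor N P)).carrier) :
    (inclL M N P).lin ((cotAssocInv M N P).lin x) =
      (TensorProduct.assoc k M.carrier N.carrier P.carrier).symm ((inclR M N P).lin x) :=
  inclL_liftL3 (inclR M N P ≫ (extAssoc M N P).inv) _ _ x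

/-- `(M □ N) □ P ≅ M □ (N □ P)`, induced by `(m ⊗ n) ⊗ p ↦ m ⊗ (n ⊗ p)`. -/
noncomputable def cotAssoc (M : Bicomod C D) (N : Bicomod D E) (P : Bicomod E F) :
    cotensor (cotensor M N) P ≅ cotensor M (cotensor N P) where
  hom := cotAssocHom M N P
  inv := cotAssocInv M N P
  hom_inv_id := hom_ext fun x => inclL_inj _ _ _ <| by
    refine (inclL_cotAssoc M N P _).trans ?_
    refine (congrArg (extAssoc M N P).inv.lin (inclR_cotAssoc M N P _)).trans ?_
    exact LinearEquiv.symm_apply_apply _ _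
  inv_hom_id := hom_ext fun x => inclR_inj _ _ _ <| by
    refine (inclR_cotAssoc M N P _).trans ?_
    refine (congrArg (extAssoc M N P).hom.lin (inclL_cotAssoc M N P _)).trans ?_
    exact LinearEquiv.apply_symm_apply _ _

/-- `C □_C M ≅ M`, induced by `c ⊗ m ↦ ε(c) m`; the inverse is the coaction. -/
noncomputable def cotLeft (M : Bicomod C D) : cotensor (unit C) M ≅ M :=
  (isoOf (cotLift (lamHom M) fun x => mem_cot.2 (M.isLeft.coassoc x))
    ((TensorProduct.lid k M.carrier).toLinearMap ∘ₗ
      (Coalgebra.counit (R := k) (A := C.carrier)).rTensor M.carrier ∘ₗ (incl (unit C) M).lin)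
    M.isLeft.counit fun y => incl_inj _ _ <|
      (counit_lTensor M.lam _).symm.trans <|
        (congrArg (fun t => TensorProduct.lid k (C.carrier ⊗[k] M.carrier)
          ((Coalgebra.counit (R := k) (A := C.carrier)).rTensor _ t))
          (mem_cot.1 (cotDiff_incl y)).symm).trans
        ((unit C).isLeft.outL.counit _)).symm

/-- `M □_D D ≅ M`, induced by `m ⊗ d ↦ ε(d) m`; the inverse is the coaction. -/
noncomputable def cotRight (M : Bicomod C D) : cotensor M (unit D) ≅ M :=
  (isoOf (cotLift (rhoHom M) fun x => mem_cot.2 (M.isRight.coassoc x))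
    ((TensorProduct.rid k M.carrier).toLinearMap ∘ₗ
      (Coalgebra.counit (R := k) (A := D.carrier)).lTensor M.carrier ∘ₗ (incl M (unit D)).lin)
    M.isRight.counit fun y => incl_inj _ _ <|
      (rTensor_counit M.rho _).symm.trans <|
        (congrArg (fun t => TensorProduct.rid k (M.carrier ⊗[k] D.carrier)
          ((Coalgebra.counit (R := k) (A := D.carrier)).lTensor _ t))
          ((LinearEquiv.eq_symm_apply _).2 (mem_cot.1 (cotDiff_incl y)))).trans
        ((unit D).isRight.outR.counit _)).symm

end Bicomod

namespace Bicomod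

variable {C D E F G : HCoalg k H}

theorem pentagon_aux {A V P Q M N : Type u} [AddCommGroup A] [Module k A]
    [AddCommGroup V] [Module k V] [AddCommGroup P] [Module k P] [AddCommGroup Q]
    [Module k Q] [AddCommGroup M] [Module k M] [AddCommGroup N] [Module k N]
    (i : A →ₗ[k] V ⊗[k] P) (j : V →ₗ[k] M ⊗[k] N) (t : A ⊗[k] Q) :
    (TensorProduct.assoc k N P Q).toLinearMap.lTensor M (TensorProduct.assoc k M (N ⊗[k] P) Q
      (((TensorProduct.assoc k M N P).toLinearMap ∘ₗ j.rTensor P ∘ₗ i).rTensor Q t)) =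
    TensorProduct.assoc k M N (P ⊗[k] Q) (j.rTensor (P ⊗[k] Q)
      (TensorProduct.assoc k V P Q (i.rTensor Q t))) := by
  induction t with
  | zero => simp
  | add x y hx hy => simp only [map_add, hx, hy]
  | tmul a q =>
    simp only [LinearMap.rTensor_tmul, LinearMap.comp_apply]
    generalize i a = t
    induction t with
    | zero => simp
    | add x y hx hy => simp only [map_add, TensorProduct.add_tmul, hx, hy]
    | tmul v p =>
      simp only [LinearMap.rTensor_tmul, TensorProduct.assoc_tmul]
      generalize j v = t
      induction t with
      | zero => simp
      | add x y hx hy => simp only [map_add, TensorProduct.add_tmul, hx, hy]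
      | tmul x y => rfl

theorem map_assoc {M N P M' N' P' : Type u} [AddCommGroup M] [Module k M] [AddCommGroup N]
    [Module k N] [AddCommGroup P] [Module k P] [AddCommGroup M'] [Module k M'] [AddCommGroup N']
    [Module k N'] [AddCommGroup P'] [Module k P'] (f : M →ₗ[k] M') (g : N →ₗ[k] N')
    (h : P →ₗ[k] P') (t : (M ⊗[k] N) ⊗[k] P) :
    TensorProduct.assoc k M' N' P' (TensorProduct.map (TensorProduct.map f g) h t) =
      TensorProduct.map f (TensorProduct.map g h) (TensorProduct.assoc k M N P t) :=
  LinearMap.congr_fun (TensorProduct.ext_threefold (g := (TensorProduct.assoc k M' N' P').toLinearMap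
    ∘ₗ TensorProduct.map (TensorProduct.map f g) h) (h := TensorProduct.map f
    (TensorProduct.map g h) ∘ₗ (TensorProduct.assoc k M N P).toLinearMap) fun _ _ _ => rfl) t

theorem map_comp_eq {M N P M' N' P' : Type u} [AddCommGroup M] [Module k M] [AddCommGroup N]
    [Module k N] [AddCommGroup P] [Module k P] [AddCommGroup M'] [Module k M'] [AddCommGroup N']
    [Module k N'] [AddCommGroup P'] [Module k P'] {f : M →ₗ[k] N} {g : N →ₗ[k] P} {h : M →ₗ[k] P}
    {f' : M' →ₗ[k] N'} {g' : N' →ₗ[k] P'} {h' : M' →ₗ[k] P'} (e : ∀ x, g (f x) = h x)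
    (e' : ∀ x, g' (f' x) = h' x) (t : M ⊗[k] M') :
    TensorProduct.map g g' (TensorProduct.map f f' t) = TensorProduct.map h h' t := by
  obtain rfl : g ∘ₗ f = h := LinearMap.ext e
  obtain rfl : g' ∘ₗ f' = h' := LinearMap.ext e'
  rw [TensorProduct.map_comp]; rfl

theorem map_sq {M N N₂ P M' N' N₂' P' : Type u} [AddCommGroup M] [Module k M] [AddCommGroup N]
    [Module k N] [AddCommGroup P] [Module k P] [AddCommGroup M'] [Module k M'] [AddCommGroup N']
    [Module k N'] [AddCommGroup P'] [Module k P'] [AddCommGroup N₂] [Module k N₂]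
    [AddCommGroup N₂'] [Module k N₂'] {f : M →ₗ[k] N} {g : N →ₗ[k] P} {f₂ : M →ₗ[k] N₂}
    {g₂ : N₂ →ₗ[k] P} {f' : M' →ₗ[k] N'} {g' : N' →ₗ[k] P'} {f₂' : M' →ₗ[k] N₂'}
    {g₂' : N₂' →ₗ[k] P'} (e : ∀ x, g (f x) = g₂ (f₂ x)) (e' : ∀ x, g' (f' x) = g₂' (f₂' x))
    (t : M ⊗[k] M') :
    TensorProduct.map g g' (TensorProduct.map f f' t) =
      TensorProduct.map g₂ g₂' (TensorProduct.map f₂ f₂' t) :=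
  (map_comp_eq (h := g₂ ∘ₗ f₂) (h' := g₂' ∘ₗ f₂') e e' t).trans
    (map_comp_eq (fun _ => rfl) (fun _ => rfl) t).symm

theorem lTensor_comp3 {A B E F B' E' M : Type u} [AddCommGroup A] [Module k A] [AddCommGroup B]
    [Module k B] [AddCommGroup E] [Module k E] [AddCommGroup F] [Module k F] [AddCommGroup B']
    [Module k B'] [AddCommGroup E'] [Module k E'] [AddCommGroup M] [Module k M]
    {c : A →ₗ[k] B} {b : B →ₗ[k] E} {a : E →ₗ[k] F} {c' : A →ₗ[k] B'} {b' : B' →ₗ[k] E'}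
    {a' : E' →ₗ[k] F} (h : ∀ x, a (b (c x)) = a' (b' (c' x))) (t : M ⊗[k] A) :
    a.lTensor M (b.lTensor M (c.lTensor M t)) = a'.lTensor M (b'.lTensor M (c'.lTensor M t)) := by
  have : a ∘ₗ b ∘ₗ c = a' ∘ₗ b' ∘ₗ c' := LinearMap.ext h
  have := LinearMap.congr_fun (congrArg (LinearMap.lTensor M) this) t
  simpa only [LinearMap.lTensor_comp_apply] using this

theorem rTensor_comp3 {A B E F B' E' M : Type u} [AddCommGroup A] [Module k A] [AddCommGroup B]
    [Module k B] [AddCommGroup E] [Module k E] [AddCommGroup F] [Module k F] [AddCommGroup B']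
    [Module k B'] [AddCommGroup E'] [Module k E'] [AddCommGroup M] [Module k M]
    {c : A →ₗ[k] B} {b : B →ₗ[k] E} {a : E →ₗ[k] F} {c' : A →ₗ[k] B'} {b' : B' →ₗ[k] E'}
    {a' : E' →ₗ[k] F} (h : ∀ x, a (b (c x)) = a' (b' (c' x))) (t : A ⊗[k] M) :
    a.rTensor M (b.rTensor M (c.rTensor M t)) = (a' ∘ₗ b' ∘ₗ c').rTensor M t := by
  have : a ∘ₗ b ∘ₗ c = a' ∘ₗ b' ∘ₗ c' := LinearMap.ext h
  have := LinearMap.congr_fun (congrArg (LinearMap.rTensor M) this) t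
  rw [← this]
  simp only [LinearMap.rTensor_comp_apply]

theorem inclR_map {M M' : Bicomod C D} {N N' : Bicomod D E} {P P' : Bicomod E F} (f : M ⟶ M')
    (g : N ⟶ N') (h : P ⟶ P') (x : (cotensor M (cotensor N P)).carrier) :
    (inclR M' N' P').lin ((cotMap f (cotMap g h)).lin x) =
      TensorProduct.map f.lin (TensorProduct.map g.lin h.lin) ((inclR M N P).lin x) :=
  map_sq (f := f.lin) (g := LinearMap.id) (f₂ := LinearMap.id) (g₂ := f.lin)
    (f' := (cotMap g h).lin) (g' := (incl N' P').lin) (f₂' := (incl N P).lin)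
    (g₂' := TensorProduct.map g.lin h.lin) (fun _ => rfl) (fun _ => rfl)
    ((incl M (cotensor N P)).lin x)

theorem inclL_map {M M' : Bicomod C D} {N N' : Bicomod D E} {P P' : Bicomod E F} (f : M ⟶ M')
    (g : N ⟶ N') (h : P ⟶ P') (x : (cotensor (cotensor M N) P).carrier) :
    (inclL M' N' P').lin ((cotMap (cotMap f g) h).lin x) =
      TensorProduct.map (TensorProduct.map f.lin g.lin) h.lin ((inclL M N P).lin x) :=
  map_sq (f' := h.lin) (g' := LinearMap.id) (f₂' := LinearMap.id) (g₂' := h.lin)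
    (f := (cotMap f g).lin) (g := (incl M' N').lin) (f₂ := (incl M N).lin)
    (g₂ := TensorProduct.map f.lin g.lin) (fun _ => rfl) (fun _ => rfl)
    ((incl (cotensor M N) P).lin x)

theorem cotMap_id (M : Bicomod C D) (N : Bicomod D E) : cotMap (𝟙 M) (𝟙 N) = 𝟙 (cotensor M N) :=
  hom_ext fun x => incl_inj _ _ <| by
    rw [incl_cotMap]
    exact LinearMap.congr_fun TensorProduct.map_id _

theorem cotMap_comp {M M' M'' : Bicomod C D} {N N' N'' : Bicomod D E} (f : M ⟶ M') (f' : M' ⟶ M'')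
    (g : N ⟶ N') (g' : N' ⟶ N'') : cotMap (f ≫ f') (g ≫ g') = cotMap f g ≫ cotMap f' g' :=
  hom_ext fun _ => incl_inj _ _ <| LinearMap.congr_fun (TensorProduct.map_comp _ _ _ _) _

theorem cotAssoc_nat {M M' : Bicomod C D} {N N' : Bicomod D E} {P P' : Bicomod E F} (f : M ⟶ M')
    (g : N ⟶ N') (h : P ⟶ P') : cotMap (cotMap f g) h ≫ (cotAssoc M' N' P').hom =
      (cotAssoc M N P).hom ≫ cotMap f (cotMap g h) :=
  hom_ext fun x => inclR_inj _ _ _ <| by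
    refine (inclR_cotAssoc _ _ _ _).trans ?_
    refine Eq.trans ?_ (inclR_map f g h _).symm
    refine Eq.trans ?_ (congrArg _ (inclR_cotAssoc M N P x)).symm
    refine Eq.trans ?_ (map_assoc f.lin g.lin h.lin _)
    exact congrArg _ (inclL_map f g h x)

theorem cotLeft_nat {M M' : Bicomod C D} (f : M ⟶ M') :
    cotMap (𝟙 (unit C)) f ≫ (cotLeft M').hom = (cotLeft M).hom ≫ f :=
  hom_ext fun x => counit_lTensor f.lin
    (show C.carrier ⊗[k] M.carrier from (incl (unit C) M).lin x)

theorem cotRight_nat {M M' : Bicomod C D} (f : M ⟶ M') :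
    cotMap f (𝟙 (unit D)) ≫ (cotRight M').hom = (cotRight M).hom ≫ f :=
  hom_ext fun x => rTensor_counit f.lin
    (show M.carrier ⊗[k] D.carrier from (incl M (unit D)).lin x)

theorem triangle_aux {M N D V : Type u} [AddCommGroup M] [Module k M] [AddCommGroup N]
    [Module k N] [AddCommGroup D] [Module k D] [AddCommGroup V] [Module k V]
    (e : D →ₗ[k] k) (i : V →ₗ[k] M ⊗[k] D) (t : V ⊗[k] N) :
    ((TensorProduct.lid k N).toLinearMap ∘ₗ e.rTensor N).lTensor M
      (TensorProduct.assoc k M D N (i.rTensor N t)) =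
    ((TensorProduct.rid k M).toLinearMap ∘ₗ e.lTensor M ∘ₗ i).rTensor N t := by
  induction t with
  | zero => simp
  | add x y hx hy => simp only [map_add, hx, hy]
  | tmul v n =>
    simp only [LinearMap.rTensor_tmul, LinearMap.comp_apply]
    generalize i v = t
    induction t with
    | zero => simp
    | add x y hx hy => simp only [map_add, TensorProduct.add_tmul, hx, hy]
    | tmul x y => simp [TensorProduct.smul_tmul]

theorem cot_triangle (M : Bicomod C D) (N : Bicomod D E) :
    (cotAssoc M (unit D) N).hom ≫ cotMap (𝟙 M) (cotLeft N).hom =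
      cotMap (cotRight M).hom (𝟙 N) :=
  hom_ext fun x => incl_inj _ _ <| by
    refine Eq.trans ?_ (triangle_aux (Coalgebra.counit (R := k) (A := D.carrier))
      (incl M (unit D)).lin ((incl (cotensor M (unit D)) N).lin x))
    refine Eq.trans ?_ (congrArg _ (inclR_cotAssoc M (unit D) N x))
    exact (map_comp_eq (fun _ => rfl) (fun _ => rfl) _).symm

theorem cot_pentagon (M : Bicomod C D) (N : Bicomod D E) (P : Bicomod E F) (Q : Bicomod F G) :
    cotMap (cotAssoc M N P).hom (𝟙 Q) ≫ (cotAssoc M (cotensor N P) Q).hom ≫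
      cotMap (𝟙 M) (cotAssoc N P Q).hom =
    (cotAssoc (cotensor M N) P Q).hom ≫ (cotAssoc M N (cotensor P Q)).hom :=
  hom_ext fun x => inclR_inj _ _ _ <|
    lTensor_inj M.carrier (lTensor_inj N.carrier (incl_inj P Q)) <| by
    let y := (cotAssoc M (cotensor N P) Q).hom.lin ((cotMap (cotAssoc M N P).hom (𝟙 Q)).lin x)
    let y' := (cotAssoc (cotensor M N) P Q).hom.lin x
    let X := (incl (cotensor (cotensor M N) P) Q).lin x
    have e1 : ((incl P Q).lin.lTensor N.carrier).lTensor M.carrier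
        ((inclR M N (cotensor P Q)).lin ((cotMap (𝟙 M) (cotAssoc N P Q).hom).lin y)) =
        (TensorProduct.assoc k N.carrier P.carrier Q.carrier).toLinearMap.lTensor M.carrier
          (((incl N P).lin.rTensor Q.carrier).lTensor M.carrier
            ((inclR M (cotensor N P) Q).lin y)) :=
      lTensor_comp3 (fun z => inclR_cotAssoc N P Q z) ((incl M (cotensor (cotensor N P) Q)).lin y)
    have e2 : (inclR M (cotensor N P) Q).lin y = TensorProduct.assoc k _ _ _
        ((incl M (cotensor N P)).lin.rTensor Q.carrier
          ((cotAssocHom M N P).lin.rTensor Q.carrier X)) :=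
      inclR_cotAssoc _ _ _ _
    have e3 : ((incl P Q).lin.lTensor N.carrier).lTensor M.carrier
        ((inclR M N (cotensor P Q)).lin ((cotAssoc M N (cotensor P Q)).hom.lin y')) =
        TensorProduct.assoc k M.carrier N.carrier (P.carrier ⊗[k] Q.carrier)
          ((incl M N).lin.rTensor _ ((inclR (cotensor M N) P Q).lin y')) :=
      (congrArg _ (inclR_cotAssoc M N (cotensor P Q) y')).trans <|
        (assoc_lTensor _ _).trans (congrArg _ (lr_comm _ _ _).symm)
    have e4 : (inclR (cotensor M N) P Q).lin y' = TensorProduct.assoc k _ _ _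
        ((incl (cotensor M N) P).lin.rTensor Q.carrier X) := inclR_cotAssoc _ _ _ _
    refine e1.trans (Eq.trans ?_ e3.symm)
    rw [e2, e4]
    refine Eq.trans ?_ (pentagon_aux (incl (cotensor M N) P).lin (incl M N).lin X)
    refine congrArg _ ((assoc_mTensor _ _).trans (congrArg _ ?_))
    exact rTensor_comp3 (fun z => inclR_cotAssoc M N P z) X

noncomputable instance : Bicategory (HCoalg k H) where
  Hom C D := Bicomod C D
  id C := unit C
  comp M N := cotensor M N
  whiskerLeft M _ _ g := cotMap (𝟙 M) g
  whiskerRight f N := cotMap f (𝟙 N)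
  associator M N P := cotAssoc M N P
  leftUnitor M := cotLeft M
  rightUnitor M := cotRight M
  whiskerLeft_id M N := cotMap_id M N
  whiskerLeft_comp M _ _ _ g h := by rw [← cotMap_comp, Category.comp_id]
  id_whiskerLeft g := by rw [← Category.assoc, Iso.eq_comp_inv]; exact cotLeft_nat g
  comp_whiskerLeft M N _ _ g := by
    rw [← Category.assoc, Iso.eq_comp_inv, ← cotAssoc_nat, cotMap_id]
  id_whiskerRight M N := cotMap_id M N
  comp_whiskerRight f g N := by rw [← cotMap_comp, Category.comp_id]
  whiskerRight_id g := by rw [← Category.assoc, Iso.eq_comp_inv]; exact cotRight_nat g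
  whiskerRight_comp f N P := by
    rw [Iso.eq_inv_comp, cotAssoc_nat, cotMap_id]
  whisker_assoc M _ _ g P := by
    rw [← Category.assoc, Iso.eq_comp_inv, ← cotAssoc_nat]
  whisker_exchange f g := by
    rw [← cotMap_comp, ← cotMap_comp]; simp only [Category.id_comp, Category.comp_id]
  pentagon M N P Q := cot_pentagon M N P Q
  triangle M N := cot_triangle M N

end Bicomod

/-- An object of `𝔐^C`: a right comodule over the coalgebra `C`. -/
structure RComod (k : Type u) [Field k] (C : Type u) [AddCommGroup C] [Module k C]
    [Coalgebra k C] where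
  carrier : Type u
  [addCommGroup : AddCommGroup carrier]
  [module : Module k carrier]
  rho : carrier →ₗ[k] carrier ⊗[k] C
  isRight : IsRightCoaction rho

attribute [instance] RComod.addCommGroup RComod.module

namespace RComod

section

variable {C : Type u} [AddCommGroup C] [Module k C] [Coalgebra k C]

/-- A morphism of right comodules: a colinear map. -/
@[ext]
structure Hom (M N : RComod k C) where
  lin : M.carrier →ₗ[k] N.carrier
  rho : RColin M.rho N.rho lin

instance : Category (RComod k C) where
  Hom := Hom
  id M := ⟨LinearMap.id, fun _ => by simp⟩
  comp f g := ⟨g.lin ∘ₗ f.lin, g.rho.comp f.rho⟩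

theorem hom_ext {M N : RComod k C} {f g : M ⟶ N} (h : ∀ x, f.lin x = g.lin x) : f = g :=
  Hom.ext (LinearMap.ext h)

theorem lin_injective {M N : RComod k C} : Function.Injective (Hom.lin : (M ⟶ N) → _) :=
  fun _ _ h => Hom.ext h

@[simp] theorem id_lin (M : RComod k C) : Hom.lin (𝟙 M) = LinearMap.id := rfl

@[simp] theorem comp_lin {M N P : RComod k C} (f : M ⟶ N) (g : N ⟶ P) :
    Hom.lin (f ≫ g) = g.lin ∘ₗ f.lin := rfl

/-- The colinear maps form a subspace of the linear maps. -/
def homSub (M N : RComod k C) : Submodule k (M.carrier →ₗ[k] N.carrier) where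
  carrier := {f | RColin M.rho N.rho f}
  add_mem' hf hg := fun v => by
    rw [LinearMap.add_apply, map_add, hf v, hg v, LinearMap.rTensor_add, LinearMap.add_apply]
  zero_mem' := fun v => by simp
  smul_mem' c f hf := fun v => by
    rw [LinearMap.smul_apply, map_smul, hf v, LinearMap.rTensor_smul, LinearMap.smul_apply]

def homEquiv (M N : RComod k C) : (M ⟶ N) ≃ homSub M N where
  toFun f := ⟨f.lin, f.rho⟩
  invFun f := ⟨f.1, f.2⟩

instance (M N : RComod k C) : AddCommGroup (M ⟶ N) := (homEquiv M N).addCommGroup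

instance (M N : RComod k C) : Module k (M ⟶ N) := (homEquiv M N).module k

instance : Preadditive (RComod k C) where
  add_comp _ _ _ _ _ g := Hom.ext (LinearMap.ext fun _ => map_add g.lin _ _)
  comp_add _ _ _ _ _ _ := Hom.ext (LinearMap.ext fun _ => rfl)

instance : Linear k (RComod k C) where
  smul_comp _ _ _ _ _ g := Hom.ext (LinearMap.ext fun _ => map_smul g.lin _ _)
  comp_smul _ _ _ _ _ _ := Hom.ext (LinearMap.ext fun _ => rfl)

/-- A bijective colinear map is an isomorphism. -/
def isoOf {M N : RComod k C} (e : M.carrier ≃ₗ[k] N.carrier)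
    (he : RColin M.rho N.rho e.toLinearMap) : M ≅ N where
  hom := ⟨e.toLinearMap, he⟩
  inv := ⟨e.symm.toLinearMap, RColin.of_comp e.injective he fun v => by
    have : e.toLinearMap ∘ₗ e.symm.toLinearMap = LinearMap.id := by ext; simp
    rw [this, LinearMap.rTensor_id]; rfl⟩
  hom_inv_id := hom_ext e.symm_apply_apply
  inv_hom_id := hom_ext e.apply_symm_apply

end

/-- `x ⊗ m ↦ x₍₀₎ ⊗ m₍₀₎ ⊗ x₍₁₎ m₍₁₎` -/
noncomputable def tensRho {H' C X M : Type u} [AddCommGroup H'] [Module k H'] [AddCommGroup C]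
    [Module k C] [AddCommGroup X] [Module k X] [AddCommGroup M] [Module k M]
    (act : H' →ₗ[k] C →ₗ[k] C) (ρ : X →ₗ[k] X ⊗[k] H') (ρ' : M →ₗ[k] M ⊗[k] C) :
    X ⊗[k] M →ₗ[k] (X ⊗[k] M) ⊗[k] C :=
  (TensorProduct.lift act).lTensor (X ⊗[k] M) ∘ₗ
    (TensorProduct.tensorTensorTensorComm k X H' M C).toLinearMap ∘ₗ TensorProduct.map ρ ρ'

theorem tens_isRight (C : HCoalg k H) {X M : Type u} [AddCommGroup X] [Module k X] [AddCommGroup M]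
    [Module k M] {ρ : X →ₗ[k] X ⊗[k] H} {ρ' : M →ₗ[k] M ⊗[k] C.carrier} (hX : IsRightCoaction ρ)
    (hM : IsRightCoaction ρ') : IsRightCoaction (tensRho C.act.toLinearMap ρ ρ') where
  coassoc t := by
    induction t with
    | zero => simp
    | add x y hx hy => simp only [map_add, hx, hy]
    | tmul x m =>
      let Q : (X ⊗[k] (H ⊗[k] H)) ⊗[k] (M ⊗[k] (C.carrier ⊗[k] C.carrier)) →ₗ[k]
          (X ⊗[k] M) ⊗[k] (C.carrier ⊗[k] C.carrier) :=
        (TensorProduct.map (TensorProduct.lift C.act.toLinearMap)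
            (TensorProduct.lift C.act.toLinearMap) ∘ₗ
          (TensorProduct.tensorTensorTensorComm k H H C.carrier C.carrier).toLinearMap).lTensor _ ∘ₗ
        (TensorProduct.tensorTensorTensorComm k X (H ⊗[k] H) M _).toLinearMap
      have h1 : ∀ (a : X ⊗[k] H) (b : M ⊗[k] C.carrier),
          TensorProduct.assoc k (X ⊗[k] M) C.carrier C.carrier
            ((tensRho C.act.toLinearMap ρ ρ').rTensor C.carrier
              ((TensorProduct.lift C.act.toLinearMap).lTensor _
                (TensorProduct.tensorTensorTensorComm k X H M C.carrier (a ⊗ₜ b)))) =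
          Q (TensorProduct.assoc k X H H (ρ.rTensor H a) ⊗ₜ
            TensorProduct.assoc k M C.carrier C.carrier (ρ'.rTensor _ b)) := by
        intro a b
        induction a with
        | zero => simp
        | add x y hx hy => simp only [map_add, TensorProduct.add_tmul, hx, hy]
        | tmul x h =>
        induction b with
        | zero => simp
        | add x y hx hy => simp only [map_add, TensorProduct.tmul_add, hx, hy]
        | tmul m c =>
          simp only [TensorProduct.tensorTensorTensorComm_tmul, LinearMap.lTensor_tmul,
            LinearMap.rTensor_tmul, TensorProduct.lift.tmul, tensRho, LinearMap.comp_apply,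
            TensorProduct.map_tmul, LinearEquiv.coe_coe]
          generalize ρ x = a
          generalize ρ' m = b
          induction a with
          | zero => simp
          | add x y hx hy => simp only [map_add, TensorProduct.add_tmul, hx, hy]
          | tmul x h =>
          induction b with
          | zero => simp
          | add x y hx hy =>
            simp only [map_add, TensorProduct.tmul_add, TensorProduct.add_tmul, hx, hy]
          | tmul m c => rfl
      have h2 : ∀ (a : X ⊗[k] H) (b : M ⊗[k] C.carrier),
          (Coalgebra.comul (R := k) (A := C.carrier)).lTensor _
              ((TensorProduct.lift C.act.toLinearMap).lTensor _
                (TensorProduct.tensorTensorTensorComm k X H M C.carrier (a ⊗ₜ b))) =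
          Q ((Coalgebra.comul (R := k) (A := H)).lTensor X a ⊗ₜ
            (Coalgebra.comul (R := k) (A := C.carrier)).lTensor M b) := by
        intro a b
        induction a with
        | zero => simp
        | add x y hx hy => simp only [map_add, TensorProduct.add_tmul, hx, hy]
        | tmul x h =>
        induction b with
        | zero => simp
        | add x y hx hy => simp only [map_add, TensorProduct.tmul_add, hx, hy]
        | tmul m c =>
          simp only [TensorProduct.tensorTensorTensorComm_tmul, LinearMap.lTensor_tmul,
            TensorProduct.lift.tmul, AlgHom.toLinearMap_apply, C.comul_act, diag_apply]
          rfl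
      exact (h1 _ _).trans (((congrArg₂ (fun a b => Q (a ⊗ₜ b)) (hX.coassoc x)
        (hM.coassoc m))).trans (h2 _ _).symm)
  counit t := by
    induction t with
    | zero => simp
    | add x y hx hy => simp only [map_add, hx, hy]
    | tmul x m =>
      have h1 : ∀ (a : X ⊗[k] H) (b : M ⊗[k] C.carrier),
          TensorProduct.rid k (X ⊗[k] M) ((Coalgebra.counit (R := k) (A := C.carrier)).lTensor _
              ((TensorProduct.lift C.act.toLinearMap).lTensor _
                (TensorProduct.tensorTensorTensorComm k X H M C.carrier (a ⊗ₜ b)))) =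
          TensorProduct.rid k X ((Coalgebra.counit (R := k) (A := H)).lTensor X a) ⊗ₜ
            TensorProduct.rid k M ((Coalgebra.counit (R := k) (A := C.carrier)).lTensor M b) := by
        intro a b
        induction a with
        | zero => simp
        | add x y hx hy => simp only [map_add, TensorProduct.add_tmul, hx, hy]
        | tmul x h =>
        induction b with
        | zero => simp
        | add x y hx hy => simp only [map_add, TensorProduct.tmul_add, hx, hy]
        | tmul m c =>
          simp [C.counit_act, TensorProduct.smul_tmul', TensorProduct.tmul_smul, ← mul_smul,
            mul_comm]
      exact (h1 _ _).trans (congrArg₂ _ (hX.counit x) (hM.counit m))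

theorem tensRho_map {H' C X M X' M' : Type u} [AddCommGroup H'] [Module k H'] [AddCommGroup C]
    [Module k C] [AddCommGroup X] [Module k X] [AddCommGroup M] [Module k M]
    [AddCommGroup X'] [Module k X'] [AddCommGroup M'] [Module k M'] [Coalgebra k H'] [Coalgebra k C]
    (act : H' →ₗ[k] C →ₗ[k] C) {ρX : X →ₗ[k] X ⊗[k] H'} {ρM : M →ₗ[k] M ⊗[k] C}
    {ρX' : X' →ₗ[k] X' ⊗[k] H'} {ρM' : M' →ₗ[k] M' ⊗[k] C} {f : X →ₗ[k] X'} {g : M →ₗ[k] M'}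
    (hf : RColin ρX ρX' f) (hg : RColin ρM ρM' g) :
    RColin (tensRho act ρX ρM) (tensRho act ρX' ρM') (TensorProduct.map f g) := by
  intro t
  induction t with
  | zero => simp
  | add x y hx hy => simp only [map_add, hx, hy]
  | tmul x m =>
    simp only [tensRho, LinearMap.comp_apply, TensorProduct.map_tmul, hf x, hg m,
      LinearEquiv.coe_coe]
    generalize ρX x = a
    generalize ρM m = b
    induction a with
    | zero => simp
    | add x y hx hy => simp only [map_add, TensorProduct.add_tmul, hx, hy]
    | tmul x h =>
    induction b with
    | zero => simp
    | add x y hx hy => simp only [map_add, TensorProduct.tmul_add, hx, hy]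
    | tmul m c => rfl

/-- `X ⊗ M ∈ 𝔐^C` for `X ∈ 𝔐^H` and `M ∈ 𝔐^C`. -/
noncomputable def tens (C : HCoalg k H) (X : RComod k H) (M : RComod k C.carrier) :
    RComod k C.carrier where
  carrier := X.carrier ⊗[k] M.carrier
  rho := tensRho C.act.toLinearMap X.rho M.rho
  isRight := tens_isRight C X.isRight M.isRight

noncomputable def tensMap (C : HCoalg k H) {X Y : RComod k H} {M N : RComod k C.carrier}
    (f : X ⟶ Y) (g : M ⟶ N) : tens C X M ⟶ tens C Y N :=
  ⟨TensorProduct.map f.lin g.lin, tensRho_map _ f.rho g.rho⟩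

/-- `H` as a left module coalgebra over itself. -/
noncomputable abbrev regular (k : Type u) [Field k] (H : Type u) [Ring H] [Bialgebra k H] :
    HCoalg k H where
  carrier := H
  act := Algebra.lmul k H
  comul_act h c := by
    have key : ∀ s t : H ⊗[k] H, TensorProduct.map (TensorProduct.lift (Algebra.lmul k H).toLinearMap)
        (TensorProduct.lift (Algebra.lmul k H).toLinearMap)
        (TensorProduct.tensorTensorTensorComm k H H H H (s ⊗ₜ t)) = s * t := by
      intro s t
      induction s with
      | zero => simp
      | add x y hx hy => simp only [map_add, TensorProduct.add_tmul, hx, hy, add_mul]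
      | tmul x h =>
      induction t with
      | zero => simp
      | add x y hx hy => simp only [map_add, TensorProduct.tmul_add, hx, hy, mul_add]
      | tmul m c =>
        simp only [TensorProduct.tensorTensorTensorComm_tmul, TensorProduct.map_tmul,
          TensorProduct.lift.tmul, Algebra.TensorProduct.tmul_mul_tmul]
        rfl
    rw [diag_apply, key]
    exact Bialgebra.comul_mul h c
  counit_act h c := by simp

/-- `(x ⊗ y) ⊗ m ↦ x ⊗ (y ⊗ m)` is colinear. -/
theorem rcolin_tensAssoc (C : HCoalg k H) {X Y M : Type u} [AddCommGroup X] [Module k X]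
    [AddCommGroup Y] [Module k Y] [AddCommGroup M] [Module k M] (ρX : X →ₗ[k] X ⊗[k] H)
    (ρY : Y →ₗ[k] Y ⊗[k] H) (ρM : M →ₗ[k] M ⊗[k] C.carrier) :
    RColin (tensRho C.act.toLinearMap (tensRho (Algebra.lmul k H).toLinearMap ρX ρY) ρM)
      (tensRho C.act.toLinearMap ρX (tensRho C.act.toLinearMap ρY ρM))
      (TensorProduct.assoc k X Y M).toLinearMap := by
  intro t
  induction t with
  | zero => simp
  | add x y hx hy => simp only [map_add, hx, hy]
  | tmul t m =>
  induction t with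
  | zero => simp
  | add x y hx hy => simp only [map_add, TensorProduct.add_tmul, hx, hy]
  | tmul x y =>
    simp only [tensRho, LinearMap.comp_apply, TensorProduct.map_tmul,
      LinearEquiv.coe_coe, TensorProduct.assoc_tmul]
    generalize ρX x = a
    generalize ρY y = b
    generalize ρM m = c
    induction a with
    | zero => simp
    | add x y hx hy => simp only [map_add, TensorProduct.add_tmul, hx, hy]
    | tmul x h =>
    induction b with
    | zero => simp
    | add x y hx hy => simp only [map_add, TensorProduct.tmul_add, TensorProduct.add_tmul, hx, hy]
    | tmul y h' =>
    induction c with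
    | zero => simp
    | add x y hx hy => simp only [map_add, TensorProduct.tmul_add, hx, hy]
    | tmul m c =>
      simp [Module.End.mul_apply]

/-- `k` with the trivial coaction `1 ↦ 1 ⊗ 1`. -/
noncomputable def triv (k : Type u) [Field k] (H : Type u) [Ring H] [Bialgebra k H] :
    RComod k H where
  carrier := k
  rho := (TensorProduct.mk k k H).flip 1
  isRight :=
    { coassoc := fun m => by
        simp [Bialgebra.comul_one, Algebra.TensorProduct.one_def]
      counit := fun m => by simp }

theorem rcolin_lid (C : HCoalg k H) {M : Type u} [AddCommGroup M] [Module k M]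
    (ρM : M →ₗ[k] M ⊗[k] C.carrier) :
    RColin (tensRho C.act.toLinearMap ((TensorProduct.mk k k H).flip 1) ρM) ρM
      (TensorProduct.lid k M).toLinearMap := by
  intro t
  induction t with
  | zero => simp
  | add x y hx hy => simp only [map_add, hx, hy]
  | tmul x m =>
    simp only [tensRho, LinearMap.comp_apply, TensorProduct.map_tmul,
      LinearEquiv.coe_coe, TensorProduct.lid_tmul, map_smul]
    generalize ρM m = c
    induction c with
    | zero => simp
    | add x y hx hy => simp only [map_add, TensorProduct.tmul_add, smul_add, hx, hy]
    | tmul m c => simp [TensorProduct.smul_tmul']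

theorem rcolin_rid {X : Type u} [AddCommGroup X] [Module k X] (ρX : X →ₗ[k] X ⊗[k] H) :
    RColin (tensRho (Algebra.lmul k H).toLinearMap ρX ((TensorProduct.mk k k H).flip 1)) ρX
      (TensorProduct.rid k X).toLinearMap := by
  intro t
  induction t with
  | zero => simp
  | add x y hx hy => simp only [map_add, hx, hy]
  | tmul x m =>
    simp only [tensRho, LinearMap.comp_apply, TensorProduct.map_tmul,
      LinearEquiv.coe_coe, TensorProduct.rid_tmul, map_smul]
    generalize ρX x = c
    induction c with
    | zero => simp
    | add x y hx hy => simp only [map_add, TensorProduct.add_tmul, smul_add, hx, hy]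
    | tmul m c => simp [TensorProduct.smul_tmul']

noncomputable def tensAssoc (C : HCoalg k H) (X Y : RComod k H) (M : RComod k C.carrier) :
    tens C (tens (regular k H) X Y) M ≅ tens C X (tens C Y M) :=
  isoOf (TensorProduct.assoc k X.carrier Y.carrier M.carrier) (rcolin_tensAssoc C X.rho Y.rho M.rho)

noncomputable def tensUnit (C : HCoalg k H) (M : RComod k C.carrier) : tens C (triv k H) M ≅ M :=
  isoOf (TensorProduct.lid k M.carrier) (rcolin_lid C M.rho)

/-- The monoidal category `𝔐^H`. -/
noncomputable instance : MonoidalCategory (RComod k H) where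
  tensorObj X Y := tens (regular k H) X Y
  whiskerLeft X _ _ g := tensMap (regular k H) (𝟙 X) g
  whiskerRight f Y := tensMap (regular k H) f (𝟙 Y)
  tensorHom f g := tensMap (regular k H) f g
  tensorUnit := triv k H
  associator X Y Z := tensAssoc (regular k H) X Y Z
  leftUnitor X := tensUnit (regular k H) X
  rightUnitor X := isoOf (TensorProduct.rid k X.carrier) (rcolin_rid X.rho)
  tensorHom_def f g := Hom.ext (TensorProduct.ext' fun x y => rfl)
  id_tensorHom_id X Y := Hom.ext TensorProduct.map_id
  tensorHom_comp_tensorHom f₁ f₂ g₁ g₂ := Hom.ext (TensorProduct.ext' fun x y => rfl)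
  whiskerLeft_id X Y := Hom.ext TensorProduct.map_id
  id_whiskerRight X Y := Hom.ext TensorProduct.map_id
  associator_naturality f g h := Hom.ext (TensorProduct.ext_threefold fun x y z => rfl)
  leftUnitor_naturality f := Hom.ext (TensorProduct.ext' fun (x : k) y => (map_smul f.lin x y).symm)
  rightUnitor_naturality f := Hom.ext
    (TensorProduct.ext' fun x (y : k) => (map_smul f.lin y x).symm)
  pentagon W X Y Z := Hom.ext (TensorProduct.ext_fourfold fun w x y z => rfl)
  triangle X Y := Hom.ext (TensorProduct.ext_threefold fun x (r : k) y =>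
    (TensorProduct.smul_tmul r x y).symm)

/-- `𝔐^C` as a left module category over `𝔐^H`. -/
noncomputable instance (C : HCoalg k H) : MonoidalCategory.MonoidalLeftAction (RComod k H)
    (RComod k C.carrier) where
  actionObj X M := tens C X M
  actionHomLeft f M := tensMap C f (𝟙 M)
  actionHomRight X _ _ g := tensMap C (𝟙 X) g
  actionHom f g := tensMap C f g
  actionAssocIso X Y M := tensAssoc C X Y M
  actionUnitIso M := tensUnit C M
  actionHom_def f g := Hom.ext (TensorProduct.ext' fun x y => rfl)
  actionHomRight_id X Y := Hom.ext TensorProduct.map_id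
  id_actionHomLeft X Y := Hom.ext TensorProduct.map_id
  actionHom_comp f₁ f₂ g₁ g₂ := Hom.ext (TensorProduct.ext' fun x y => rfl)
  actionAssocIso_hom_naturality f g h := Hom.ext (TensorProduct.ext_threefold fun x y z => rfl)
  actionUnitIso_hom_naturality f :=
    Hom.ext (TensorProduct.ext' fun (x : k) y => (map_smul f.lin x y))
  whiskerLeft_actionHomLeft X _ _ f M := Hom.ext (TensorProduct.ext_threefold fun x y z => rfl)
  whiskerRight_actionHomLeft Y f M := Hom.ext (TensorProduct.ext_threefold fun x y z => rfl)
  associator_actionHom X Y Z M := Hom.ext (TensorProduct.ext_fourfold fun w x y z => rfl)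
  leftUnitor_actionHom X M := Hom.ext (TensorProduct.ext_threefold fun (r : k) x y => rfl)
  rightUnitor_actionHom X M := Hom.ext (TensorProduct.ext_threefold fun x (r : k) y =>
    (TensorProduct.smul_tmul r x y))

end RComod

section ModuleCategories

open MonoidalCategory MonoidalLeftAction Functor.LaxLeftLinear Limits

variable (k H)

/-- A `k`-linear left module category over `𝔐^H`. -/
structure ModCat where
  carrier : Type (u + 1)
  [category : Category.{u} carrier]
  [preadditive : Preadditive carrier]
  [linear : Linear k carrier]
  [action : MonoidalLeftAction (RComod k H) carrier]

attribute [instance] ModCat.category ModCat.preadditive ModCat.linear ModCat.action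

variable {k H}

/-- `𝔐^C` as a left `𝔐^H`-module category. -/
noncomputable def comodCat (C : HCoalg k H) : ModCat k H where
  carrier := RComod k C.carrier

/-- A lax left `𝔐^H`-module functor, with structure morphism
`μₗ : X ⊗ F(M) ⟶ F(X ⊗ M)` (not assumed invertible). -/
structure LaxFun (M N : ModCat k H) where
  functor : M.carrier ⥤ N.carrier
  [additive : functor.Additive]
  [linear : functor.Linear k]
  [lax : functor.LaxLeftLinear (RComod k H)]

attribute [instance] LaxFun.additive LaxFun.linear LaxFun.lax

/-- A morphism of lax module functors: a natural transformation compatible with the structure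
morphisms. -/
@[ext]
structure ModNat {M N : ModCat k H} (F G : LaxFun M N) where
  nat : F.functor ⟶ G.functor
  comm : ∀ (X : RComod k H) (A : M.carrier),
    X ⊴ₗ nat.app A ≫ μₗ G.functor X A = μₗ F.functor X A ≫ nat.app (X ⊙ₗ A)

variable {M N P Q : ModCat k H}

def ModNat.id (F : LaxFun M N) : ModNat F F := ⟨𝟙 F.functor, fun X A => by simp⟩

def ModNat.comp {F G K : LaxFun M N} (f : ModNat F G) (g : ModNat G K) : ModNat F K :=
  ⟨f.nat ≫ g.nat, fun X A => by
    rw [NatTrans.comp_app, NatTrans.comp_app, actionHomRight_comp, Category.assoc, g.comm,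
      ← Category.assoc, f.comm, Category.assoc]⟩

theorem ModNat.ext_app {F G : LaxFun M N} {f g : ModNat F G}
    (h : ∀ A, f.nat.app A = g.nat.app A) : f = g :=
  ModNat.ext (NatTrans.ext (funext h))

instance : Category (LaxFun M N) where
  Hom F G := ModNat F G
  id F := ModNat.id F
  comp f g := ModNat.comp f g
  id_comp f := ModNat.ext (Category.id_comp f.nat)
  comp_id f := ModNat.ext (Category.comp_id f.nat)
  assoc f g h := ModNat.ext (Category.assoc f.nat g.nat h.nat)

/-- The identity module functor. -/
def LaxFun.id (M : ModCat k H) : LaxFun M M where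
  functor := 𝟭 M.carrier
  lax := { μₗ := fun X A => 𝟙 _ }

/-- The composite `G ∘ F` of `F : M → N` and `G : N → P`. -/
def LaxFun.comp (F : LaxFun M N) (G : LaxFun N P) : LaxFun M P where
  functor := F.functor ⋙ G.functor
  lax :=
    { μₗ := fun X A => μₗ G.functor X (F.functor.obj A) ≫ G.functor.map (μₗ F.functor X A)
      μₗ_naturality_left := fun f A => by
        simp only [Functor.comp_obj, Functor.comp_map, Category.assoc, ← Functor.map_comp]
        rw [μₗ_naturality_left_assoc, ← Functor.map_comp, μₗ_naturality_left]
      μₗ_naturality_right := fun X _ _ f => by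
        simp only [Functor.comp_obj, Functor.comp_map, Category.assoc, ← Functor.map_comp]
        rw [μₗ_naturality_right_assoc, ← Functor.map_comp, μₗ_naturality_right]
      μₗ_associativity := fun X Y A => by
        simp only [Functor.comp_obj, Functor.comp_map, Category.assoc, ← Functor.map_comp]
        rw [μₗ_associativity, Functor.map_comp, μₗ_associativity_assoc, actionHomRight_comp,
          Category.assoc, Functor.map_comp, μₗ_naturality_right_assoc]
      μₗ_unitality := fun A => by
        simp only [Functor.comp_obj, Functor.comp_map, Category.assoc, ← Functor.map_comp]
        rw [← μₗ_unitality, ← μₗ_unitality] }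

/-- Equivalence of left `𝔐^H`-module categories: lax module functors in both directions whose
composites are isomorphic to the identities as lax module functors. -/
def ModCat.Equivalent (M N : ModCat k H) : Prop :=
  ∃ (F : LaxFun M N) (G : LaxFun N M), Nonempty (F.comp G ≅ LaxFun.id M) ∧
    Nonempty (G.comp F ≅ LaxFun.id N)

/-- The underlying functor is of type `𝓛`: it is left exact and preserves small coproducts
(linearity is part of `LaxFun`). -/
structure LaxFun.TypeL (F : LaxFun M N) : Prop where
  leftExact : PreservesFiniteLimits F.functor
  coproducts : ∀ J : Type u, PreservesColimitsOfShape (Discrete J) F.functor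

theorem LaxFun.TypeL.comp {F : LaxFun M N} {G : LaxFun N P} (hF : F.TypeL) (hG : G.TypeL) :
    (F.comp G).TypeL where
  leftExact := by
    have := hF.leftExact; have := hG.leftExact
    exact comp_preservesFiniteLimits F.functor G.functor
  coproducts J := by
    have := hF.coproducts J; have := hG.coproducts J
    exact comp_preservesColimitsOfShape F.functor G.functor

theorem LaxFun.TypeL.id (M : ModCat k H) : (LaxFun.id M).TypeL where
  leftExact := inferInstanceAs (PreservesFiniteLimits (𝟭 M.carrier))
  coproducts J := inferInstanceAs (PreservesColimitsOfShape (Discrete J) (𝟭 M.carrier))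

variable (k H) in
/-- The 0-cells of `𝔐^H-Mod`: left `𝔐^H`-module categories that are equivalent to `𝔐^C` for some
left `H`-module coalgebra `C`. -/
structure HMod where
  cat : ModCat k H
  equiv_comod : ∃ C : HCoalg k H, cat.Equivalent (comodCat C)

/-- The 1-cells of `𝔐^H-Mod`: lax left module functors of type `𝓛`. -/
structure HMod.Hom (M N : HMod k H) where
  val : LaxFun M.cat N.cat
  typeL : val.TypeL

/-- Whiskering of morphisms of lax module functors. -/
def ModNat.whiskerLeft (F : LaxFun M N) {G G' : LaxFun N P} (f : ModNat G G') :
    ModNat (F.comp G) (F.comp G') :=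
  ⟨Functor.whiskerLeft F.functor f.nat, fun X A => by
    show X ⊴ₗ f.nat.app (F.functor.obj A) ≫ μₗ G'.functor X (F.functor.obj A) ≫
      G'.functor.map (μₗ F.functor X A) = (μₗ G.functor X (F.functor.obj A) ≫
        G.functor.map (μₗ F.functor X A)) ≫ f.nat.app (F.functor.obj (X ⊙ₗ A))
    rw [← Category.assoc, f.comm, Category.assoc, Category.assoc, f.nat.naturality]⟩

def ModNat.whiskerRight {F F' : LaxFun M N} (f : ModNat F F') (G : LaxFun N P) :
    ModNat (F.comp G) (F'.comp G) :=
  ⟨Functor.whiskerRight f.nat G.functor, fun X A => by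
    show X ⊴ₗ G.functor.map (f.nat.app A) ≫ μₗ G.functor X (F'.functor.obj A) ≫
      G.functor.map (μₗ F'.functor X A) = (μₗ G.functor X (F.functor.obj A) ≫
        G.functor.map (μₗ F.functor X A)) ≫ G.functor.map (f.nat.app (X ⊙ₗ A))
    rw [μₗ_naturality_right_assoc, Category.assoc, ← Functor.map_comp, f.comm, Functor.map_comp]⟩

theorem LaxFun.assoc_comm (F : LaxFun M N) (G : LaxFun N P) (K : LaxFun P Q) (X : RComod k H)
    (A : M.carrier) : μₗ ((F.comp G).comp K).functor X A = μₗ (F.comp (G.comp K)).functor X A := by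
  show μₗ K.functor X (G.functor.obj (F.functor.obj A)) ≫ K.functor.map
      (μₗ G.functor X (F.functor.obj A) ≫ G.functor.map (μₗ F.functor X A)) =
    (μₗ K.functor X (G.functor.obj (F.functor.obj A)) ≫ K.functor.map
      (μₗ G.functor X (F.functor.obj A))) ≫ K.functor.map (G.functor.map (μₗ F.functor X A))
  rw [Functor.map_comp, Category.assoc]

theorem LaxFun.id_comp_comm (F : LaxFun M N) (X : RComod k H) (A : M.carrier) :
    μₗ ((LaxFun.id M).comp F).functor X A = μₗ F.functor X A := by
  show μₗ F.functor X A ≫ F.functor.map (𝟙 (X ⊙ₗ A)) = _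
  rw [CategoryTheory.Functor.map_id, Category.comp_id]

theorem LaxFun.comp_id_comm (F : LaxFun M N) (X : RComod k H) (A : M.carrier) :
    μₗ (F.comp (LaxFun.id N)).functor X A = μₗ F.functor X A := by
  show 𝟙 (X ⊙ₗ F.functor.obj A) ≫ μₗ F.functor X A = _
  rw [Category.id_comp]

theorem id_square {X : RComod k H} {A : N.carrier} {B : N.carrier} {f g : X ⊙ₗ A ⟶ B} (h : f = g) :
    X ⊴ₗ 𝟙 A ≫ f = g ≫ 𝟙 B := by
  rw [actionHomRight_id, Category.id_comp, Category.comp_id, h]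

/-! The associators and unitors of functors are morphisms of lax module functors. -/

def LaxFun.assocHom (F : LaxFun M N) (G : LaxFun N P) (K : LaxFun P Q) :
    ModNat ((F.comp G).comp K) (F.comp (G.comp K)) where
  nat := (Functor.associator F.functor G.functor K.functor).hom
  comm X A := id_square (LaxFun.assoc_comm F G K X A).symm

def LaxFun.assocInv (F : LaxFun M N) (G : LaxFun N P) (K : LaxFun P Q) :
    ModNat (F.comp (G.comp K)) ((F.comp G).comp K) where
  nat := (Functor.associator F.functor G.functor K.functor).inv
  comm X A := id_square (LaxFun.assoc_comm F G K X A)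

def LaxFun.leftHom (F : LaxFun M N) : ModNat ((LaxFun.id M).comp F) F where
  nat := (Functor.leftUnitor F.functor).hom
  comm X A := id_square (LaxFun.id_comp_comm F X A).symm

def LaxFun.leftInv (F : LaxFun M N) : ModNat F ((LaxFun.id M).comp F) where
  nat := (Functor.leftUnitor F.functor).inv
  comm X A := id_square (LaxFun.id_comp_comm F X A)

def LaxFun.rightHom (F : LaxFun M N) : ModNat (F.comp (LaxFun.id N)) F where
  nat := (Functor.rightUnitor F.functor).hom
  comm X A := id_square (LaxFun.comp_id_comm F X A).symm

def LaxFun.rightInv (F : LaxFun M N) : ModNat F (F.comp (LaxFun.id N)) where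
  nat := (Functor.rightUnitor F.functor).inv
  comm X A := id_square (LaxFun.comp_id_comm F X A)

theorem app_id_id {A B : N.carrier} (f : A ⟶ B) : f = 𝟙 A ≫ f ≫ 𝟙 B := by simp

theorem ModNat.exchange {F G : LaxFun M N} {K L : LaxFun N P} (f : ModNat F G) (g : ModNat K L) :
    (ModNat.whiskerLeft F g).comp (ModNat.whiskerRight f L) =
      (ModNat.whiskerRight f K).comp (ModNat.whiskerLeft G g) :=
  ModNat.ext_app fun A => (g.nat.naturality (f.nat.app A)).symm

namespace HMod

/-- The 2-cells of `𝔐^H-Mod` are the morphisms of lax module functors. -/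
instance (M N : HMod k H) : Category (HMod.Hom M N) where
  Hom F G := ModNat F.val G.val
  id F := ModNat.id F.val
  comp f g := ModNat.comp f g
  id_comp f := ModNat.ext (Category.id_comp f.nat)
  comp_id f := ModNat.ext (Category.comp_id f.nat)
  assoc f g h := ModNat.ext (Category.assoc f.nat g.nat h.nat)

/-- The 2-category `𝔐^H-Mod`. The composite `F ≫ G` of 1-cells `F : M → N` and `G : N → P` is the
composite functor `G ∘ F`. -/
instance : Bicategory (HMod k H) where
  Hom M N := HMod.Hom M N
  id M := ⟨LaxFun.id M.cat, .id M.cat⟩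
  comp F G := ⟨F.val.comp G.val, F.typeL.comp G.typeL⟩
  whiskerLeft F _ _ f := ModNat.whiskerLeft F.val f
  whiskerRight f G := ModNat.whiskerRight f G.val
  associator F G K :=
    { hom := LaxFun.assocHom F.val G.val K.val
      inv := LaxFun.assocInv F.val G.val K.val
      hom_inv_id := ModNat.ext_app fun A => Category.id_comp _
      inv_hom_id := ModNat.ext_app fun A => Category.id_comp _ }
  leftUnitor F :=
    { hom := LaxFun.leftHom F.val
      inv := LaxFun.leftInv F.val
      hom_inv_id := ModNat.ext_app fun A => Category.id_comp _
      inv_hom_id := ModNat.ext_app fun A => Category.id_comp _ }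
  rightUnitor F :=
    { hom := LaxFun.rightHom F.val
      inv := LaxFun.rightInv F.val
      hom_inv_id := ModNat.ext_app fun A => Category.id_comp _
      inv_hom_id := ModNat.ext_app fun A => Category.id_comp _ }
  whiskerLeft_id F G := rfl
  whiskerLeft_comp F _ _ _ f g := rfl
  id_whiskerLeft f := ModNat.ext_app fun A => app_id_id (ModNat.nat f |>.app A)
  comp_whiskerLeft F G _ _ f := ModNat.ext_app fun A =>
    app_id_id ((ModNat.nat f).app (G.val.functor.obj (F.val.functor.obj A)))
  id_whiskerRight F G := ModNat.ext_app fun A => G.val.functor.map_id _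
  comp_whiskerRight f g G := ModNat.ext_app fun A => G.val.functor.map_comp _ _
  whiskerRight_id f := ModNat.ext_app fun A => app_id_id (ModNat.nat f |>.app A)
  whiskerRight_comp f G K := ModNat.ext_app fun A =>
    app_id_id (K.val.functor.map (G.val.functor.map ((ModNat.nat f).app A)))
  whisker_assoc F _ _ f K := ModNat.ext_app fun A =>
    app_id_id (K.val.functor.map ((ModNat.nat f).app (F.val.functor.obj A)))
  whisker_exchange f g := ModNat.exchange f g
  pentagon F G K L := by
    refine ModNat.ext_app fun A => ?_
    show L.val.functor.map (𝟙 _) ≫ 𝟙 _ ≫ 𝟙 _ = 𝟙 _ ≫ 𝟙 _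
    rw [CategoryTheory.Functor.map_id]
    exact Category.id_comp _
  triangle F G := by
    refine ModNat.ext_app fun A => ?_
    show 𝟙 _ ≫ 𝟙 _ = G.val.functor.map (𝟙 _)
    rw [CategoryTheory.Functor.map_id]
    exact Category.id_comp _

end HMod

end ModuleCategories

section Lax

variable {X X' Y W W' A B : Type u} [AddCommGroup X] [Module k X] [AddCommGroup X'] [Module k X']
  [AddCommGroup Y] [Module k Y] [AddCommGroup W] [Module k W] [AddCommGroup W'] [Module k W']
  [AddCommGroup A] [Module k A] [AddCommGroup B] [Module k B]

/-- `x ⊗ (w ⊗ m) ↦ (x₍₀₎ ⊗ w) ⊗ x₍₁₎ m` -/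
noncomputable def amb (W : Type u) [AddCommGroup W] [Module k W] (a : H →ₐ[k] Module.End k A)
    (ρ : X →ₗ[k] X ⊗[k] H) : X ⊗[k] (W ⊗[k] A) →ₗ[k] (X ⊗[k] W) ⊗[k] A :=
  (TensorProduct.lift a.toLinearMap).lTensor (X ⊗[k] W) ∘ₗ
    (TensorProduct.tensorTensorTensorComm k X H W A).toLinearMap ∘ₗ ρ.rTensor (W ⊗[k] A)

theorem amb_tmul (a : H →ₐ[k] Module.End k A) (ρ : X →ₗ[k] X ⊗[k] H) (x : X) (w : W) (m : A) :
    amb W a ρ (x ⊗ₜ (w ⊗ₜ m)) =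
      TensorProduct.map ((TensorProduct.mk k X W).flip w) (a.toLinearMap.flip m) (ρ x) := by
  simp only [amb, LinearMap.comp_apply, LinearMap.rTensor_tmul]
  generalize ρ x = t
  induction t with
  | zero => simp
  | add x y hx hy => simp only [map_add, TensorProduct.add_tmul, hx, hy]
  | tmul x h => rfl

theorem tensRho_eq (a : H →ₐ[k] Module.End k A) (ρ : X →ₗ[k] X ⊗[k] H) (ρW : W →ₗ[k] W ⊗[k] A) :
    RComod.tensRho a.toLinearMap ρ ρW = amb W a ρ ∘ₗ ρW.lTensor X :=
  TensorProduct.ext' fun x w => rfl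

theorem amb_natW (a : H →ₐ[k] Module.End k A) (ρ : X →ₗ[k] X ⊗[k] H) (g : W →ₗ[k] W')
    (t : X ⊗[k] (W ⊗[k] A)) :
    amb W' a ρ ((g.rTensor A).lTensor X t) = (g.lTensor X).rTensor A (amb W a ρ t) := by
  refine LinearMap.congr_fun (f := amb W' a ρ ∘ₗ (g.rTensor A).lTensor X)
    (g := (g.lTensor X).rTensor A ∘ₗ amb W a ρ) (TensorProduct.ext_threefold' fun x w m => ?_) t
  simp only [LinearMap.comp_apply, LinearMap.lTensor_tmul, LinearMap.rTensor_tmul, amb_tmul]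
  generalize ρ x = s
  induction s with
  | zero => simp
  | add x y hx hy => simp only [map_add, hx, hy]
  | tmul x h => rfl

theorem amb_natA {a : H →ₐ[k] Module.End k A} {b : H →ₐ[k] Module.End k B} (ρ : X →ₗ[k] X ⊗[k] H)
    {g : A →ₗ[k] B} (hg : Equivar a b g) (t : X ⊗[k] (W ⊗[k] A)) :
    amb W b ρ ((g.lTensor W).lTensor X t) = g.lTensor (X ⊗[k] W) (amb W a ρ t) := by
  refine LinearMap.congr_fun (f := amb W b ρ ∘ₗ (g.lTensor W).lTensor X)
    (g := g.lTensor (X ⊗[k] W) ∘ₗ amb W a ρ) (TensorProduct.ext_threefold' fun x w m => ?_) t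
  simp only [LinearMap.comp_apply, LinearMap.lTensor_tmul, amb_tmul]
  generalize ρ x = s
  induction s with
  | zero => simp
  | add x y hx hy => simp only [map_add, hx, hy]
  | tmul x h => simp [hg h m]

theorem amb_natX (a : H →ₐ[k] Module.End k A) {ρ : X →ₗ[k] X ⊗[k] H} {ρ' : X' →ₗ[k] X' ⊗[k] H}
    {f : X →ₗ[k] X'} (hf : RColin ρ ρ' f) (t : X ⊗[k] (W ⊗[k] A)) :
    amb W a ρ' (f.rTensor _ t) = (f.rTensor W).rTensor A (amb W a ρ t) := by
  refine LinearMap.congr_fun (f := amb W a ρ' ∘ₗ f.rTensor _)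
    (g := (f.rTensor W).rTensor A ∘ₗ amb W a ρ) (TensorProduct.ext_threefold' fun x w m => ?_) t
  simp only [LinearMap.comp_apply, LinearMap.rTensor_tmul, amb_tmul, hf x]
  generalize ρ x = s
  induction s with
  | zero => simp
  | add x y hx hy => simp only [map_add, hx, hy]
  | tmul x h => rfl

theorem amb_map {a : H →ₐ[k] Module.End k A} {b : H →ₐ[k] Module.End k B} {ρ : X →ₗ[k] X ⊗[k] H}
    {ρ' : X' →ₗ[k] X' ⊗[k] H} {f : X →ₗ[k] X'} (hf : RColin ρ ρ' f) (g : W →ₗ[k] W')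
    {h : A →ₗ[k] B} (hh : Equivar a b h) (t : X ⊗[k] (W ⊗[k] A)) :
    amb W' b ρ' (TensorProduct.map f (TensorProduct.map g h) t) =
      TensorProduct.map (TensorProduct.map f g) h (amb W a ρ t) := by
  have e1 : TensorProduct.map f (TensorProduct.map g h) t =
      f.rTensor _ ((g.rTensor _).lTensor X ((h.lTensor W).lTensor X t)) :=
    LinearMap.congr_fun (f := TensorProduct.map f (TensorProduct.map g h))
      (g := f.rTensor _ ∘ₗ (g.rTensor _).lTensor X ∘ₗ (h.lTensor W).lTensor X)
      (TensorProduct.ext_threefold' fun _ _ _ => rfl) t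
  have e2 (t : (X ⊗[k] W) ⊗[k] A) : TensorProduct.map (TensorProduct.map f g) h t =
      (f.rTensor W').rTensor B ((g.lTensor X).rTensor B (h.lTensor (X ⊗[k] W) t)) :=
    LinearMap.congr_fun (f := TensorProduct.map (TensorProduct.map f g) h)
      (g := (f.rTensor W').rTensor B ∘ₗ (g.lTensor X).rTensor B ∘ₗ h.lTensor (X ⊗[k] W))
      (TensorProduct.ext_threefold fun _ _ _ => rfl) t
  rw [e1, e2, amb_natX b hf, amb_natW, amb_natA ρ hh]

theorem amb_coassoc (a : H →ₐ[k] Module.End k A) (b : H →ₐ[k] Module.End k B)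
    {ρ : X →ₗ[k] X ⊗[k] H} (hρ : IsRightCoaction ρ) (t : X ⊗[k] ((W ⊗[k] A) ⊗[k] B)) :
    TensorProduct.assoc k (X ⊗[k] W) A B ((amb W a ρ).rTensor B (amb (W ⊗[k] A) b ρ t)) =
      amb W (diag a b) ρ ((TensorProduct.assoc k W A B).toLinearMap.lTensor X t) := by
  induction t with
  | zero => simp
  | add x y hx hy => simp only [map_add, hx, hy]
  | tmul x t =>
  induction t with
  | zero => simp
  | add x y hx hy => simp only [map_add, TensorProduct.tmul_add, hx, hy]
  | tmul t q =>
  induction t with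
  | zero => simp
  | add x y hx hy => simp only [map_add, TensorProduct.tmul_add, TensorProduct.add_tmul, hx, hy]
  | tmul w p =>
    let Q : X ⊗[k] (H ⊗[k] H) →ₗ[k] (X ⊗[k] W) ⊗[k] (A ⊗[k] B) :=
      TensorProduct.map ((TensorProduct.mk k X W).flip w)
        (TensorProduct.map (a.toLinearMap.flip p) (b.toLinearMap.flip q))
    have h1 : ∀ s : X ⊗[k] H, TensorProduct.assoc k (X ⊗[k] W) A B ((amb W a ρ).rTensor B
        (TensorProduct.map ((TensorProduct.mk k X (W ⊗[k] A)).flip (w ⊗ₜ p))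
          (b.toLinearMap.flip q) s)) = Q (TensorProduct.assoc k X H H (ρ.rTensor H s)) := by
      intro s
      induction s with
      | zero => simp
      | add x y hx hy => simp only [map_add, hx, hy]
      | tmul x h =>
        simp only [TensorProduct.map_tmul, LinearMap.flip_apply, TensorProduct.mk_apply,
          LinearMap.rTensor_tmul, amb_tmul]
        generalize ρ x = s
        induction s with
        | zero => simp
        | add x y hx hy => simp only [map_add, TensorProduct.add_tmul, hx, hy]
        | tmul x h => rfl
    have h2 : ∀ s : X ⊗[k] H, TensorProduct.map ((TensorProduct.mk k X W).flip w)
        ((diag a b).toLinearMap.flip (p ⊗ₜ q)) s =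
        Q ((Coalgebra.comul (R := k) (A := H)).lTensor X s) := by
      intro s
      induction s with
      | zero => simp
      | add x y hx hy => simp only [map_add, hx, hy]
      | tmul x h =>
        simp only [TensorProduct.map_tmul, LinearMap.flip_apply, AlgHom.toLinearMap_apply,
          LinearMap.lTensor_tmul, diag_apply]
        generalize (Coalgebra.comul h : H ⊗[k] H) = s
        induction s with
        | zero => simp
        | add x y hx hy => simp only [map_add, TensorProduct.add_tmul, TensorProduct.tmul_add, hx, hy]
        | tmul x h => rfl
    rw [LinearMap.lTensor_tmul, LinearEquiv.coe_coe, TensorProduct.assoc_tmul, amb_tmul, amb_tmul,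
      h1, h2, hρ.coassoc]

theorem amb_mul (a : H →ₐ[k] Module.End k A) (ρX : X →ₗ[k] X ⊗[k] H) (ρY : Y →ₗ[k] Y ⊗[k] H)
    (t : (X ⊗[k] Y) ⊗[k] (W ⊗[k] A)) :
    (TensorProduct.assoc k X Y W).toLinearMap.rTensor A
      (amb W a (RComod.tensRho (Algebra.lmul k H).toLinearMap ρX ρY) t) =
      amb (Y ⊗[k] W) a ρX ((amb W a ρY).lTensor X (TensorProduct.assoc k X Y (W ⊗[k] A) t)) := by
  induction t with
  | zero => simp
  | add x y hx hy => simp only [map_add, hx, hy]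
  | tmul t s =>
  induction t with
  | zero => simp
  | add x y hx hy => simp only [map_add, TensorProduct.add_tmul, hx, hy]
  | tmul x y =>
  induction s with
  | zero => simp
  | add x y hx hy => simp only [map_add, TensorProduct.tmul_add, hx, hy]
  | tmul w m =>
    simp only [amb_tmul, TensorProduct.assoc_tmul, LinearMap.lTensor_tmul, RComod.tensRho,
      LinearMap.comp_apply, TensorProduct.map_tmul, LinearEquiv.coe_coe]
    generalize ρY y = b
    induction b with
    | zero => simp
    | add x y hx hy => simp only [map_add, TensorProduct.tmul_add, hx, hy]
    | tmul y h' =>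
      simp only [TensorProduct.map_tmul, LinearMap.flip_apply, TensorProduct.mk_apply, amb_tmul]
      generalize ρX x = s
      induction s with
      | zero => simp
      | add x y hx hy => simp only [map_add, TensorProduct.add_tmul, hx, hy]
      | tmul x h => simp [Module.End.mul_apply]

theorem amb_one (a : H →ₐ[k] Module.End k A) (t : k ⊗[k] (W ⊗[k] A)) :
    (TensorProduct.lid k W).toLinearMap.rTensor A (amb W a ((TensorProduct.mk k k H).flip 1) t) =
      TensorProduct.lid k (W ⊗[k] A) t := by
  induction t with
  | zero => simp
  | add x y hx hy => simp only [map_add, hx, hy]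
  | tmul r s =>
  induction s with
  | zero => simp
  | add x y hx hy => simp only [map_add, TensorProduct.tmul_add, hx, hy]
  | tmul w m =>
    rw [amb_tmul]
    simp [TensorProduct.smul_tmul']

end Lax

section CotensorFunctor

open Bicomod MonoidalCategory MonoidalLeftAction Functor.LaxLeftLinear

variable {C D : HCoalg k H}

theorem cot_colin (W : RComod k C.carrier) (M : Bicomod C D) :
    RColin (outR W.carrier M.rho) (outR W.carrier (outR C.carrier M.rho))
      (cotDiff W.rho M.lam) :=
  RColin.sub (RColin.comp (rcolin_assoc M.rho) (RColin.map (fun m => by simp) W.rho))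
    (RColin.map M.lamHom.rho LinearMap.id)

/-- `W □_C M` for a right `C`-comodule `W` and a `C`-`D`-bicomodule `M`. -/
noncomputable def cotObj (W : RComod k C.carrier) (M : Bicomod C D) : RComod k D.carrier where
  carrier := LinearMap.ker (cotDiff W.rho M.lam)
  rho := kerR _ _ _ (cot_colin W M)
  isRight := M.isRight.outR.of_inj (Submodule.injective_subtype _) (rcolin_ker _ _ _ _)

/-- The inclusion `W □_C M → W ⊗ M`. -/
noncomputable def cotIncl (W : RComod k C.carrier) (M : Bicomod C D) :
    (cotObj W M).carrier →ₗ[k] W.carrier ⊗[k] M.carrier := Submodule.subtype _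

theorem cotIncl_inj (W : RComod k C.carrier) (M : Bicomod C D) :
    Function.Injective (cotIncl W M) := Submodule.injective_subtype _

theorem cotDiff_cotIncl {W : RComod k C.carrier} {M : Bicomod C D} (t : (cotObj W M).carrier) :
    cotDiff W.rho M.lam (cotIncl W M t) = 0 := t.2

theorem rcolin_cotIncl (W : RComod k C.carrier) (M : Bicomod C D) :
    RColin (cotObj W M).rho (outR W.carrier M.rho) (cotIncl W M) :=
  rcolin_ker _ _ _ (cot_colin W M)

/-- A colinear map into `W ⊗ M` with image in `W □_C M`. -/
noncomputable def cotCod {W : RComod k C.carrier} {M : Bicomod C D} {V : RComod k D.carrier}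
    (f : V.carrier →ₗ[k] W.carrier ⊗[k] M.carrier) (hf : ∀ v, cotDiff W.rho M.lam (f v) = 0)
    (hr : RColin V.rho (outR W.carrier M.rho) f) : V ⟶ cotObj W M where
  lin := f.codRestrict _ hf
  rho := RColin.of_comp (cotIncl_inj W M) (rcolin_cotIncl W M) hr

theorem cotIncl_cotCod {W : RComod k C.carrier} {M : Bicomod C D} {V : RComod k D.carrier}
    (f : V.carrier →ₗ[k] W.carrier ⊗[k] M.carrier) (hf : ∀ v, cotDiff W.rho M.lam (f v) = 0)
    (hr : RColin V.rho (outR W.carrier M.rho) f) (v : V.carrier) :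
    cotIncl W M ((cotCod f hf hr).lin v) = f v := rfl

theorem cot_hom_ext {W : RComod k C.carrier} {M : Bicomod C D} {V : RComod k D.carrier}
    {f g : V ⟶ cotObj W M} (h : ∀ v, cotIncl W M (f.lin v) = cotIncl W M (g.lin v)) : f = g :=
  RComod.hom_ext fun v => cotIncl_inj W M (h v)

/-- `f □_C g`, the restriction of `f ⊗ g`. -/
noncomputable def cotMap₂ {W W' : RComod k C.carrier} {M M' : Bicomod C D} (f : W ⟶ W')
    (g : M ⟶ M') : cotObj W M ⟶ cotObj W' M' :=
  cotCod (TensorProduct.map f.lin g.lin ∘ₗ cotIncl W M)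
    (fun v => (cotDiff_nat f.rho g.lam _).trans (by rw [cotDiff_cotIncl, map_zero]))
    (RColin.comp (RColin.map g.rho f.lin) (rcolin_cotIncl W M))

theorem cotIncl_map₂ {W W' : RComod k C.carrier} {M M' : Bicomod C D} (f : W ⟶ W')
    (g : M ⟶ M') (t : (cotObj W M).carrier) : cotIncl W' M' ((cotMap₂ f g).lin t) =
      TensorProduct.map f.lin g.lin (cotIncl W M t) := rfl

/-- The functor `- □_C M : 𝔐^C → 𝔐^D`. -/
noncomputable def cotFunctor (M : Bicomod C D) : RComod k C.carrier ⥤ RComod k D.carrier where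
  obj W := cotObj W M
  map f := cotMap₂ f (𝟙 M)
  map_id W := cot_hom_ext fun v => LinearMap.congr_fun TensorProduct.map_id _
  map_comp f g := cot_hom_ext fun v =>
    LinearMap.congr_fun (LinearMap.rTensor_comp M.carrier g.lin f.lin) _

instance (M : Bicomod C D) : (cotFunctor M).Additive where
  map_add {_ _ f g} := cot_hom_ext fun v =>
    LinearMap.congr_fun (LinearMap.rTensor_add M.carrier f.lin g.lin) _

instance (M : Bicomod C D) : (cotFunctor M).Linear k where
  map_smul f r := cot_hom_ext fun v =>
    LinearMap.congr_fun (LinearMap.rTensor_smul M.carrier r f.lin) _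

theorem amb_cotDiff (X : RComod k H) (W : RComod k C.carrier) (M : Bicomod C D)
    (t : X.carrier ⊗[k] (W.carrier ⊗[k] M.carrier)) :
    cotDiff (RComod.tensRho C.act.toLinearMap X.rho W.rho) M.lam (amb W.carrier M.act X.rho t) =
      amb W.carrier (diag C.act M.act) X.rho ((cotDiff W.rho M.lam).lTensor X.carrier t) := by
  rw [cotDiff, cotDiff, LinearMap.lTensor_sub, LinearMap.sub_apply, LinearMap.sub_apply, map_sub,
    amb_natA X.rho M.lam_act, LinearMap.lTensor_comp_apply, ← amb_coassoc _ _ X.isRight,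
    amb_natW, ← LinearMap.rTensor_comp_apply, ← tensRho_eq]
  rfl

theorem amb_colin (X : RComod k H) (W : RComod k C.carrier) (M : Bicomod C D) :
    RColin (RComod.tensRho D.act.toLinearMap X.rho (outR W.carrier M.rho))
      (outR (X.carrier ⊗[k] W.carrier) M.rho) (amb W.carrier M.act X.rho) := by
  intro t
  apply (TensorProduct.assoc k (X.carrier ⊗[k] W.carrier) M.carrier D.carrier).injective
  rw [tensRho_eq, LinearMap.comp_apply, amb_coassoc _ _ X.isRight, ← LinearMap.lTensor_comp_apply]
  have h : (TensorProduct.assoc k W.carrier M.carrier D.carrier).toLinearMap ∘ₗ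
      outR W.carrier M.rho = M.rho.lTensor W.carrier :=
    LinearMap.ext fun x => (TensorProduct.assoc k W.carrier M.carrier D.carrier).apply_symm_apply _
  rw [h, amb_natA X.rho M.rho_act]
  exact LinearEquiv.apply_symm_apply _ _

theorem amb_cotIncl (X : RComod k H) (W : RComod k C.carrier) (M : Bicomod C D)
    (t : X.carrier ⊗[k] (cotObj W M).carrier) :
    cotDiff (RComod.tensRho C.act.toLinearMap X.rho W.rho) M.lam
      (amb W.carrier M.act X.rho ((cotIncl W M).lTensor X.carrier t)) = 0 := by
  rw [amb_cotDiff, lTensor_zero_of cotDiff_cotIncl, map_zero]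

/-- `X ⊗ (W □_C M) → (X ⊗ W) □_C M`, induced by `x ⊗ (w ⊗ m) ↦ (x₍₀₎ ⊗ w) ⊗ x₍₁₎ m`. -/
noncomputable def cotLax (X : RComod k H) (W : RComod k C.carrier) (M : Bicomod C D) :
    RComod.tens D X (cotObj W M) ⟶ cotObj (RComod.tens C X W) M :=
  cotCod (W := RComod.tens C X W) (V := RComod.tens D X (cotObj W M))
    (amb W.carrier M.act X.rho ∘ₗ (cotIncl W M).lTensor X.carrier)
    (amb_cotIncl X W M)
    (RColin.comp (amb_colin X W M)
      (RComod.tensRho_map _ (f := LinearMap.id) (fun v => by simp) (rcolin_cotIncl W M)))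

theorem cotIncl_lax (X : RComod k H) (W : RComod k C.carrier) (M : Bicomod C D)
    (t : X.carrier ⊗[k] (cotObj W M).carrier) :
    cotIncl (RComod.tens C X W) M ((cotLax X W M).lin t) =
      amb W.carrier M.act X.rho ((cotIncl W M).lTensor X.carrier t) := rfl

theorem cotLax_map {X X' : RComod k H} {W W' : RComod k C.carrier} {M M' : Bicomod C D}
    (f : X ⟶ X') (g : W ⟶ W') (h : M ⟶ M') :
    RComod.tensMap D f (cotMap₂ g h) ≫ cotLax X' W' M' =
      cotLax X W M ≫ cotMap₂ (RComod.tensMap C f g) h := by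
  refine cot_hom_ext (W := RComod.tens C X' W') fun t => ?_
  have e : ∀ t : X.carrier ⊗[k] (cotObj W M).carrier,
      (cotIncl W' M').lTensor X'.carrier (TensorProduct.map f.lin (cotMap₂ g h).lin t) =
        TensorProduct.map f.lin (TensorProduct.map g.lin h.lin)
          ((cotIncl W M).lTensor X.carrier t) :=
    LinearMap.congr_fun (f := (cotIncl W' M').lTensor X'.carrier ∘ₗ
        TensorProduct.map f.lin (cotMap₂ g h).lin)
      (g := TensorProduct.map f.lin (TensorProduct.map g.lin h.lin) ∘ₗ
        (cotIncl W M).lTensor X.carrier) (TensorProduct.ext' fun _ _ => rfl)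
  exact (congrArg (amb W'.carrier M'.act X'.rho) (e t)).trans (amb_map f.rho g.lin h.act _)

theorem cotLax_assoc (X Y : RComod k H) (W : RComod k C.carrier) (M : Bicomod C D) :
    cotLax (RComod.tens (RComod.regular k H) X Y) W M ≫
        cotMap₂ (RComod.tensAssoc C X Y W).hom (𝟙 M) =
      (RComod.tensAssoc D X Y (cotObj W M)).hom ≫ RComod.tensMap D (𝟙 X) (cotLax Y W M) ≫
        cotLax X (RComod.tens C Y W) M := by
  refine cot_hom_ext (W := RComod.tens C X (RComod.tens C Y W)) fun t => ?_
  have e : ∀ t : (X.carrier ⊗[k] Y.carrier) ⊗[k] (cotObj W M).carrier,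
      (cotIncl (RComod.tens C Y W) M).lTensor X.carrier (TensorProduct.map LinearMap.id
        (cotLax Y W M).lin (TensorProduct.assoc k X.carrier Y.carrier (cotObj W M).carrier t)) =
      (amb W.carrier M.act Y.rho).lTensor X.carrier (TensorProduct.assoc k X.carrier Y.carrier _
        ((cotIncl W M).lTensor (X.carrier ⊗[k] Y.carrier) t)) :=
    LinearMap.congr_fun
      (f := (cotIncl (RComod.tens C Y W) M).lTensor X.carrier ∘ₗ TensorProduct.map LinearMap.id
        (cotLax Y W M).lin ∘ₗ (TensorProduct.assoc k X.carrier Y.carrier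
          (cotObj W M).carrier).toLinearMap)
      (g := (amb W.carrier M.act Y.rho).lTensor X.carrier ∘ₗ
        (TensorProduct.assoc k X.carrier Y.carrier _).toLinearMap ∘ₗ
        (cotIncl W M).lTensor (X.carrier ⊗[k] Y.carrier))
      (TensorProduct.ext_threefold fun _ _ _ => rfl)
  exact (amb_mul M.act X.rho Y.rho ((cotIncl W M).lTensor (X.carrier ⊗[k] Y.carrier) t)).trans
    (congrArg (amb (Y.carrier ⊗[k] W.carrier) M.act X.rho) (e t)).symm

theorem cotLax_unit (W : RComod k C.carrier) (M : Bicomod C D) :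
    (RComod.tensUnit D (cotObj W M)).hom =
      cotLax (RComod.triv k H) W M ≫ cotMap₂ (RComod.tensUnit C W).hom (𝟙 M) := by
  refine cot_hom_ext fun t => ?_
  have e : ∀ t : k ⊗[k] (cotObj W M).carrier,
      cotIncl W M (TensorProduct.lid k (cotObj W M).carrier t) =
        TensorProduct.lid k _ ((cotIncl W M).lTensor k t) :=
    LinearMap.congr_fun (f := cotIncl W M ∘ₗ (TensorProduct.lid k (cotObj W M).carrier).toLinearMap)
      (g := (TensorProduct.lid k _).toLinearMap ∘ₗ (cotIncl W M).lTensor k)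
      (TensorProduct.ext' fun r x => map_smul (cotIncl W M) r x)
  exact (e t).trans (amb_one M.act ((cotIncl W M).lTensor k t)).symm

theorem cotMap₂_id (W : RComod k C.carrier) (M : Bicomod C D) :
    cotMap₂ (𝟙 W) (𝟙 M) = 𝟙 (cotObj W M) :=
  cot_hom_ext fun v => LinearMap.congr_fun TensorProduct.map_id _

theorem cotMap₂_comp (W : RComod k C.carrier) {M N P : Bicomod C D} (f : M ⟶ N) (g : N ⟶ P) :
    cotMap₂ (𝟙 W) (f ≫ g) = cotMap₂ (𝟙 W) f ≫ cotMap₂ (𝟙 W) g :=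
  cot_hom_ext fun v => LinearMap.congr_fun (LinearMap.lTensor_comp W.carrier g.lin f.lin) _

/-- The functor `- □_C M : 𝔐^C → 𝔐^D` as a lax left `𝔐^H`-module functor. -/
noncomputable def cotensorFunctor (M : Bicomod C D) : LaxFun (comodCat C) (comodCat D) where
  functor := cotFunctor M
  additive := inferInstanceAs (cotFunctor M).Additive
  linear := inferInstanceAs ((cotFunctor M).Linear k)
  lax :=
    { μₗ := fun X W => cotLax X W M
      μₗ_naturality_left := fun {X Y} f W =>
        (congrArg (fun z => RComod.tensMap D f z ≫ cotLax Y W M) (cotMap₂_id W M).symm).trans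
          (cotLax_map f (𝟙 W) (𝟙 M))
      μₗ_naturality_right := fun X _ _ g => cotLax_map (𝟙 X) g (𝟙 M)
      μₗ_associativity := fun X Y W => cotLax_assoc X Y W M
      μₗ_unitality := fun W => cotLax_unit W M }

/-- The natural transformation `- □_C f`. -/
noncomputable def cotNat {M N : Bicomod C D} (f : M ⟶ N) : cotFunctor M ⟶ cotFunctor N where
  app W := cotMap₂ (𝟙 W) f
  naturality W W' g := cot_hom_ext fun (t : (cotObj W M).carrier) =>
    (lr_comm (RComod.Hom.lin g) f.lin (cotIncl W M t)).symm

/-- The morphism `- □_C f` of lax module functors. -/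
noncomputable def cotensorNat {M N : Bicomod C D} (f : M ⟶ N) :
    ModNat (cotensorFunctor M) (cotensorFunctor N) where
  nat := cotNat f
  comm X (W : RComod k C.carrier) := (cotLax_map (𝟙 X) (𝟙 W) f).trans
    (congrArg (fun z => cotLax X W M ≫ cotMap₂ z f)
      (RComod.Hom.ext (TensorProduct.map_id (M := X.carrier) (N := W.carrier))))

end CotensorFunctor

section Biequivalence

/-- The left module category `𝔐^C` as a 0-cell of `𝔐^H-Mod`. -/
noncomputable def comodHMod (C : HCoalg k H) : HMod k H where
  cat := comodCat C
  equiv_comod := ⟨C, LaxFun.id _, LaxFun.id _,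
    ⟨{ hom := LaxFun.leftHom (LaxFun.id (comodCat C))
       inv := LaxFun.leftInv (LaxFun.id (comodCat C))
       hom_inv_id := ModNat.ext_app fun A => Category.id_comp _
       inv_hom_id := ModNat.ext_app fun A => Category.id_comp _ }⟩,
    ⟨{ hom := LaxFun.leftHom (LaxFun.id (comodCat C))
       inv := LaxFun.leftInv (LaxFun.id (comodCat C))
       hom_inv_id := ModNat.ext_app fun A => Category.id_comp _
       inv_hom_id := ModNat.ext_app fun A => Category.id_comp _ }⟩⟩

/-- The assignment `C ↦ 𝔐^C`, `M ↦ - □_C M`, `f ↦ - □_C f`, given that the functors `- □_C M` are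
of type `𝓛`. It sends `f : M ⟶ N` in `^C_H 𝔐^D` to a 2-cell `- □_C M ⟶ - □_C N` between 1-cells
`𝔐^C ⟶ 𝔐^D`. A pseudofunctor extending it has isomorphisms `Φ(M ≫ N) ≅ Φ(M) ≫ Φ(N)`, i.e.
`- □_C (M □_D N) ≅ (- □_D N) ∘ (- □_C M)`: cotensor products go to composites of functors in the
reversed order, which is what the superscript `op` on `𝔐^H-Mod` stands for when composites of
functors are written `G ∘ F`. -/
noncomputable def comodPrelax
    (hL : ∀ {C D : HCoalg k H} (M : C ⟶ D), (cotensorFunctor M).TypeL) :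
    PrelaxFunctor (HCoalg k H) (HMod k H) where
  obj C := comodHMod C
  map M := ⟨cotensorFunctor M, hL M⟩
  map₂ f := cotensorNat f
  map₂_id M := ModNat.ext_app fun W => cotMap₂_id W M
  map₂_comp f g := ModNat.ext_app fun W => cotMap₂_comp W f g

/-- A pseudofunctor is a biequivalence if it is an equivalence on all categories of 1-cells and
every 0-cell of the target is equivalent, within the target bicategory, to one in the image. -/
structure IsBiequivalence {K L : Type*} [Bicategory K] [Bicategory L] (F : Pseudofunctor K L) :
    Prop where
  locally : ∀ a b : K, (F.mapFunctor a b).IsEquivalence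
  essSurj : ∀ c : L, ∃ b : K, Nonempty (Bicategory.Equivalence (F.obj b) c)

end Biequivalence

end HopfModCat

/-! This is an Eilenberg–Watts theorem for comodules, with the lax module structure carried along.
Every right `C`-comodule `W` is the kernel of the difference of two colinear maps `W ⊗ C → W ⊗ C ⊗
C` between cofree comodules, and a cofree comodule is a direct sum of copies of `C`. A linear
functor `F` that preserves kernels and coproducts is therefore determined by `F(C)`: it sends `W` to
the kernel of `W ⊗ F(C) → W ⊗ C ⊗ F(C)`, which is `W □_C F(C)`.

The lax structure enters twice. At a trivial comodule `X = V` the structure morphism `V ⊗ F(W) → F(V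
⊗ W)` is the canonical comparison of coproducts, hence invertible (`isIso_laxHom_const`); inverting
it turns `F` of the coaction of `W` into a map `F(W) → W ⊗ F(C)`, whose case `W = C` is the left
coaction of `F(C)`. At `X = H` it gives an action `H ⊗ F(C) → F(H ⊗ C) → F(C)`. The structure
morphism at an arbitrary `X` is recovered from this action, because the coaction `x ⊗ w ↦ x₍₀₎ ⊗
w₍₀₎ ⊗ x₍₁₎w₍₁₎` of `X ⊗ W` factors through morphisms involving only `X`, trivial comodules and `H`
(`rhoHom_tens`, `laxHom_coactHom`). So `F(C)` is a bicomodule over `C` and `D` in `H`-modules, and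
`F ≅ - □_C F(C)` as lax module functors (`genHom_bijective`).

For 2-cells, a functional `φ` on `W` gives a colinear map `W → C`, `w ↦ φ(w₍₀₎)w₍₁₎`, and these maps
jointly separate the elements of `W □_C M` (`coeff_ext`). A transformation `- □_C M → - □_C N` is
thus determined by its component at `C`, which is a map `M → N` because `C □_C M ≅ M`. Naturality
along the maps `C → C` coming from functionals makes this map left colinear, and compatibility with
the lax structure at `X = H` makes it `H`-linear.

The rest rests on exactness of tensor products over a field. It gives that `- □_C M` is of type `𝓛`,
and that `(W □ M) □ N` and `W □ (M □ N)` are the same subspace of `W ⊗ M ⊗ N` up to rebracketing;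
the coherence axioms are checked inside tensor products. On 0-cells, functors belonging to an
equivalence preserve all limits and colimits, so they are of type `𝓛` and the equivalence lives in
the target bicategory. -/

namespace HopfModCat

open Limits

/-! ### Direct sum decompositions of vector spaces -/

section CoproductData

variable {k : Type u} [Field k]

/-- Linear maps `i j : W j → T` and `p j : T → W j` that exhibit `T` as the direct sum of the
`W j`. -/
structure DirectSumData {J : Type u} {W : J → Type u} {T : Type u}
    [∀ j, AddCommGroup (W j)] [∀ j, Module k (W j)] [AddCommGroup T] [Module k T]
    (i : ∀ j, W j →ₗ[k] T) (p : ∀ j, T →ₗ[k] W j) : Prop where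
  same : ∀ j x, p j (i j x) = x
  ne : ∀ j l x, j ≠ l → p l (i j x) = 0
  -- Requiring the identity for every finite set containing `s`, and not for `s` alone, lets the
  -- sets found for two elements be replaced by their union.
  total : ∀ t, ∃ s : Finset J, ∀ s' : Finset J, s ⊆ s' → ∑ j ∈ s', i j (p j t) = t

namespace DirectSumData

variable {J : Type u} {W : J → Type u} {T V : Type u}
    [∀ j, AddCommGroup (W j)] [∀ j, Module k (W j)] [AddCommGroup T] [Module k T]
    [AddCommGroup V] [Module k V]
    {i : ∀ j, W j →ₗ[k] T} {p : ∀ j, T →ₗ[k] W j}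

theorem hom_ext (h : DirectSumData i p) {f g : T →ₗ[k] V}
    (e : ∀ j x, f (i j x) = g (i j x)) : f = g := by
  ext t
  obtain ⟨s, hs⟩ := h.total t
  rw [← hs s subset_rfl, map_sum, map_sum]
  exact Finset.sum_congr rfl fun j _ => e j _

/-- The linear equivalence with the direct sum. -/
noncomputable def equiv [DecidableEq J] (h : DirectSumData i p) : (Π₀ j, W j) ≃ₗ[k] T :=
  LinearEquiv.ofBijective (DFinsupp.lsum ℕ i) <| by
    constructor
    · rw [injective_iff_map_eq_zero]
      intro x hx
      ext l
      -- The projection `p l` reads off the `l`-th coordinate from the sum, which makes the sum map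
      -- injective.
      have e : p l (DFinsupp.lsum ℕ i x) = x l := by
        induction x using DFinsupp.induction with
        | h0 => simp
        | ha j b f _ _ ih =>
          have : ∀ f : Π₀ j, W j, p l (DFinsupp.lsum ℕ i f) = f l := by
            intro f
            refine LinearMap.congr_fun (f := p l ∘ₗ DFinsupp.lsum ℕ i) (g := DFinsupp.lapply l)
              (DFinsupp.lhom_ext fun j x => ?_) f
            simp only [LinearMap.comp_apply, DFinsupp.lsum_single, DFinsupp.lapply_apply]
            by_cases hj : j = l
            · subst hj; simp [h.same]
            · rw [h.ne _ _ _ hj, DFinsupp.single_eq_of_ne (Ne.symm hj)]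
          exact this _
      rw [← e, hx]; simp
    · intro t
      obtain ⟨s, hs⟩ := h.total t
      refine ⟨∑ j ∈ s, DFinsupp.single j (p j t), ?_⟩
      rw [map_sum]
      simp only [DFinsupp.lsum_single]
      exact hs s subset_rfl

open Classical in
/-- The linear map out of `T` with given components. -/
noncomputable def desc (h : DirectSumData i p) (f : ∀ j, W j →ₗ[k] V) : T →ₗ[k] V :=
  DFinsupp.lsum ℕ f ∘ₗ h.equiv.symm.toLinearMap

open Classical in
theorem desc_apply (h : DirectSumData i p) (f : ∀ j, W j →ₗ[k] V) (j : J) (x : W j) :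
    h.desc f (i j x) = f j x := by
  have : h.equiv.symm (i j x) = DFinsupp.single j x := by
    rw [LinearEquiv.symm_apply_eq]
    exact (DFinsupp.lsum_single ℕ i j x).symm
  exact (congrArg (DFinsupp.lsum ℕ f) this).trans (DFinsupp.lsum_single ℕ f j x)

/-- Tensoring a direct sum decomposition. -/
theorem rTensor (h : DirectSumData i p) (A : Type u) [AddCommGroup A] [Module k A] :
    DirectSumData (fun j => (i j).rTensor A) (fun j => (p j).rTensor A) where
  same j x := by
    rw [← LinearMap.rTensor_comp_apply, (LinearMap.ext (h.same j) : p j ∘ₗ i j = LinearMap.id),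
      LinearMap.rTensor_id, LinearMap.id_apply]
  ne j l x hjl := Bicomod.rTensor_zero_of (fun x => h.ne j l x hjl) x
  total t := by
    classical
    induction t with
    | zero => exact ⟨∅, by simp⟩
    | add x y hx hy =>
      obtain ⟨s, hs⟩ := hx
      obtain ⟨s', hs'⟩ := hy
      refine ⟨s ∪ s', fun r hr => ?_⟩
      simp only [map_add, Finset.sum_add_distrib]
      rw [hs r (Finset.union_subset_left hr), hs' r (Finset.union_subset_right hr)]
    | tmul x a =>
      obtain ⟨s, hs⟩ := h.total x
      refine ⟨s, fun r hr => ?_⟩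
      simp only [LinearMap.rTensor_tmul, ← TensorProduct.sum_tmul, hs r hr]

/-- All three conditions are equations, so they can be checked after an injection into a known
decomposition. The intended use is `W j □ M` inside `W j ⊗ M`. -/
theorem of_inj {W' : J → Type u} {T' : Type u} [∀ j, AddCommGroup (W' j)] [∀ j, Module k (W' j)]
    [AddCommGroup T'] [Module k T'] {i' : ∀ j, W' j →ₗ[k] T'} {p' : ∀ j, T' →ₗ[k] W' j}
    (h : DirectSumData i p) (a : ∀ j, W' j →ₗ[k] W j) (ha : ∀ j, Function.Injective (a j))
    (b : T' →ₗ[k] T) (hb : Function.Injective b) (hi : ∀ j x, b (i' j x) = i j (a j x))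
    (hp : ∀ j x, a j (p' j x) = p j (b x)) : DirectSumData i' p' where
  same j x := ha j <| by rw [hp, hi, h.same]
  ne j l x hjl := ha l <| by rw [hp, hi, h.ne j l _ hjl, map_zero]
  total t := by
    obtain ⟨s, hs⟩ := h.total (b t)
    refine ⟨s, fun r hr => hb ?_⟩
    rw [map_sum, ← hs r hr]
    exact Finset.sum_congr rfl fun j _ => by rw [hi, hp]

end DirectSumData

/-- The canonical decomposition of a direct sum. -/
theorem directSumData_dfinsupp {J : Type u} [DecidableEq J] (W : J → Type u)
    [∀ j, AddCommGroup (W j)] [∀ j, Module k (W j)] :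
    DirectSumData (k := k) (fun j => DFinsupp.lsingle (R := k) (M := W) j)
      (fun j => DFinsupp.lapply j) where
  same j x := by simp
  ne j l x hjl := by
    simp only [DFinsupp.lsingle_apply, DFinsupp.lapply_apply]
    exact DFinsupp.single_eq_of_ne (Ne.symm hjl)
  total t := by
    classical
    refine ⟨t.support, fun s hs => ?_⟩
    ext l
    simp only [DFinsupp.lsingle_apply, DFinsupp.lapply_apply, DFinsupp.finsetSum_apply]
    by_cases hl : l ∈ s
    · rw [Finset.sum_eq_single l]
      · simp
      · intro j _ hj; exact DFinsupp.single_eq_of_ne hj.symm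
      · exact fun h => absurd hl h
    · rw [Finset.sum_eq_zero]
      · by_contra h
        exact hl (hs (DFinsupp.mem_support_iff.2 (Ne.symm h)))
      · intro j hj
        exact DFinsupp.single_eq_of_ne (by rintro rfl; exact hl hj)

end CoproductData

/-! ### Coproducts and kernels in the category of comodules -/

namespace RComod

variable {k : Type u} [Field k] {C : Type u} [AddCommGroup C] [Module k C] [Coalgebra k C]

/-- A cofan of comodules that is a direct sum of vector spaces is a coproduct. -/
noncomputable def isColimitCofan {J : Type u} {W : J → RComod k C} {T : RComod k C}
    (i : ∀ j, W j ⟶ T) {p : ∀ j, T.carrier →ₗ[k] (W j).carrier}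
    (h : DirectSumData (fun j => (i j).lin) p) : IsColimit (Cofan.mk T i) :=
  Cofan.IsColimit.mk _
    (fun s =>
      { lin := h.desc fun j => (s.inj j).lin
        -- Colinearity is an equality of linear maps out of a direct sum, so it suffices to see it
        -- on each summand, where it is colinearity of the cofan leg.
        rho := fun v => by
          refine LinearMap.congr_fun (f := s.pt.rho ∘ₗ h.desc fun j => (s.inj j).lin)
            (g := (h.desc fun j => (s.inj j).lin).rTensor C ∘ₗ T.rho) (h.hom_ext fun j x => ?_) v
          have e : (h.desc fun j => (s.inj j).lin) ∘ₗ (i j).lin = (s.inj j).lin :=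
            LinearMap.ext fun x => h.desc_apply _ j x
          rw [LinearMap.comp_apply, LinearMap.comp_apply, h.desc_apply, (i j).rho,
            ← LinearMap.rTensor_comp_apply, e, (s.inj j).rho] })
    (fun s j => hom_ext fun x => h.desc_apply _ j x)
    (fun s m hm => Hom.ext (h.hom_ext fun j x =>
      (LinearMap.congr_fun (congrArg Hom.lin (hm j)) x).trans (h.desc_apply (fun j => (s.inj j).lin) j x).symm))

section DirectSum

open Classical

variable {J : Type u}

/-- The coaction on a direct sum. -/
noncomputable def directSumRho {W : J → Type u} [∀ j, AddCommGroup (W j)] [∀ j, Module k (W j)]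
    (ρ : ∀ j, W j →ₗ[k] W j ⊗[k] C) : (Π₀ j, W j) →ₗ[k] (Π₀ j, W j) ⊗[k] C :=
  DFinsupp.lsum ℕ fun j => (DFinsupp.lsingle (R := k) (M := W) j).rTensor C ∘ₗ ρ j

theorem rcolin_lsingle {W : J → Type u} [∀ j, AddCommGroup (W j)] [∀ j, Module k (W j)]
    (ρ : ∀ j, W j →ₗ[k] W j ⊗[k] C) (j : J) :
    RColin (ρ j) (directSumRho ρ) (DFinsupp.lsingle (R := k) (M := W) j) := fun x =>
  DFinsupp.lsum_single ℕ (fun j => (DFinsupp.lsingle (R := k) (M := W) j).rTensor C ∘ₗ ρ j) j x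

theorem rcolin_lapply {W : J → Type u} [∀ j, AddCommGroup (W j)] [∀ j, Module k (W j)]
    (ρ : ∀ j, W j →ₗ[k] W j ⊗[k] C) (j : J) :
    RColin (directSumRho ρ) (ρ j) (DFinsupp.lapply (R := k) (M := W) j) := by
  intro v
  refine LinearMap.congr_fun (f := ρ j ∘ₗ DFinsupp.lapply j)
      (g := (DFinsupp.lapply (R := k) (M := W) j).rTensor C ∘ₗ
        directSumRho ρ) ((directSumData_dfinsupp _).hom_ext fun l x => ?_) v
  rw [LinearMap.comp_apply, LinearMap.comp_apply, rcolin_lsingle, ← LinearMap.rTensor_comp_apply]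
  by_cases hl : l = j
  · subst hl
    have : DFinsupp.lapply l ∘ₗ DFinsupp.lsingle (R := k) (M := W) l = LinearMap.id := by
      ext; simp
    rw [this]
    simp
  · have e : ∀ x, DFinsupp.lapply (R := k) j (DFinsupp.lsingle (R := k) (M := W) l x) = 0 :=
      fun x => (directSumData_dfinsupp W).ne l j x hl
    have : DFinsupp.lapply j ∘ₗ DFinsupp.lsingle (R := k) (M := W) l = 0 := LinearMap.ext e
    rw [this, e]
    simp

/-- The direct sum of comodules. -/
noncomputable def directSum (W : J → RComod k C) : RComod k C where
  carrier := Π₀ j, (W j).carrier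
  rho := directSumRho fun j => (W j).rho
  isRight := by
    constructor
    · intro m
      induction m using DFinsupp.induction with
      | h0 => simp
      | ha j x f _ _ ih =>
        have := (rcolin_lsingle (fun j => (W j).rho) j).nat x
        simp only [DFinsupp.lsingle_apply] at this
        rw [map_add, map_add, map_add, map_add, ih, this.1, this.2.1, (W j).isRight.coassoc]
    · intro m
      induction m using DFinsupp.induction with
      | h0 => simp
      | ha j x f _ _ ih =>
        have := (rcolin_lsingle (fun j => (W j).rho) j).nat x
        simp only [DFinsupp.lsingle_apply] at this
        rw [map_add, map_add, map_add, ih, this.2.2, (W j).isRight.counit]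

/-- The inclusion of a summand. -/
noncomputable def directSumι (W : J → RComod k C) (j : J) : W j ⟶ directSum W where
  lin := DFinsupp.lsingle (R := k) (M := fun j => (W j).carrier) j
  rho := rcolin_lsingle (fun j => (W j).rho) j

/-- The projection to a summand. -/
noncomputable def directSumπ (W : J → RComod k C) (j : J) : directSum W ⟶ W j where
  lin := DFinsupp.lapply (R := k) (M := fun j => (W j).carrier) j
  rho := rcolin_lapply (fun j => (W j).rho) j

theorem directSumData (W : J → RComod k C) :
    DirectSumData (fun j => (directSumι W j).lin) (fun j => (directSumπ W j).lin) :=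
  directSumData_dfinsupp (k := k) fun j => (W j).carrier

end DirectSum

instance : HasCoproducts.{u} (RComod k C) := hasCoproducts_of_colimit_cofans
  (fun W => Cofan.mk (directSum W) (directSumι W)) fun W => isColimitCofan _ (directSumData W)

/-- An injective colinear map with image `ker f` is a kernel of `f`. -/
noncomputable def isLimitKernelFork {K W W' : RComod k C} (i : K ⟶ W) (f : W ⟶ W')
    (w : i ≫ f = 0) (hi : Function.Injective i.lin)
    (h : ∀ x, f.lin x = 0 → ∃ y, i.lin y = x) : IsLimit (KernelFork.ofι i w) :=
  have e {A : RComod k C} (g : A ⟶ W) (hg : g ≫ f = 0) (x : A.carrier) :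
      ∃ y, i.lin y = g.lin x :=
    h _ (LinearMap.congr_fun (congrArg Hom.lin hg) x)
  let l {A : RComod k C} (g : A ⟶ W) (hg : g ≫ f = 0) : A.carrier →ₗ[k] K.carrier :=
    (LinearEquiv.ofInjective i.lin hi).symm.toLinearMap ∘ₗ
      g.lin.codRestrict (LinearMap.range i.lin) (e g hg)
  have hl {A : RComod k C} (g : A ⟶ W) (hg : g ≫ f = 0) (x : A.carrier) :
      i.lin (l g hg x) = g.lin x :=
    congrArg Subtype.val ((LinearEquiv.ofInjective i.lin hi).apply_symm_apply _)
  KernelFork.IsLimit.ofι _ _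
    (fun g hg =>
      { lin := l g hg
        -- A linear factorization through an injective colinear map is colinear, since its composite
        -- with that map is.
        rho := RColin.of_comp hi i.rho <| by
          rw [(LinearMap.ext (hl g hg) : i.lin ∘ₗ l g hg = g.lin)]
          exact g.rho })
    (fun g hg => hom_ext fun x => hl g hg x)
    (fun g hg m hm => hom_ext fun x => hi <|
      (LinearMap.congr_fun (congrArg Hom.lin hm) x).trans (hl g hg x).symm)

/-- The kernel of a colinear map. -/
noncomputable def ker {W W' : RComod k C} (f : W ⟶ W') : RComod k C where
  carrier := LinearMap.ker f.lin
  rho := kerR W.rho W'.rho f.lin f.rho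
  isRight := W.isRight.of_inj (Submodule.injective_subtype _) (rcolin_ker _ _ _ f.rho)

noncomputable def kerι {W W' : RComod k C} (f : W ⟶ W') : ker f ⟶ W where
  lin := (LinearMap.ker f.lin).subtype
  rho := rcolin_ker _ _ _ f.rho

theorem kerι_comp {W W' : RComod k C} (f : W ⟶ W') : kerι f ≫ f = 0 :=
  hom_ext fun x => x.2

noncomputable def isLimitKer {W W' : RComod k C} (f : W ⟶ W') :
    IsLimit (KernelFork.ofι (kerι f) (kerι_comp f)) :=
  isLimitKernelFork _ _ _ (Submodule.injective_subtype _) fun x hx => ⟨⟨x, hx⟩, rfl⟩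

/-- A kernel of `f` is injective, with image the kernel of `f` as a linear map. -/
theorem of_isLimit_kernelFork {K W W' : RComod k C} {i : K ⟶ W} {f : W ⟶ W'} {w : i ≫ f = 0}
    (h : IsLimit (KernelFork.ofι i w)) :
    Function.Injective i.lin ∧ ∀ x, f.lin x = 0 → ∃ y, i.lin y = x := by
  -- Both claims are evident for the concrete kernel `ker f`, and any kernel is isomorphic to it
  -- over `W`.
  let e := h.conePointUniqueUpToIso (isLimitKer f)
  have he : e.hom ≫ kerι f = i :=
    h.conePointUniqueUpToIso_hom_comp (isLimitKer f) WalkingParallelPair.zero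
  have he' : e.inv ≫ i = kerι f :=
    h.conePointUniqueUpToIso_inv_comp (isLimitKer f) WalkingParallelPair.zero
  have hinj : Function.Injective e.hom.lin := Function.LeftInverse.injective (g := e.inv.lin)
    fun x => LinearMap.congr_fun (congrArg Hom.lin e.hom_inv_id) x
  refine ⟨?_, fun x hx => ⟨e.inv.lin ⟨x, hx⟩, LinearMap.congr_fun (congrArg Hom.lin he') ⟨x, hx⟩⟩⟩
  rw [← he]
  exact (Submodule.injective_subtype _).comp hinj

instance : HasKernels (RComod k C) where
  has_limit f := ⟨⟨_, isLimitKer f⟩⟩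

instance : HasEqualizers (RComod k C) := Preadditive.hasEqualizers_of_hasKernels

instance : HasFiniteCoproducts (RComod k C) := hasFiniteCoproducts_of_hasCoproducts _

instance : HasFiniteBiproducts (RComod k C) := HasFiniteBiproducts.of_hasFiniteCoproducts

instance : HasZeroObject (RComod k C) := hasZeroObject_of_hasFiniteBiproducts _

end RComod

/-! ### The functors `- □_C M` are left exact and preserve coproducts -/

section TypeL

variable {k : Type u} [Field k] {H : Type u} [Ring H] [Bialgebra k H] {C D : HCoalg k H}

/-- Tensoring with `M` decomposes `(⨁ W j) ⊗ M`. The inclusions and projections of `⨁ W j` are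
colinear, so they restrict to cotensor products, and the decomposition restricts with them by
`DirectSumData.of_inj`. -/
theorem cotFunctor_preservesCoproducts (M : Bicomod C D) (J : Type u) :
    PreservesColimitsOfShape (Discrete J) (cotFunctor M) :=
  have (W : J → RComod k C.carrier) :
      PreservesColimit (Discrete.functor W) (cotFunctor M) :=
    preservesColimit_of_preserves_colimit_cocone
      (RComod.isColimitCofan _ (RComod.directSumData W)) <|
      (isColimitMapCoconeCofanMkEquiv _ _ _).symm <|
        RComod.isColimitCofan (W := fun j => (cotFunctor M).obj (W j))
          (fun j => (cotFunctor M).map (RComod.directSumι W j))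
          (p := fun j => ((cotFunctor M).map (RComod.directSumπ W j)).lin)
          (((RComod.directSumData W).rTensor M.carrier).of_inj (fun j => cotIncl (W j) M)
            (fun j => cotIncl_inj (W j) M) (cotIncl (RComod.directSum W) M) (cotIncl_inj _ M)
            (fun j x => rfl) (fun j x => rfl))
  preservesColimitsOfShape_of_discrete _

/-- By flatness an element of `W □ M` killed by `f ⊗ M` comes from `ker f ⊗ M`. It satisfies the
cotensor condition there because `ker f ⊗ C ⊗ M → W ⊗ C ⊗ M` is injective and the condition holds in
the target. -/
theorem cotFunctor_preservesKernel (M : Bicomod C D) {W W' : RComod k C.carrier} (f : W ⟶ W') :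
    PreservesLimit (parallelPair f 0) (cotFunctor M) :=
  preservesLimit_of_preserves_limit_cone (RComod.isLimitKer f) <|
    (isLimitMapConeForkEquiv' (cotFunctor M) (RComod.kerι_comp f)).symm <|
      RComod.isLimitKernelFork _ _ _
        (Function.Injective.of_comp (f := cotIncl W M) <|
          show Function.Injective ((RComod.kerι f).lin.rTensor M.carrier ∘ cotIncl _ M) from
          (rTensor_inj M.carrier (Submodule.injective_subtype _)).comp (cotIncl_inj _ M))
        fun (x : (cotObj W M).carrier) hx => by
          have h1 : f.lin.rTensor M.carrier (cotIncl W M x) = 0 :=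
            congrArg (cotIncl W' M) hx
          obtain ⟨y, hy⟩ := (Module.Flat.rTensor_exact M.carrier
            (LinearMap.exact_subtype_ker_map f.lin) (cotIncl W M x)).1 h1
          have h2 : Bicomod.cotDiff (RComod.ker f).rho M.lam y = 0 := by
            apply rTensor_inj (C.carrier ⊗[k] M.carrier) (f := (RComod.kerι f).lin)
              (Submodule.injective_subtype _)
            refine (Bicomod.cotDiff_natL (l := M.lam) (RComod.kerι f).rho y).symm.trans ?_
            rw [map_zero]
            exact (congrArg _ hy).trans (cotDiff_cotIncl x)
          exact ⟨⟨y, h2⟩, cotIncl_inj _ _ hy⟩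

/-- With biproducts and kernels available in comodule categories, left exactness of an additive
functor reduces to preservation of kernels. -/
theorem cotFunctor_preservesFiniteLimits (M : Bicomod C D) :
    PreservesFiniteLimits (cotFunctor M) :=
  have {W W' : RComod k C.carrier} (f : W ⟶ W') := cotFunctor_preservesKernel M f
  have := HasBinaryBiproducts.of_hasBinaryCoproducts (C := RComod k C.carrier)
  Functor.preservesFiniteLimits_of_preservesKernels _

/-- The functors `- □_C M` are of type `𝓛`. -/
theorem cotensorFunctor_typeL (M : Bicomod C D) : (cotensorFunctor M).TypeL where
  leftExact := cotFunctor_preservesFiniteLimits M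
  coproducts J := cotFunctor_preservesCoproducts M J

end TypeL

end HopfModCat

namespace HopfModCat

open MonoidalCategory MonoidalLeftAction Functor.LaxLeftLinear

/-! ### Invertible morphisms of lax module functors -/

section ModNatIso

variable {k : Type u} [Field k] {H : Type u} [Ring H] [Bialgebra k H]

/-- The inverse of a morphism of lax module functors with invertible components. -/
def ModNat.inverse {M N : ModCat k H} {F G : LaxFun M N} (f : ModNat F G)
    (g : ∀ A, G.functor.obj A ⟶ F.functor.obj A) (h₁ : ∀ A, f.nat.app A ≫ g A = 𝟙 _)
    (h₂ : ∀ A, g A ≫ f.nat.app A = 𝟙 _) : ModNat G F where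
  nat :=
    { app := g
      naturality := fun A B u => by
        rw [← Category.comp_id (G.functor.map u ≫ g B), ← Category.id_comp (G.functor.map u),
          ← h₂ A, Category.assoc, Category.assoc, Category.assoc, ← f.nat.naturality_assoc,
          reassoc_of% (h₁ B), Category.comp_id] }
  -- The structure morphisms are not invertible, but only `f` is cancelled: insert `g A ≫ f A = 𝟙`
  -- in front, use compatibility of `f`, and cancel `f` against `g` at the end.
  comm X A := by
    have e := f.comm X A
    rw [← Category.id_comp (μₗ G.functor X A), ← actionHomRight_id, ← h₂ A, actionHomRight_comp,
      Category.assoc, Category.assoc, ← Category.assoc _ _ (g (X ⊙ₗ A)), e, Category.assoc, h₁,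
      Category.comp_id]

/-- A morphism of lax module functors with invertible components is an isomorphism. -/
def ModNat.iso {M N : ModCat k H} {F G : LaxFun M N} (f : ModNat F G)
    (g : ∀ A, G.functor.obj A ⟶ F.functor.obj A) (h₁ : ∀ A, f.nat.app A ≫ g A = 𝟙 _)
    (h₂ : ∀ A, g A ≫ f.nat.app A = 𝟙 _) : F ≅ G where
  hom := f
  inv := f.inverse g h₁ h₂
  hom_inv_id := ModNat.ext_app h₁
  inv_hom_id := ModNat.ext_app h₂

/-- An isomorphism of lax module functors of type `𝓛` as an invertible 2-cell. -/
def HMod.isoOf {M N : HMod k H} {F G : M ⟶ N} (e : HMod.Hom.val F ≅ HMod.Hom.val G) : F ≅ G where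
  hom := e.hom
  inv := e.inv
  hom_inv_id := e.hom_inv_id
  inv_hom_id := e.inv_hom_id

end ModNatIso

/-! ### Associativity and units of the cotensor product, and the pseudofunctor -/

section Comparison

variable {k : Type u} [Field k] {H : Type u} [Ring H] [Bialgebra k H] {C D E F : HCoalg k H}

open Bicomod

section Associativity

variable (W : RComod k C.carrier) (M : Bicomod C D) (N : Bicomod D E)

/-- `(W □ M) □ N → (W ⊗ M) ⊗ N` -/
noncomputable def cotInclL : (cotObj (cotObj W M) N).carrier →ₗ[k]
    (W.carrier ⊗[k] M.carrier) ⊗[k] N.carrier :=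
  (cotIncl W M).rTensor N.carrier ∘ₗ cotIncl (cotObj W M) N

/-- `W □ (M □ N) → W ⊗ (M ⊗ N)` -/
noncomputable def cotInclR : (cotObj W (cotensor M N)).carrier →ₗ[k]
    W.carrier ⊗[k] (M.carrier ⊗[k] N.carrier) :=
  (incl M N).lin.lTensor W.carrier ∘ₗ cotIncl W (cotensor M N)

theorem cotInclL_inj : Function.Injective (cotInclL W M N) :=
  (rTensor_inj N.carrier (cotIncl_inj W M)).comp (cotIncl_inj _ _)

theorem cotInclR_inj : Function.Injective (cotInclR W M N) :=
  (lTensor_inj W.carrier (incl_inj M N)).comp (cotIncl_inj _ _)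

theorem rcolin_cotInclL : RColin (cotObj (cotObj W M) N).rho
    (outR (W.carrier ⊗[k] M.carrier) N.rho) (cotInclL W M N) :=
  RColin.comp (RColin.map (fun m => by simp) (cotIncl W M)) (rcolin_cotIncl (cotObj W M) N)

theorem rcolin_cotInclR : RColin (cotObj W (cotensor M N)).rho
    (outR W.carrier (outR M.carrier N.rho)) (cotInclR W M N) :=
  RColin.comp (RColin.map (incl M N).rho LinearMap.id) (rcolin_cotIncl W (cotensor M N))

/-- An element of `(W ⊗ M) ⊗ N` lies in `(W □ M) □ N` when it is balanced over `C` and over `D`. The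
next four lemmas record these two conditions for each bracketing; the associator matches them. -/
theorem cotInclL_left (x : (cotObj (cotObj W M) N).carrier) :
    (cotDiff W.rho M.lam).rTensor N.carrier (cotInclL W M N x) = 0 :=
  rTensor_zero_of cotDiff_cotIncl _

theorem cotInclL_right (x : (cotObj (cotObj W M) N).carrier) :
    cotDiff (outR W.carrier M.rho) N.lam (cotInclL W M N x) = 0 :=
  (cotDiff_natL (rcolin_cotIncl W M) _).trans (by rw [cotDiff_cotIncl, map_zero])

theorem cotInclR_right (x : (cotObj W (cotensor M N)).carrier) :
    (cotDiff M.rho N.lam).lTensor W.carrier (cotInclR W M N x) = 0 :=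
  lTensor_zero_of cotDiff_incl _

theorem cotInclR_left (x : (cotObj W (cotensor M N)).carrier) :
    cotDiff W.rho (outL N.carrier M.lam) (cotInclR W M N x) = 0 :=
  (cotDiff_natR (incl M N).lam _).trans (by rw [cotDiff_cotIncl, map_zero]; rfl)

/-- Balance over `D` does not see the factor `W`, so the associator carries it to a condition on `M
⊗ N` alone. This puts the element into `W ⊗ (M □ N)`. -/
theorem cotObjAssoc_cond₁ (x : (cotObj (cotObj W M) N).carrier) :
    (cotDiff M.rho N.lam).lTensor W.carrier
      (((TensorProduct.assoc k W.carrier M.carrier N.carrier).toLinearMap ∘ₗ cotInclL W M N) x) =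
        0 :=
  (cotDiff_assocR M.rho N.lam _).symm.trans <|
    (congrArg (TensorProduct.assoc k W.carrier M.carrier (D.carrier ⊗[k] N.carrier))
      (cotInclL_right W M N x)).trans (map_zero _)

/-- Since `W ⊗ C ⊗ (M □ N)` embeds in `W ⊗ C ⊗ M ⊗ N`, the condition may be tested there, where it
becomes balance over `C`. -/
theorem cotObjAssoc_cond₂ (x : (cotObj (cotObj W M) N).carrier) :
    cotDiff W.rho (cotensor M N).lam (liftL (cotDiff M.rho N.lam)
      ((TensorProduct.assoc k W.carrier M.carrier N.carrier).toLinearMap ∘ₗ cotInclL W M N)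
      (cotObjAssoc_cond₁ W M N) x) = 0 := by
  apply lTensor_inj W.carrier (lTensor_inj C.carrier (incl_inj M N))
  refine (cotDiff_natR (incl M N).lam _).symm.trans ?_
  rw [map_zero]
  refine (congrArg _ (lTensor_liftL (cotDiff M.rho N.lam) _ (cotObjAssoc_cond₁ W M N) x)).trans ?_
  refine (cotDiff_assocL W.rho M.lam _).trans ?_
  rw [cotInclL_left, map_zero, map_zero]
  rfl

/-- `(W □ M) □ N → W □ (M □ N)` as a linear map. -/
noncomputable def cotObjAssocLin :
    (cotObj (cotObj W M) N).carrier →ₗ[k] (cotObj W (cotensor M N)).carrier :=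
  (liftL (cotDiff M.rho N.lam) ((TensorProduct.assoc k W.carrier M.carrier N.carrier).toLinearMap
    ∘ₗ cotInclL W M N) (cotObjAssoc_cond₁ W M N)).codRestrict _ (cotObjAssoc_cond₂ W M N)

theorem cotInclR_assocLin (x : (cotObj (cotObj W M) N).carrier) :
    cotInclR W M N (cotObjAssocLin W M N x) =
      TensorProduct.assoc k W.carrier M.carrier N.carrier (cotInclL W M N x) :=
  lTensor_liftL (cotDiff M.rho N.lam) _ (cotObjAssoc_cond₁ W M N) x

/-- The conditions are used in the opposite order: exactness of `- ⊗ N` and balance over `C` move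
the element into `(W □ M) ⊗ N`, and then balance over `D`, tested after an injection, puts it into
the iterated cotensor product. -/
theorem cotObjAssocLin_surjective : Function.Surjective (cotObjAssocLin W M N) := by
  intro y
  let t := (TensorProduct.assoc k W.carrier M.carrier N.carrier).symm (cotInclR W M N y)
  have ht : TensorProduct.assoc k W.carrier M.carrier N.carrier t = cotInclR W M N y :=
    LinearEquiv.apply_symm_apply _ _
  have h1 : (cotDiff W.rho M.lam).rTensor N.carrier t = 0 := by
    apply (TensorProduct.assoc k W.carrier (C.carrier ⊗[k] M.carrier) N.carrier).injective
    apply lTensor_inj W.carrier (TensorProduct.assoc k C.carrier M.carrier N.carrier).injective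
    refine (cotDiff_assocL W.rho M.lam _).symm.trans ?_
    rw [map_zero, map_zero, ht]
    exact cotInclR_left W M N y
  obtain ⟨s, hs⟩ : ∃ s : (cotObj W M).carrier ⊗[k] N.carrier,
      (cotIncl W M).rTensor N.carrier s = t :=
    (Module.Flat.rTensor_exact N.carrier
      (LinearMap.exact_subtype_ker_map (cotDiff W.rho M.lam)) t).1 h1
  have h2 : cotDiff (cotObj W M).rho N.lam s = 0 := by
    apply rTensor_inj (D.carrier ⊗[k] N.carrier) (cotIncl_inj W M)
    refine (cotDiff_natL (rcolin_cotIncl W M) _).symm.trans ?_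
    rw [map_zero, hs]
    apply (TensorProduct.assoc k W.carrier M.carrier (D.carrier ⊗[k] N.carrier)).injective
    refine (cotDiff_assocR M.rho N.lam _).trans ?_
    rw [map_zero, ht]
    exact cotInclR_right W M N y
  refine ⟨⟨s, h2⟩, cotInclR_inj W M N ?_⟩
  exact (cotInclR_assocLin W M N _).trans ((congrArg _ hs).trans ht)

theorem cotObjAssocLin_injective : Function.Injective (cotObjAssocLin W M N) := fun x y h =>
  cotInclL_inj W M N <| (TensorProduct.assoc k W.carrier M.carrier N.carrier).injective <| by
    rw [← cotInclR_assocLin, ← cotInclR_assocLin, h]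

/-- `(W □_C M) □_D N ≅ W □_C (M □_D N)`. -/
noncomputable def cotObjAssoc : cotObj (cotObj W M) N ≅ cotObj W (cotensor M N) :=
  RComod.isoOf (LinearEquiv.ofBijective (cotObjAssocLin W M N)
    ⟨cotObjAssocLin_injective W M N, cotObjAssocLin_surjective W M N⟩) <| by
    refine RColin.of_comp (cotInclR_inj W M N) (rcolin_cotInclR W M N) ?_
    have e : cotInclR W M N ∘ₗ cotObjAssocLin W M N =
        (TensorProduct.assoc k W.carrier M.carrier N.carrier).toLinearMap ∘ₗ cotInclL W M N :=
      LinearMap.ext (cotInclR_assocLin W M N)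
    exact e ▸ RColin.comp (rcolin_assoc N.rho) (rcolin_cotInclL W M N)

/-- Inside the triple tensor product the isomorphism is just the associator. The naturality and
coherence identities for `cotObjAssoc` are derived from this. -/
theorem cotIncl_cotObjAssoc (x : (cotObj (cotObj W M) N).carrier) :
    cotInclR W M N ((cotObjAssoc W M N).hom.lin x) =
      TensorProduct.assoc k W.carrier M.carrier N.carrier (cotInclL W M N x) :=
  cotInclR_assocLin W M N x

/-- `W □_C C ≅ W`. -/
noncomputable def cotObjUnit : cotObj W (unit C) ≅ W :=
  (RComod.isoOf (M := W) (N := cotObj W (unit C))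
    (LinearEquiv.ofLinearMap
      (W.rho.codRestrict _ fun x => mem_cot.2 (W.isRight.coassoc x))
      ((TensorProduct.rid k W.carrier).toLinearMap ∘ₗ
        (Coalgebra.counit (R := k) (A := C.carrier)).lTensor W.carrier ∘ₗ cotIncl W (unit C))
      (LinearMap.ext fun y => cotIncl_inj W (unit C) <|
        (rTensor_counit W.rho _).symm.trans <|
        (congrArg (fun t => TensorProduct.rid k (W.carrier ⊗[k] C.carrier)
          ((Coalgebra.counit (R := k) (A := C.carrier)).lTensor _ t))
          ((LinearEquiv.eq_symm_apply _).2 (mem_cot.1 (cotDiff_cotIncl y)))).trans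
        ((unit C).isRight.outR.counit _))
      (LinearMap.ext W.isRight.counit)) <|
    RColin.of_comp (cotIncl_inj W (unit C)) (rcolin_cotIncl W (unit C)) fun m => by
      apply (TensorProduct.assoc k W.carrier C.carrier C.carrier).injective
      exact (LinearEquiv.apply_symm_apply _ _).trans (W.isRight.coassoc m).symm).symm

end Associativity

theorem cotInclR_map {W W' : RComod k C.carrier} {M M' : Bicomod C D} {N N' : Bicomod D E}
    (f : W ⟶ W') (g : M ⟶ M') (h : N ⟶ N') (x : (cotObj W (cotensor M N)).carrier) :
    cotInclR W' M' N' ((cotMap₂ f (cotMap g h)).lin x) =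
      TensorProduct.map f.lin (TensorProduct.map g.lin h.lin) (cotInclR W M N x) :=
  map_sq (f := f.lin) (g := LinearMap.id) (f₂ := LinearMap.id) (g₂ := f.lin)
    (f' := (cotMap g h).lin) (g' := (incl M' N').lin) (f₂' := (incl M N).lin)
    (g₂' := TensorProduct.map g.lin h.lin) (fun _ => rfl) (fun _ => rfl)
    (cotIncl W (cotensor M N) x)

theorem cotInclL_map {W W' : RComod k C.carrier} {M M' : Bicomod C D} {N N' : Bicomod D E}
    (f : W ⟶ W') (g : M ⟶ M') (h : N ⟶ N') (x : (cotObj (cotObj W M) N).carrier) :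
    cotInclL W' M' N' ((cotMap₂ (cotMap₂ f g) h).lin x) =
      TensorProduct.map (TensorProduct.map f.lin g.lin) h.lin (cotInclL W M N x) :=
  map_sq (f' := h.lin) (g' := LinearMap.id) (f₂' := LinearMap.id) (g₂' := h.lin)
    (f := (cotMap₂ f g).lin) (g := cotIncl W' M') (f₂ := cotIncl W M)
    (g₂ := TensorProduct.map f.lin g.lin) (fun _ => rfl) (fun _ => rfl)
    (cotIncl (cotObj W M) N x)

theorem cotObjAssoc_nat {W W' : RComod k C.carrier} {M M' : Bicomod C D} {N N' : Bicomod D E}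
    (f : W ⟶ W') (g : M ⟶ M') (h : N ⟶ N') :
    cotMap₂ (cotMap₂ f g) h ≫ (cotObjAssoc W' M' N').hom =
      (cotObjAssoc W M N).hom ≫ cotMap₂ f (cotMap g h) :=
  RComod.hom_ext fun x => cotInclR_inj _ _ _ <| by
    refine (cotIncl_cotObjAssoc _ _ _ _).trans ?_
    refine Eq.trans ?_ (cotInclR_map f g h _).symm
    refine Eq.trans ?_ (congrArg _ (cotIncl_cotObjAssoc W M N x)).symm
    refine Eq.trans ?_ (map_assoc f.lin g.lin h.lin _)
    exact congrArg _ (cotInclL_map f g h x)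

/-- Both sides become rebracketings after embedding into `W ⊗ (M ⊗ (N ⊗ P))`, where they agree by
the pentagon for vector spaces in the form `pentagon_aux`. This yields the associator axiom of the
pseudofunctor. -/
theorem cotObjAssoc_pentagon (W : RComod k C.carrier) (M : Bicomod C D) (N : Bicomod D E)
    (P : Bicomod E F) :
    cotMap₂ (cotObjAssoc W M N).hom (𝟙 P) ≫ (cotObjAssoc W (cotensor M N) P).hom ≫
      cotMap₂ (𝟙 W) (cotAssoc M N P).hom =
    (cotObjAssoc (cotObj W M) N P).hom ≫ (cotObjAssoc W M (cotensor N P)).hom :=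
  RComod.hom_ext fun x => cotInclR_inj _ _ _ <|
    lTensor_inj W.carrier (lTensor_inj M.carrier (incl_inj N P)) <| by
    let y := (cotObjAssoc W (cotensor M N) P).hom.lin
      ((cotMap₂ (cotObjAssoc W M N).hom (𝟙 P)).lin x)
    let y' := (cotObjAssoc (cotObj W M) N P).hom.lin x
    let X := cotIncl (cotObj (cotObj W M) N) P x
    -- Each of `e1` to `e4` replaces one cotensor associator by the associator of tensor products,
    -- at the cost of an inclusion in one more factor.
    have e1 : ((incl N P).lin.lTensor M.carrier).lTensor W.carrier
        (cotInclR W M (cotensor N P) ((cotMap₂ (𝟙 W) (cotAssoc M N P).hom).lin y)) =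
        (TensorProduct.assoc k M.carrier N.carrier P.carrier).toLinearMap.lTensor W.carrier
          (((incl M N).lin.rTensor P.carrier).lTensor W.carrier
            (cotInclR W (cotensor M N) P y)) :=
      lTensor_comp3 (fun z => inclR_cotAssoc M N P z) (cotIncl W (cotensor (cotensor M N) P) y)
    have e2 : cotInclR W (cotensor M N) P y = TensorProduct.assoc k _ _ _
        ((cotIncl W (cotensor M N)).rTensor P.carrier
          ((cotObjAssocLin W M N).rTensor P.carrier X)) :=
      cotIncl_cotObjAssoc _ _ _ _
    have e3 : ((incl N P).lin.lTensor M.carrier).lTensor W.carrier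
        (cotInclR W M (cotensor N P) ((cotObjAssoc W M (cotensor N P)).hom.lin y')) =
        TensorProduct.assoc k W.carrier M.carrier (N.carrier ⊗[k] P.carrier)
          ((cotIncl W M).rTensor _ (cotInclR (cotObj W M) N P y')) :=
      (congrArg _ (cotIncl_cotObjAssoc W M (cotensor N P) y')).trans <|
        (assoc_lTensor _ _).trans (congrArg _ (lr_comm _ _ _).symm)
    have e4 : cotInclR (cotObj W M) N P y' = TensorProduct.assoc k _ _ _
        ((cotIncl (cotObj W M) N).rTensor P.carrier X) := cotIncl_cotObjAssoc _ _ _ _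
    refine e1.trans (Eq.trans ?_ e3.symm)
    rw [e2, e4]
    refine Eq.trans ?_ (pentagon_aux (cotIncl (cotObj W M) N) (cotIncl W M) X)
    refine congrArg _ ((assoc_mTensor _ _).trans (congrArg _ ?_))
    exact rTensor_comp3 (fun z => cotInclR_assocLin W M N z) X

/-- Inside `W ⊗ M`, both sides apply the counit to the middle factor of `W ⊗ C ⊗ M`; they differ
only in whether the scalar is attached to `W` or to `M`. -/
theorem cotObjAssoc_triangle (W : RComod k C.carrier) (M : Bicomod C D) :
    (cotObjAssoc W (unit C) M).hom ≫ cotMap₂ (𝟙 W) (cotLeft M).hom =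
      cotMap₂ (cotObjUnit W).hom (𝟙 M) :=
  cot_hom_ext fun x => by
    refine Eq.trans ?_ (triangle_aux (Coalgebra.counit (R := k) (A := C.carrier))
      (cotIncl W (unit C)) (cotIncl (cotObj W (unit C)) M x))
    refine Eq.trans ?_ (congrArg _ (cotIncl_cotObjAssoc W (unit C) M x))
    exact (map_comp_eq (fun _ => rfl) (fun _ => rfl) _).symm

/-- The functional acts on the last factor only, so it commutes with `i`. This is the vector space
identity behind the right unit axiom. -/
theorem lTensor_rid {W M D V : Type u} [AddCommGroup W] [Module k W] [AddCommGroup M]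
    [Module k M] [AddCommGroup D] [Module k D] [AddCommGroup V] [Module k V]
    (e : D →ₗ[k] k) (i : V →ₗ[k] W ⊗[k] M) (t : V ⊗[k] D) :
    ((TensorProduct.rid k M).toLinearMap ∘ₗ e.lTensor M).lTensor W
      (TensorProduct.assoc k W M D (i.rTensor D t)) =
    i (TensorProduct.rid k V (e.lTensor V t)) := by
  induction t with
  | zero => simp
  | add x y hx hy => simp only [map_add, hx, hy]
  | tmul v n =>
    simp only [LinearMap.rTensor_tmul, LinearMap.lTensor_tmul, TensorProduct.rid_tmul, map_smul]
    generalize i v = t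
    induction t with
    | zero => simp
    | add x y hx hy => simp only [map_add, TensorProduct.add_tmul, smul_add, hx, hy]
    | tmul x y => simp

theorem cotObjAssoc_right (W : RComod k C.carrier) (M : Bicomod C D) :
    (cotObjAssoc W M (unit D)).hom ≫ cotMap₂ (𝟙 W) (cotRight M).hom =
      (cotObjUnit (cotObj W M)).hom :=
  cot_hom_ext fun x => by
    refine Eq.trans ?_ (lTensor_rid (Coalgebra.counit (R := k) (A := D.carrier))
      (cotIncl W M) (cotIncl (cotObj W M) (unit D) x))
    refine Eq.trans ?_ (congrArg _ (cotIncl_cotObjAssoc W M (unit D) x))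
    exact (map_comp_eq (fun _ => rfl) (fun _ => rfl) _).symm

/-- The inverse of `W □_C C ≅ W` is the coaction, so naturality is colinearity of `f`. -/
theorem cotObjUnit_nat {W W' : RComod k C.carrier} (f : W ⟶ W') :
    f ≫ (cotObjUnit W').inv = (cotObjUnit W).inv ≫ cotMap₂ f (𝟙 (unit C)) :=
  cot_hom_ext fun w => f.rho w

/-- On elements both sides are `x ⊗ (w ⊗ m ⊗ n) ↦ (x₍₀₎ ⊗ w) ⊗ x₍₁₎m ⊗ x₍₂₎n`. One side lets `x₍₁₎`
act diagonally on `M ⊗ N`, the other acts on `N` and on `M` in turn; coassociativity of `X`, in the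
form `amb_coassoc`, reconciles them. -/
theorem cotObjAssoc_lax (X : RComod k H) (W : RComod k C.carrier) (M : Bicomod C D)
    (N : Bicomod D E) :
    RComod.tensMap E (𝟙 X) (cotObjAssoc W M N).hom ≫ cotLax X W (cotensor M N) =
      (cotLax X (cotObj W M) N ≫ cotMap₂ (cotLax X W M) (𝟙 N)) ≫
        (cotObjAssoc (RComod.tens C X W) M N).hom := by
  refine cot_hom_ext (W := RComod.tens C X W)
    fun (t : X.carrier ⊗[k] (cotObj (cotObj W M) N).carrier) => ?_
  apply lTensor_inj _ (incl_inj M N)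
  refine Eq.trans ?_ (cotIncl_cotObjAssoc (RComod.tens C X W) M N
    ((cotMap₂ (cotLax X W M) (𝟙 N)).lin ((cotLax X (cotObj W M) N).lin t))).symm
  let a := cotIncl (cotObj W M) N
  let b := cotIncl W M
  have e1 : (incl M N).lin.lTensor (X.carrier ⊗[k] W.carrier)
      (cotIncl (RComod.tens C X W) (cotensor M N)
        ((cotLax X W (cotensor M N)).lin
          ((cotObjAssoc W M N).hom.lin.lTensor X.carrier t))) =
      amb W.carrier (diag M.act N.act) X.rho
        ((TensorProduct.assoc k W.carrier M.carrier N.carrier).toLinearMap.lTensor X.carrier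
          ((b.rTensor N.carrier).lTensor X.carrier (a.lTensor X.carrier t))) := by
    refine (amb_natA X.rho (incl M N).act _).symm.trans (congrArg _ ?_)
    exact lTensor_comp3 (cotIncl_cotObjAssoc W M N) t
  have e2 : (cotIncl (RComod.tens C X W) M).rTensor N.carrier
      (cotIncl _ N ((cotMap₂ (cotLax X W M) (𝟙 N)).lin ((cotLax X (cotObj W M) N).lin t))) =
      (amb W.carrier M.act X.rho).rTensor N.carrier ((b.lTensor X.carrier).rTensor N.carrier
        (amb (cotObj W M).carrier N.act X.rho (a.lTensor X.carrier t))) := by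
    have : cotIncl (RComod.tens C X W) M ∘ₗ (cotLax X W M).lin =
      amb W.carrier M.act X.rho ∘ₗ b.lTensor X.carrier := rfl
    rw [← LinearMap.rTensor_comp_apply, ← this]
    exact (LinearMap.rTensor_comp_apply _ _ _ _).symm
  refine e1.trans ?_
  refine Eq.trans ?_ (congrArg (TensorProduct.assoc k _ M.carrier N.carrier) e2.symm)
  rw [← amb_natW, amb_coassoc _ _ X.isRight]

/-- `(- □_D N) ∘ (- □_C M) ≅ - □_C (M □_D N)` as lax module functors. -/
noncomputable def cotensorComp (M : Bicomod C D) (N : Bicomod D E) :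
    (cotensorFunctor M).comp (cotensorFunctor N) ≅ cotensorFunctor (cotensor M N) :=
  ModNat.iso
    { nat :=
        { app := fun W => (cotObjAssoc W M N).hom
          naturality := fun W W' f => (cotObjAssoc_nat f (𝟙 M) (𝟙 N)).trans <| by
            rw [cotMap_id]; rfl }
      comm := fun X W => cotObjAssoc_lax X W M N }
    (fun W => (cotObjAssoc W M N).inv) (fun W => (cotObjAssoc W M N).hom_inv_id)
    (fun W => (cotObjAssoc W M N).inv_hom_id)

/-- `- □_C C` is isomorphic to the identity as a lax module functor. -/
noncomputable def cotensorUnit (C : HCoalg k H) :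
    LaxFun.id (comodCat C) ≅ cotensorFunctor (unit C) :=
  ModNat.iso
    { nat :=
        { app := fun W => (cotObjUnit W).inv
          naturality := fun W W' f => cotObjUnit_nat f }
      -- The coaction of `X ⊗ W` is the coaction of `W` followed by `x ⊗ (w ⊗ c) ↦ (x₍₀₎ ⊗ w) ⊗
      -- x₍₁₎c`, and the latter is the structure morphism of `- □_C C`.
      comm := fun X (W : RComod k C.carrier) => cot_hom_ext (W := RComod.tens C X W)
        fun (t : X.carrier ⊗[k] W.carrier) => by
          refine Eq.trans ?_ (LinearMap.congr_fun (tensRho_eq C.act X.rho W.rho) t).symm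
          exact congrArg (amb W.carrier C.act X.rho)
            (LinearMap.lTensor_comp_apply X.carrier (cotIncl W (unit C)) (cotObjUnit W).inv.lin
              t).symm }
    (fun W => (cotObjUnit W).hom) (fun W => (cotObjUnit W).inv_hom_id)
    (fun W => (cotObjUnit W).hom_inv_id)

/-- The pseudofunctor `C ↦ 𝔐^C`, `M ↦ - □_C M`. -/
noncomputable def comodPseudo
    (hL : ∀ {C D : HCoalg k H} (M : C ⟶ D), (cotensorFunctor M).TypeL) :
    Pseudofunctor (HCoalg k H) (HMod k H) where
  toPrelaxFunctor := comodPrelax hL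
  mapId C := HMod.isoOf (F := (comodPrelax hL).map (𝟙 C)) (G := 𝟙 (comodHMod C))
    (cotensorUnit C).symm
  mapComp M N := HMod.isoOf (F := (comodPrelax hL).map (M ≫ N))
    (G := (comodPrelax hL).map M ≫ (comodPrelax hL).map N) (cotensorComp M N).symm
  map₂_whisker_left {_ _ _} M {N N'} f := ModNat.ext_app fun (W : RComod k _) => by
    have e := cotObjAssoc_nat (𝟙 W) (𝟙 M) f
    rw [cotMap₂_id] at e
    exact ((Iso.eq_inv_comp _).2 e.symm)
  map₂_whisker_right {_ _ _} {M M'} f N := ModNat.ext_app fun (W : RComod k _) =>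
    (Iso.eq_inv_comp _).2 (cotObjAssoc_nat (𝟙 W) f (𝟙 N)).symm
  map₂_associator {_ _ _ _} M N P := ModNat.ext_app fun (W : RComod k _) => by
    have e := cotObjAssoc_pentagon W M N P
    -- The axiom contains the whiskered inverse associator; by functoriality of `- □ P` it cancels
    -- against the first arrow of the pentagon.
    have e' : cotMap₂ (cotObjAssoc W M N).inv (𝟙 P) ≫ cotMap₂ (cotObjAssoc W M N).hom (𝟙 P) =
        𝟙 (cotObj (cotObj W (cotensor M N)) P) :=
      ((cotFunctor P).map_comp _ _).symm.trans (by
        rw [Iso.inv_hom_id]; exact (cotFunctor P).map_id _)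
    refine (Iso.eq_inv_comp _).2 (?_ : (cotObjAssoc W (cotensor M N) P).hom ≫
      cotMap₂ (𝟙 W) (cotAssoc M N P).hom = cotMap₂ (cotObjAssoc W M N).inv (𝟙 P) ≫
        𝟙 _ ≫ (cotObjAssoc (cotObj W M) N P).hom ≫ (cotObjAssoc W M (cotensor N P)).hom)
    rw [Category.id_comp, ← e, reassoc_of% e']
  map₂_left_unitor {_ _} M := ModNat.ext_app fun (W : RComod k _) =>
    (Iso.eq_inv_comp _).2 <| (cotObjAssoc_triangle W M).trans (Category.comp_id _).symm
  map₂_right_unitor {_ _} M := ModNat.ext_app fun (W : RComod k _) =>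
    (Iso.eq_inv_comp _).2 <| (cotObjAssoc_right W M).trans (Category.comp_id _).symm

end Comparison

end HopfModCat

namespace HopfModCat

/-! ### Contraction with linear functionals -/

section Functionals

variable {k : Type u} [Field k] {A V W N : Type u} [AddCommGroup A] [Module k A]
  [AddCommGroup V] [Module k V] [AddCommGroup W] [Module k W] [AddCommGroup N] [Module k N]

/-- `φ ⊗ V : A ⊗ V → V` for a functional `φ` on `A`. -/
noncomputable def contract (V : Type u) [AddCommGroup V] [Module k V] (φ : A →ₗ[k] k) :
    A ⊗[k] V →ₗ[k] V :=
  (TensorProduct.lid k V).toLinearMap ∘ₗ φ.rTensor V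

theorem contract_tmul (φ : A →ₗ[k] k) (a : A) (v : V) : contract V φ (a ⊗ₜ v) = φ a • v := by
  simp [contract]

/-- The coordinate functionals of a basis of `A` already detect an element of `A ⊗ V`. -/
theorem contract_ext {s t : A ⊗[k] V} (h : ∀ φ : A →ₗ[k] k, contract V φ s = contract V φ t) :
    s = t := by
  classical
  let b := Module.Basis.ofVectorSpace k A
  apply (TensorProduct.equivFinsuppOfBasisLeft b).injective
  ext i
  rw [TensorProduct.equivFinsuppOfBasisLeft_apply, TensorProduct.equivFinsuppOfBasisLeft_apply]
  exact h (b.coord i)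

theorem contract_nat (φ : A →ₗ[k] k) (f : V →ₗ[k] W) (t : A ⊗[k] V) :
    contract W φ (f.lTensor A t) = f (contract V φ t) := by
  induction t with
  | zero => simp
  | add x y hx hy => simp only [map_add, hx, hy]
  | tmul a v => simp [contract_tmul]

theorem contract_assoc (φ : A →ₗ[k] k) (t : (A ⊗[k] V) ⊗[k] N) :
    contract (V ⊗[k] N) φ (TensorProduct.assoc k A V N t) = (contract V φ).rTensor N t :=
  LinearMap.congr_fun (f := contract (V ⊗[k] N) φ ∘ₗ (TensorProduct.assoc k A V N).toLinearMap)
    (g := (contract V φ).rTensor N) (TensorProduct.ext_threefold fun a v n => by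
      simp [contract_tmul, TensorProduct.smul_tmul']) t

end Functionals

namespace RComod

variable {k : Type u} [Field k] {C : Type u} [AddCommGroup C] [Module k C] [Coalgebra k C]

/-- `C` as a right comodule over itself. -/
noncomputable def self (k : Type u) [Field k] (C : Type u) [AddCommGroup C] [Module k C]
    [Coalgebra k C] : RComod k C where
  carrier := C
  rho := Coalgebra.comul
  isRight := ⟨fun m => by simp, fun m => by simp⟩

/-- The colinear map `w ↦ φ(w₍₀₎) w₍₁₎`. -/
noncomputable def coeff (W : RComod k C) (φ : W.carrier →ₗ[k] k) : W ⟶ self k C where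
  lin := show W.carrier →ₗ[k] C from contract (A := W.carrier) C φ ∘ₗ W.rho
  -- Colinearity is the coassociativity of `W` with its first factor contracted by `φ`.
  rho v := by
    have h := W.isRight.coassoc v
    have h1 := contract_nat (A := W.carrier) (V := C) (W := C ⊗[k] C) φ
      (Coalgebra.comul (R := k) (A := C)) (W.rho v)
    rw [← h, contract_assoc, ← LinearMap.rTensor_comp_apply] at h1
    exact h1.symm

end RComod

/-! ### Morphisms of lax module functors come from bicomodule maps -/

section FullyFaithful

open Bicomod MonoidalCategory MonoidalLeftAction Functor.LaxLeftLinear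

variable {k : Type u} [Field k] {H : Type u} [Ring H] [Bialgebra k H] {C D : HCoalg k H}

/-- The left coaction as a map `M → C □_C M`. -/
noncomputable def toCot (M : Bicomod C D) :
    M.carrier →ₗ[k] (cotObj (RComod.self k C.carrier) M).carrier :=
  M.lam.codRestrict _ fun x => mem_cot.2 (M.isLeft.coassoc x)

/-- The map `C □_C M → M`, `c ⊗ m ↦ ε(c) m`. -/
noncomputable def ofCot (M : Bicomod C D) :
    (cotObj (RComod.self k C.carrier) M).carrier →ₗ[k] M.carrier :=
  contract M.carrier (Coalgebra.counit (R := k) (A := C.carrier)) ∘ₗ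
    cotIncl (RComod.self k C.carrier) M

theorem cotIncl_toCot (M : Bicomod C D) (m : M.carrier) :
    cotIncl (RComod.self k C.carrier) M (toCot M m) = M.lam m := rfl

theorem ofCot_toCot (M : Bicomod C D) (m : M.carrier) : ofCot M (toCot M m) = m :=
  M.isLeft.counit m

theorem toCot_ofCot (M : Bicomod C D) (x : (cotObj (RComod.self k C.carrier) M).carrier) :
    toCot M (ofCot M x) = x :=
  LinearMap.congr_fun (congrArg Bicomod.Hom.lin (cotLeft M).hom_inv_id) x

theorem rcolin_toCot (M : Bicomod C D) :
    RColin M.rho (cotObj (RComod.self k C.carrier) M).rho (toCot M) := (cotLeft M).inv.rho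

theorem rcolin_ofCot (M : Bicomod C D) :
    RColin (cotObj (RComod.self k C.carrier) M).rho M.rho (ofCot M) := (cotLeft M).hom.rho

theorem coeff_cot (W : RComod k C.carrier) (M : Bicomod C D) (φ : W.carrier →ₗ[k] k)
    (x : (cotObj W M).carrier) :
    cotIncl (RComod.self k C.carrier) M ((cotMap₂ (W.coeff φ) (𝟙 M)).lin x) =
      contract (C.carrier ⊗[k] M.carrier) φ (TensorProduct.assoc k W.carrier C.carrier M.carrier
        (W.rho.rTensor M.carrier (cotIncl W M x))) := by
  rw [contract_assoc, ← LinearMap.rTensor_comp_apply]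
  exact cotIncl_map₂ (W.coeff φ) (𝟙 M) x

/-- On `W □ M` the coaction of `W` may be exchanged for that of `M`. The first, `W`-valued, factor
can then be contracted before the coaction of `M` is applied. -/
theorem coeff_cot' (W : RComod k C.carrier) (M : Bicomod C D) (φ : W.carrier →ₗ[k] k)
    (x : (cotObj W M).carrier) :
    (cotMap₂ (W.coeff φ) (𝟙 M)).lin x =
      toCot M (contract M.carrier φ (cotIncl W M x)) :=
  cotIncl_inj _ _ <| by
    rw [coeff_cot, cotIncl_toCot, mem_cot.1 (cotDiff_cotIncl x), contract_nat]

theorem rho_injective (W : RComod k C.carrier) : Function.Injective W.rho := fun x y h => by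
  rw [← W.isRight.counit x, ← W.isRight.counit y, h]

/-- The coaction of `W` is injective and functionals on `W` separate `W ⊗ C ⊗ M`, so the morphisms
induced by `W → C` jointly embed `W □ M` into copies of `C □ M`. This is the sense in which `C` is a
cogenerator. -/
theorem coeff_ext {W : RComod k C.carrier} {M : Bicomod C D} {x y : (cotObj W M).carrier}
    (h : ∀ φ, (cotMap₂ (W.coeff φ) (𝟙 M)).lin x = (cotMap₂ (W.coeff φ) (𝟙 M)).lin y) : x = y := by
  apply cotIncl_inj
  apply rTensor_inj M.carrier (rho_injective W)
  apply (TensorProduct.assoc k W.carrier C.carrier M.carrier).injective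
  refine contract_ext fun φ => ?_
  rw [← coeff_cot, ← coeff_cot, h]

/-- The action `H ⊗ C → C` as a morphism of right comodules. -/
noncomputable def actHom (C : HCoalg k H) :
    RComod.tens C (RComod.self k H) (RComod.self k C.carrier) ⟶ RComod.self k C.carrier where
  lin := TensorProduct.lift C.act.toLinearMap
  rho := by
    intro t
    have e := LinearMap.congr_fun (f := Coalgebra.comul (R := k) ∘ₗ
      TensorProduct.lift C.act.toLinearMap)
      (g := (TensorProduct.lift C.act.toLinearMap).rTensor C.carrier ∘ₗ
        RComod.tensRho C.act.toLinearMap (Coalgebra.comul (R := k) (A := H))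
          (Coalgebra.comul (R := k) (A := C.carrier))) (TensorProduct.ext' fun h c => by
        simp only [LinearMap.comp_apply, TensorProduct.lift.tmul, AlgHom.toLinearMap_apply,
          C.comul_act, diag_apply, RComod.tensRho, TensorProduct.map_tmul]
        rw [← LinearMap.comp_apply, LinearMap.rTensor_comp_lTensor]
        rfl) t
    exact e

/-- For `X = H` the structure morphism produces `(h₍₁₎ ⊗ c) ⊗ h₍₂₎a`, and letting `h₍₁₎` act on `c`
gives the diagonal action. This is how an action of `H` is read off from a lax module structure. -/
theorem actHom_amb (C : HCoalg k H) {A : Type u} [AddCommGroup A] [Module k A]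
    (a : H →ₐ[k] Module.End k A) (h : H) (t : C.carrier ⊗[k] A) :
    (TensorProduct.lift C.act.toLinearMap).rTensor A
      (amb C.carrier a (Coalgebra.comul (R := k) (A := H)) (h ⊗ₜ t)) = diag C.act a h t := by
  rw [diag_apply]
  simp only [amb, LinearMap.comp_apply, LinearMap.rTensor_tmul]
  rw [← LinearMap.comp_apply (LinearMap.rTensor _ _), LinearMap.rTensor_comp_lTensor]
  rfl

/-- `H ⊗ (C □_C M) → C □_C M` -/
noncomputable def cotAct (M : Bicomod C D) :
    RComod.tens D (RComod.self k H) (cotObj (RComod.self k C.carrier) M) ⟶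
      cotObj (RComod.self k C.carrier) M :=
  cotLax (RComod.self k H) (RComod.self k C.carrier) M ≫ cotMap₂ (actHom C) (𝟙 M)

/-- By `actHom_amb` this is the `H`-linearity of the left coaction. It identifies the given action
on `M` with the one obtained from the lax structure of `- □_C M`. -/
theorem cotAct_toCot (M : Bicomod C D) (h : H) (m : M.carrier) :
    (cotAct M).lin (show H ⊗[k] _ from h ⊗ₜ toCot M m) = toCot M (M.act h m) :=
  cotIncl_inj _ _ <|
    (actHom_amb C M.act h (M.lam m)).trans (M.lam_act h m).symm

variable {M N : Bicomod C D} (α : ModNat (cotensorFunctor M) (cotensorFunctor N))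

/-- The component `W □_C M → W □_C N`. -/
def ModNat.comp₁ (W : RComod k C.carrier) : cotObj W M ⟶ cotObj W N := α.nat.app W

theorem ModNat.comp₁_nat {V W : RComod k C.carrier} (f : V ⟶ W) :
    cotMap₂ f (𝟙 M) ≫ α.comp₁ W = α.comp₁ V ≫ cotMap₂ f (𝟙 N) := α.nat.naturality f

theorem ModNat.comp₁_lax (X : RComod k H) (W : RComod k C.carrier) :
    RComod.tensMap D (𝟙 X) (α.comp₁ W) ≫ cotLax X W N =
      cotLax X W M ≫ α.comp₁ (RComod.tens C X W) := α.comm X W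

/-- Compatibility with the structure morphism at `X = H` is combined with naturality along the
action `H ⊗ C → C`. -/
theorem ModNat.comp₁_act :
    RComod.tensMap D (𝟙 (RComod.self k H)) (α.comp₁ (RComod.self k C.carrier)) ≫ cotAct N =
      cotAct M ≫ α.comp₁ (RComod.self k C.carrier) := by
  rw [cotAct, cotAct, ← Category.assoc, α.comp₁_lax, Category.assoc, Category.assoc, α.comp₁_nat]

/-- The linear map `M → N` underlying `α`. -/
noncomputable def ModNat.lin : M.carrier →ₗ[k] N.carrier :=
  ofCot N ∘ₗ (α.comp₁ (RComod.self k C.carrier)).lin ∘ₗ toCot M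

theorem ModNat.toCot_lin (m : M.carrier) :
    toCot N (α.lin m) = (α.comp₁ (RComod.self k C.carrier)).lin (toCot M m) := toCot_ofCot N _

theorem toCot_injective (M : Bicomod C D) : Function.Injective (toCot M) :=
  Function.LeftInverse.injective (ofCot_toCot M)

/-- Naturality of `α` along the endomorphism `c ↦ φ(c₍₁₎)c₍₂₎` of the right comodule `C`, read
through `C □_C M ≅ M`. Since functionals on `C` separate `C ⊗ N`, this amounts to left colinearity.
-/
theorem ModNat.lin_contract (φ : C.carrier →ₗ[k] k) (m : M.carrier) :
    α.lin (contract M.carrier φ (M.lam m)) = contract N.carrier φ (N.lam (α.lin m)) := by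
  apply toCot_injective
  have e := LinearMap.congr_fun (congrArg RComod.Hom.lin
    (α.comp₁_nat ((RComod.self k C.carrier).coeff φ))) (toCot M m)
  have e₁ := coeff_cot' (RComod.self k C.carrier) M φ (toCot M m)
  have e₂ := coeff_cot' (RComod.self k C.carrier) N φ (toCot N (α.lin m))
  rw [α.toCot_lin] at e₂ ⊢
  exact (congrArg _ e₁).symm.trans (e.trans (e₂.trans (by rw [← α.toCot_lin]; rfl)))

/-- The bicomodule map underlying a morphism of lax module functors `- □_C M ⟶ - □_C N`. -/
noncomputable def ModNat.toHom : M ⟶ N where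
  lin := α.lin
  act h m := by
    apply toCot_injective
    rw [α.toCot_lin, ← cotAct_toCot, ← cotAct_toCot, α.toCot_lin]
    exact (LinearMap.congr_fun (congrArg RComod.Hom.lin α.comp₁_act) _).symm
  lam m := contract_ext fun φ => by rw [← α.lin_contract, contract_nat]
  rho := (rcolin_ofCot N).comp ((α.comp₁ (RComod.self k C.carrier)).rho.comp (rcolin_toCot M))

theorem ModNat.comp₁_self :
    α.comp₁ (RComod.self k C.carrier) = cotMap₂ (𝟙 (RComod.self k C.carrier)) α.toHom :=
  RComod.hom_ext fun x => by
    obtain ⟨m, rfl⟩ : ∃ m, toCot M m = x := ⟨_, toCot_ofCot M x⟩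
    rw [← α.toCot_lin]
    exact cotIncl_inj _ _ (α.toHom.lam m)

theorem cotMap₂_exchange {V W : RComod k C.carrier} {M N : Bicomod C D} (f : V ⟶ W) (g : M ⟶ N) :
    cotMap₂ f (𝟙 M) ≫ cotMap₂ (𝟙 W) g = cotMap₂ (𝟙 V) g ≫ cotMap₂ f (𝟙 N) :=
  (cotNat g).naturality f

/-- The two transformations agree at `C`. Naturality along the maps `W → C` given by functionals
transports the agreement to `W`, because these maps separate `W □ N`. -/
theorem ModNat.comp₁_eq (W : RComod k C.carrier) : α.comp₁ W = cotMap₂ (𝟙 W) α.toHom :=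
  RComod.hom_ext fun x => coeff_ext fun φ => by
    have e1 := LinearMap.congr_fun (congrArg RComod.Hom.lin (α.comp₁_nat (W.coeff φ))) x
    have e2 := LinearMap.congr_fun (congrArg RComod.Hom.lin
      (cotMap₂_exchange (W.coeff φ) α.toHom)) x
    rw [α.comp₁_self] at e1
    exact e1.symm.trans e2

theorem ModNat.eq_cotensorNat : α = cotensorNat α.toHom := ModNat.ext_app fun W => α.comp₁_eq W

theorem ofCot_map (f : M ⟶ N) (x : (cotObj (RComod.self k C.carrier) M).carrier) :
    ofCot N ((cotMap₂ (𝟙 (RComod.self k C.carrier)) f).lin x) = f.lin (ofCot M x) :=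
  contract_nat _ f.lin _

theorem cotensorNat_injective {f g : M ⟶ N} (h : cotensorNat f = cotensorNat g) : f = g :=
  Bicomod.hom_ext fun m => by
    rw [← ofCot_toCot M m, ← ofCot_map, ← ofCot_map]
    exact congrArg (ofCot N) <| LinearMap.congr_fun (congrArg
      (fun α : ModNat (cotensorFunctor M) (cotensorFunctor N) =>
        RComod.Hom.lin (α.comp₁ (RComod.self k C.carrier))) h) _

end FullyFaithful

end HopfModCat

namespace HopfModCat

open MonoidalCategory MonoidalLeftAction Functor.LaxLeftLinear Limits

/-! ### Trivial comodules, cofree comodules and the coaction of `X ⊗ W` -/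

namespace RComod

variable {k : Type u} [Field k] {H : Type u} [Ring H] [Bialgebra k H] {C : HCoalg k H}
  {V V' : Type u} [AddCommGroup V] [Module k V] [AddCommGroup V'] [Module k V']

variable (k H V) in
/-- The trivial comodule `v ↦ v ⊗ 1` on a vector space. -/
noncomputable def const : RComod k H where
  carrier := V
  rho := (TensorProduct.mk k V H).flip 1
  isRight :=
    { coassoc := fun m => by
        simp [Bialgebra.comul_one, Algebra.TensorProduct.one_def]
      counit := fun m => by simp }

variable (H) in
noncomputable def constMap (f : V →ₗ[k] V') : const k H V ⟶ const k H V' where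
  lin := f
  rho v := rfl

theorem tensRho_const (C : HCoalg k H) {W : Type u} [AddCommGroup W] [Module k W]
    (ρ : W →ₗ[k] W ⊗[k] C.carrier) :
    tensRho C.act.toLinearMap ((TensorProduct.mk k V H).flip 1) ρ = outR V ρ := by
  refine TensorProduct.ext' fun v w => ?_
  rw [outR_tmul]
  simp only [tensRho, LinearMap.comp_apply, TensorProduct.map_tmul]
  generalize ρ w = t
  induction t with
  | zero => simp
  | add x y hx hy => simp only [map_add, TensorProduct.tmul_add, hx, hy]
  | tmul w c => simp

/-- The inclusion `w ↦ v ⊗ w`. -/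
noncomputable def insert (C : HCoalg k H) (W : RComod k C.carrier) (v : V) :
    W ⟶ tens C (const k H V) W :=
  (tensUnit C W).inv ≫ tensMap C (constMap H (LinearMap.toSpanSingleton k V v)) (𝟙 W)

theorem insert_lin (C : HCoalg k H) (W : RComod k C.carrier) (v : V) (w : W.carrier) :
    (insert C W v).lin w = (show V ⊗[k] W.carrier from v ⊗ₜ w) := by
  show TensorProduct.map (LinearMap.toSpanSingleton k V v) LinearMap.id
    ((1 : k) ⊗ₜ[k] w) = v ⊗ₜ w
  simp

/-- A basis of `V` splits `V ⊗ W` into copies of `W` with colinear inclusions. Hence `V ⊗ W` is a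
coproduct of copies of `W` in the comodule category, which a coproduct-preserving functor must
respect. -/
theorem insert_directSumData (C : HCoalg k H) (W : RComod k C.carrier) {ι : Type u}
    (b : Module.Basis ι k V) : DirectSumData (fun j => (insert C W (b j)).lin)
      (fun j => show V ⊗[k] W.carrier →ₗ[k] W.carrier from contract W.carrier (b.coord j)) where
  same j x := by
    refine (congrArg (contract W.carrier (b.coord j)) (insert_lin C W (b j) x)).trans ?_
    simp [contract_tmul]
  ne j l x hjl := by
    refine (congrArg (contract W.carrier (b.coord l)) (insert_lin C W (b j) x)).trans ?_
    rw [contract_tmul, Module.Basis.coord_apply, Module.Basis.repr_self,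
      Finsupp.single_eq_of_ne (Ne.symm hjl), zero_smul]
  total t := by
    classical
    have key : ∀ t : V ⊗[k] W.carrier, ∃ s : Finset ι, ∀ s' : Finset ι, s ⊆ s' →
        ∑ j ∈ s', b j ⊗ₜ[k] contract W.carrier (b.coord j) t = t := by
      intro t
      induction t with
      | zero => exact ⟨∅, by simp⟩
      | add x y hx hy =>
        obtain ⟨s, hs⟩ := hx
        obtain ⟨s', hs'⟩ := hy
        refine ⟨s ∪ s', fun r hr => ?_⟩
        simp only [map_add, TensorProduct.tmul_add, Finset.sum_add_distrib]
        rw [hs r (Finset.union_subset_left hr), hs' r (Finset.union_subset_right hr)]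
      | tmul v w =>
        -- Only basis vectors in the support of `v` contribute, and adding others adds zero terms.
        refine ⟨(b.repr v).support, fun r hr => ?_⟩
        simp only [contract_tmul, ← TensorProduct.smul_tmul, ← TensorProduct.sum_tmul]
        congr 1
        conv_rhs => rw [← b.linearCombination_repr v, Finsupp.linearCombination_apply]
        refine (Finset.sum_subset hr fun j _ hj => ?_).symm
        rw [Module.Basis.coord_apply, Finsupp.notMem_support_iff.1 hj, zero_smul]
    obtain ⟨s, hs⟩ := key t
    refine ⟨s, fun s' h => Eq.trans (Finset.sum_congr rfl fun j _ => ?_) (hs s' h)⟩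
    exact insert_lin C W (b j) _

/-- The coaction as a colinear map to a cofree comodule. -/
noncomputable def rhoHom (W : RComod k C.carrier) :
    W ⟶ tens C (const k H W.carrier) (self k C.carrier) where
  lin := W.rho
  rho v := by
    refine (LinearMap.congr_fun (tensRho_const C (Coalgebra.comul (R := k))) (W.rho v)).trans ?_
    apply (TensorProduct.assoc k W.carrier C.carrier C.carrier).injective
    exact (LinearEquiv.apply_symm_apply _ _).trans (W.isRight.coassoc v).symm

theorem rhoHom_nat {V W : RComod k C.carrier} (f : V ⟶ W) :
    f ≫ rhoHom W = rhoHom V ≫ tensMap C (constMap H f.lin) (𝟙 _) :=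
  hom_ext f.rho

/-- `x ⊗ w ↦ (x₍₀₎ ⊗ w) ⊗ x₍₁₎` -/
noncomputable def twist (X : RComod k H) (V : Type u) [AddCommGroup V] [Module k V] :
    tens (regular k H) X (const k H V) ⟶
      tens (regular k H) (const k H (X.carrier ⊗[k] V)) (self k H) where
  lin := tensRho (Algebra.lmul k H).toLinearMap X.rho ((TensorProduct.mk k V H).flip 1)
  -- The map is the coaction of `X ⊗ V`, with `V` trivial, regarded as a map to a cofree comodule;
  -- colinearity is its coassociativity.
  rho v := by
    refine (LinearMap.congr_fun (tensRho_const (regular k H) (Coalgebra.comul (R := k) (A := H)))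
      _).trans ?_
    apply (TensorProduct.assoc k (X.carrier ⊗[k] V) H H).injective
    exact (LinearEquiv.apply_symm_apply _ _).trans
      ((tens (regular k H) X (const k H V)).isRight.coassoc v).symm

theorem twist_tmul (X : RComod k H) (x : X.carrier) (v : V) :
    (twist X V).lin (show X.carrier ⊗[k] V from x ⊗ₜ v) =
      ((TensorProduct.mk k X.carrier V).flip v).rTensor H (X.rho x) := by
  show tensRho (Algebra.lmul k H).toLinearMap X.rho ((TensorProduct.mk k V H).flip 1) (x ⊗ₜ v) = _
  simp only [tensRho, LinearMap.comp_apply, TensorProduct.map_tmul]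
  generalize X.rho x = t
  induction t with
  | zero => simp
  | add x y hx hy => simp only [map_add, TensorProduct.add_tmul, hx, hy]
  | tmul x h => simp

/-- The map `x ⊗ (v ⊗ m) ↦ (x₍₀₎ ⊗ v) ⊗ x₍₁₎m` is split into a morphism of `H`-comodules, which
brings `x₍₁₎` out as a separate factor, and the action of that factor on `A`. The first piece
involves neither `A` nor its action. -/
theorem twist_amb (X : RComod k H) {A : Type u} [AddCommGroup A] [Module k A]
    (a : H →ₐ[k] Module.End k A) (t : X.carrier ⊗[k] (V ⊗[k] A)) :
    (TensorProduct.lift a.toLinearMap).lTensor (X.carrier ⊗[k] V)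
      (TensorProduct.assoc k (X.carrier ⊗[k] V) H A
        ((show X.carrier ⊗[k] V →ₗ[k] (X.carrier ⊗[k] V) ⊗[k] H from (twist X V).lin).rTensor A
          ((TensorProduct.assoc k X.carrier V A).symm t))) = amb V a X.rho t := by
  induction t with
  | zero => simp
  | add x y hx hy => simp only [map_add, hx, hy]
  | tmul x t =>
  induction t with
  | zero => simp
  | add x y hx hy => simp only [map_add, TensorProduct.tmul_add, hx, hy]
  | tmul v m =>
    rw [amb_tmul, TensorProduct.assoc_symm_tmul, LinearMap.rTensor_tmul]
    refine (congrArg (fun s => (TensorProduct.lift a.toLinearMap).lTensor (X.carrier ⊗[k] V)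
      (TensorProduct.assoc k (X.carrier ⊗[k] V) H A (s ⊗ₜ m))) (twist_tmul X x v)).trans ?_
    generalize X.rho x = s
    induction s with
    | zero => simp
    | add x y hx hy => simp only [map_add, TensorProduct.add_tmul, hx, hy]
    | tmul x h => rfl

/-- The coaction of `X ⊗ W` becomes a chain of morphisms built from the coaction of `W`,
associators, morphisms of `H`-comodules and the action of `H` on `C`. The naturality and
associativity of a lax structure apply to each link. -/
theorem rhoHom_tens (X : RComod k H) (W : RComod k C.carrier) :
    rhoHom (tens C X W) = tensMap C (𝟙 X) (rhoHom W) ≫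
      (tensAssoc C X (const k H W.carrier) (self k C.carrier)).inv ≫
      tensMap C (twist X W.carrier) (𝟙 (self k C.carrier)) ≫
      (tensAssoc C (const k H (X.carrier ⊗[k] W.carrier)) (self k H) (self k C.carrier)).hom ≫
      tensMap C (𝟙 (const k H (X.carrier ⊗[k] W.carrier))) (actHom C) :=
  hom_ext fun (t : X.carrier ⊗[k] W.carrier) => by
    refine (LinearMap.congr_fun (tensRho_eq C.act X.rho W.rho) t).trans ?_
    exact (twist_amb X C.act (W.rho.lTensor X.carrier t)).symm

/-- The unit of `H` as a colinear map. -/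
noncomputable def one (k : Type u) [Field k] (H : Type u) [Ring H] [Bialgebra k H] :
    triv k H ⟶ self k H where
  lin := Algebra.linearMap k H
  rho := fun r => Bialgebra.comul_algebraMap (R := k) (A := H) r

end RComod

end HopfModCat

namespace HopfModCat

open MonoidalCategory MonoidalLeftAction Functor.LaxLeftLinear Limits

/-! ### The bicomodule `F(C)` and the comparison of `F` with `- □_C F(C)` -/

section Reconstruction

open RComod

variable {k : Type u} [Field k] {H : Type u} [Ring H] [Bialgebra k H] {C D : HCoalg k H}
  (F : RComod k C.carrier ⥤ RComod k D.carrier) [F.Additive] [F.Linear k]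
  [F.LaxLeftLinear (RComod k H)]

/-- The structure morphism `X ⊗ F(W) ⟶ F(X ⊗ W)`. -/
noncomputable def laxHom (X : RComod k H) (W : RComod k C.carrier) :
    tens D X (F.obj W) ⟶ F.obj (tens C X W) := μₗ F X W

theorem laxHom_left {X Y : RComod k H} (f : X ⟶ Y) (W : RComod k C.carrier) :
    tensMap D f (𝟙 (F.obj W)) ≫ laxHom F Y W = laxHom F X W ≫ F.map (tensMap C f (𝟙 W)) :=
  μₗ_naturality_left F f W

theorem laxHom_right (X : RComod k H) {V W : RComod k C.carrier} (g : V ⟶ W) :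
    tensMap D (𝟙 X) (F.map g) ≫ laxHom F X W = laxHom F X V ≫ F.map (tensMap C (𝟙 X) g) :=
  μₗ_naturality_right F X g

theorem laxHom_assoc (X Y : RComod k H) (W : RComod k C.carrier) :
    laxHom F (tens (regular k H) X Y) W ≫ F.map (tensAssoc C X Y W).hom =
      (tensAssoc D X Y (F.obj W)).hom ≫ tensMap D (𝟙 X) (laxHom F Y W) ≫
        laxHom F X (tens C Y W) :=
  μₗ_associativity F X Y W

theorem laxHom_unit (W : RComod k C.carrier) :
    laxHom F (triv k H) W ≫ F.map (tensUnit C W).hom = (tensUnit D (F.obj W)).hom :=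
  (μₗ_unitality F W).symm

theorem laxHom_assoc_inv (X Y : RComod k H) (W : RComod k C.carrier) :
    tensMap D (𝟙 X) (laxHom F Y W) ≫ laxHom F X (tens C Y W) ≫ F.map (tensAssoc C X Y W).inv =
      (tensAssoc D X Y (F.obj W)).inv ≫ laxHom F (tens (regular k H) X Y) W := by
  rw [Iso.eq_inv_comp, ← Category.assoc, ← Category.assoc, Category.assoc _ _ (laxHom F X _),
    ← laxHom_assoc, Category.assoc, ← F.map_comp, Iso.hom_inv_id, F.map_id, Category.comp_id]

theorem tensMap_id_comp (D : HCoalg k H) (X : RComod k H) {U V W : RComod k D.carrier} (f : U ⟶ V)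
    (g : V ⟶ W) : tensMap D (𝟙 X) (f ≫ g) = tensMap D (𝟙 X) f ≫ tensMap D (𝟙 X) g :=
  actionHomRight_comp X f g

/-- Naturality in `X` reduces the claim to the unit object, where unitality determines the structure
morphism. -/
theorem tensUnit_inv_laxHom {X : RComod k H} (f : triv k H ⟶ X) (W : RComod k C.carrier) :
    ((tensUnit D (F.obj W)).inv ≫ tensMap D f (𝟙 (F.obj W))) ≫ laxHom F X W =
      F.map ((tensUnit C W).inv ≫ tensMap C f (𝟙 W)) := by
  rw [Category.assoc, laxHom_left, F.map_comp, Iso.inv_comp_eq,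
    ← laxHom_unit, Category.assoc, ← F.map_comp_assoc, Iso.hom_inv_id, F.map_id, Category.id_comp]

theorem insert_laxHom {V : Type u} [AddCommGroup V] [Module k V] (W : RComod k C.carrier) (v : V) :
    RComod.insert D (F.obj W) v ≫ laxHom F (const k H V) W = F.map (RComod.insert C W v) :=
  tensUnit_inv_laxHom F (constMap H (LinearMap.toSpanSingleton k V v)) W

/-- For a trivial comodule `V`, the structure morphism `V ⊗ F(W) ⟶ F(V ⊗ W)` is invertible. -/
theorem isIso_laxHom_const (hF : ∀ J : Type u, PreservesColimitsOfShape (Discrete J) F)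
    (V : Type u) [AddCommGroup V] [Module k V] (W : RComod k C.carrier) :
    IsIso (laxHom F (const k H V) W) := by
  let b := Module.Basis.ofVectorSpace k V
  have := hF (Module.Basis.ofVectorSpaceIndex k V)
  -- Domain and codomain are both coproducts of copies of `F(W)` indexed by a basis of `V`. By
  -- `insert_laxHom` the structure morphism respects the injections, so it is the canonical
  -- isomorphism between them.
  let h₁ := isColimitCofan _ (insert_directSumData D (F.obj W) b)
  let h₂ := isColimitCofanMkObjOfIsColimit F _ _ (isColimitCofan _ (insert_directSumData C W b))
  let e := h₁.coconePointUniqueUpToIso h₂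
  have he : e.hom = laxHom F (const k H V) W := h₁.hom_ext fun ⟨j⟩ =>
    (h₁.comp_coconePointUniqueUpToIso_hom h₂ ⟨j⟩).trans (insert_laxHom F W (b j)).symm
  exact he ▸ inferInstance

/-- The underlying comodule `F(C)` of the bicomodule corresponding to `F`. -/
noncomputable abbrev genObj : RComod k D.carrier := F.obj (self k C.carrier)

/-- The map `H ⊗ F(C) → F(C)`. -/
noncomputable def genAct : tens D (self k H) (genObj F) ⟶ genObj F :=
  laxHom F (self k H) (self k C.carrier) ≫ F.map (actHom C)

theorem genAct_one : tensMap D (RComod.one k H) (𝟙 (genObj F)) ≫ genAct F =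
    (tensUnit D (genObj F)).hom := by
  rw [genAct, ← Category.assoc, laxHom_left, Category.assoc, ← F.map_comp, ← laxHom_unit]
  congr 2
  exact RComod.Hom.ext (TensorProduct.ext' fun (r : k) (c : C.carrier) => by
    show C.act (algebraMap k H r) c = r • c
    rw [C.act.commutes]; rfl)

/-- Associativity of the structure morphism for `X = Y = H`, together with `F` applied to the
associativity of the action of `H` on `C`. -/
theorem genAct_mul : tensMap D (actHom (regular k H)) (𝟙 (genObj F)) ≫ genAct F =
    (tensAssoc D (self k H) (self k H) (genObj F)).hom ≫
      tensMap D (𝟙 (self k H)) (genAct F) ≫ genAct F := by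
  have e : tensMap C (actHom (regular k H)) (𝟙 (self k C.carrier)) ≫ actHom C =
      (tensAssoc C (self k H) (self k H) (self k C.carrier)).hom ≫
        tensMap C (𝟙 (self k H)) (actHom C) ≫ actHom C :=
    RComod.Hom.ext (TensorProduct.ext_threefold fun (x y : H) (c : C.carrier) => by
      show C.act (x * y) c = C.act x (C.act y c)
      rw [map_mul]; rfl)
  rw [genAct, ← Category.assoc, laxHom_left, Category.assoc, ← F.map_comp, e, F.map_comp,
    F.map_comp, ← Category.assoc, laxHom_assoc, tensMap_id_comp]
  simp only [Category.assoc]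
  rw [reassoc_of% (laxHom_right F (self k H) (actHom C))]

/-- The left `H`-action on `F(C)`. -/
noncomputable def genActAlg : H →ₐ[k] Module.End k (genObj F).carrier :=
  AlgHom.ofLinearMap
    (TensorProduct.curry (show H ⊗[k] (genObj F).carrier →ₗ[k] (genObj F).carrier from
      (genAct F).lin))
    (LinearMap.ext fun m => by
      have := LinearMap.congr_fun (congrArg Hom.lin (genAct_one F))
        (show k ⊗[k] (genObj F).carrier from 1 ⊗ₜ m)
      refine Eq.trans ?_ (this.trans (one_smul k m))
      exact congrArg (genAct F).lin (congrArg (fun z : H => z ⊗ₜ[k] m) (map_one (algebraMap k H)).symm))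
    (fun x y => LinearMap.ext fun m => LinearMap.congr_fun (congrArg Hom.lin (genAct_mul F))
        (show (H ⊗[k] H) ⊗[k] (genObj F).carrier from (x ⊗ₜ y) ⊗ₜ m))

theorem genAct_eq : (genAct F).lin = TensorProduct.lift (genActAlg F).toLinearMap :=
  TensorProduct.ext' fun _ _ => rfl

variable (hF : ∀ J : Type u, PreservesColimitsOfShape (Discrete J) F)

/-- The coaction `F(W) ⟶ W ⊗ F(C)`. -/
noncomputable def coactHom (W : RComod k C.carrier) :
    F.obj W ⟶ tens D (const k H W.carrier) (genObj F) :=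
  have := isIso_laxHom_const F hF W.carrier (self k C.carrier)
  F.map (rhoHom W) ≫ inv (laxHom F (const k H W.carrier) (self k C.carrier))

theorem coactHom_laxHom (W : RComod k C.carrier) :
    coactHom F hF W ≫ laxHom F (const k H W.carrier) (self k C.carrier) = F.map (rhoHom W) := by
  have := isIso_laxHom_const F hF W.carrier (self k C.carrier)
  rw [coactHom, Category.assoc, IsIso.inv_hom_id, Category.comp_id]

theorem laxHom_const_cancel (hF : ∀ J : Type u, PreservesColimitsOfShape (Discrete J) F)
    {V : Type u} [AddCommGroup V] [Module k V] {W : RComod k C.carrier}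
    {U : RComod k D.carrier} {f g : U ⟶ tens D (const k H V) (F.obj W)}
    (h : f ≫ laxHom F (const k H V) W = g ≫ laxHom F (const k H V) W) : f = g := by
  have := isIso_laxHom_const F hF V W
  exact (cancel_mono _).1 h

theorem coactHom_nat {V W : RComod k C.carrier} (g : V ⟶ W) :
    F.map g ≫ coactHom F hF W =
      coactHom F hF V ≫ tensMap D (constMap H g.lin) (𝟙 (genObj F)) := by
  apply laxHom_const_cancel F hF
  rw [Category.assoc, Category.assoc, coactHom_laxHom, laxHom_left, ← Category.assoc (coactHom _ _ _),
    coactHom_laxHom, ← F.map_comp, ← F.map_comp, rhoHom_nat]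

/-- This is `F` applied to `rhoHom_tens`, with each link moved past the structure morphisms by
naturality or associativity. After the coactions are applied, the structure morphism at every `X` is
expressed through the action of `H` on `F(C)`; `coact_lax` is the form on elements. -/
theorem laxHom_coactHom (X : RComod k H) (W : RComod k C.carrier) :
    laxHom F X W ≫ coactHom F hF (tens C X W) =
      tensMap D (𝟙 X) (coactHom F hF W) ≫
      (tensAssoc D X (const k H W.carrier) (genObj F)).inv ≫
      tensMap D (twist X W.carrier) (𝟙 (genObj F)) ≫
      (tensAssoc D (const k H (X.carrier ⊗[k] W.carrier)) (self k H) (genObj F)).hom ≫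
      tensMap D (𝟙 (const k H (X.carrier ⊗[k] W.carrier))) (genAct F) := by
  -- The coaction contains the inverse of a structure morphism at a trivial comodule; composing with
  -- that structure morphism leaves only `F` of coactions.
  apply laxHom_const_cancel F hF (V := X.carrier ⊗[k] W.carrier)
  rw [Category.assoc]
  refine (congrArg (laxHom F X W ≫ ·) (coactHom_laxHom F hF (tens C X W))).trans ?_
  refine (congrArg (fun g : tens C X W ⟶ tens C (const k H (X.carrier ⊗[k] W.carrier))
    (self k C.carrier) => laxHom F X W ≫ F.map g) (rhoHom_tens X W)).trans ?_
  simp only [F.map_comp, Category.assoc]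
  rw [← reassoc_of% (laxHom_right F X (rhoHom W)), ← coactHom_laxHom F hF, tensMap_id_comp,
    Category.assoc, reassoc_of% (laxHom_assoc_inv F X (const k H W.carrier) (self k C.carrier)),
    ← reassoc_of% (laxHom_left F (twist X W.carrier) (self k C.carrier)),
    reassoc_of% (laxHom_assoc F (const k H (X.carrier ⊗[k] W.carrier)) (self k H)
      (self k C.carrier)), ← laxHom_right, genAct, tensMap_id_comp]
  simp only [Category.assoc]

/-- The linear map underlying the coaction `F(W) ⟶ W ⊗ F(C)`. -/
noncomputable def coact (W : RComod k C.carrier) :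
    (F.obj W).carrier →ₗ[k] W.carrier ⊗[k] (genObj F).carrier := (coactHom F hF W).lin

theorem coact_nat {V W : RComod k C.carrier} (g : V ⟶ W) (y : (F.obj V).carrier) :
    coact F hF W ((F.map g).lin y) = g.lin.rTensor (genObj F).carrier (coact F hF V y) :=
  LinearMap.congr_fun (congrArg Hom.lin (coactHom_nat F hF g)) y

theorem coact_lax (X : RComod k H) (W : RComod k C.carrier)
    (t : X.carrier ⊗[k] (F.obj W).carrier) :
    coact F hF (tens C X W) ((laxHom F X W).lin t) =
      amb W.carrier (genActAlg F) X.rho ((coact F hF W).lTensor X.carrier t) := by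
  refine (LinearMap.congr_fun (congrArg Hom.lin (laxHom_coactHom F hF X W)) t).trans ?_
  refine Eq.trans ?_ (twist_amb X (genActAlg F) _)
  rw [← genAct_eq]
  rfl

theorem rcolin_coact (W : RComod k C.carrier) :
    RColin (F.obj W).rho (outR W.carrier (genObj F).rho) (coact F hF W) := by
  rw [← tensRho_const]
  exact (coactHom F hF W).rho

theorem amb_const {V W A : Type u} [AddCommGroup V] [Module k V] [AddCommGroup W] [Module k W]
    [AddCommGroup A] [Module k A] (a : H →ₐ[k] Module.End k A) (t : V ⊗[k] (W ⊗[k] A)) :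
    TensorProduct.assoc k V W A (amb W a ((TensorProduct.mk k V H).flip 1) t) = t :=
  LinearMap.congr_fun (f := (TensorProduct.assoc k V W A).toLinearMap ∘ₗ
    amb W a ((TensorProduct.mk k V H).flip 1)) (g := LinearMap.id)
    (TensorProduct.ext_threefold' fun v w m => by
      simp only [LinearMap.comp_apply, amb_tmul]
      simp) t

/-- On a trivial comodule `V` the formula `coact_lax` involves only the unit of `H`, which acts as
the identity. The coaction therefore leaves the factor `V` alone. -/
theorem coact_const (V : Type u) [AddCommGroup V] [Module k V] (W : RComod k C.carrier)
    (t : V ⊗[k] (F.obj W).carrier) :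
    TensorProduct.assoc k V W.carrier (genObj F).carrier
      (coact F hF (tens C (const k H V) W) ((laxHom F (const k H V) W).lin t)) =
      (coact F hF W).lTensor V t :=
  (congrArg _ (coact_lax F hF (const k H V) W t)).trans (amb_const _ _)

theorem laxHom_coact (W : RComod k C.carrier) (y : (F.obj W).carrier) :
    (laxHom F (const k H W.carrier) (self k C.carrier)).lin (coact F hF W y) =
      (F.map (rhoHom W)).lin y :=
  LinearMap.congr_fun (congrArg Hom.lin (coactHom_laxHom F hF W)) y

/-- Naturality of the coaction along `W → W ⊗ C`, followed by its known form on `W ⊗ C` with `W`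
trivial. For `W = C` this is coassociativity of the left coaction on `F(C)`; for general `W` it says
that `F(W) → W ⊗ F(C)` lands in `W □_C F(C)`. -/
theorem coact_coassoc (W : RComod k C.carrier) (y : (F.obj W).carrier) :
    TensorProduct.assoc k W.carrier C.carrier (genObj F).carrier
      (W.rho.rTensor (genObj F).carrier (coact F hF W y)) =
      (coact F hF (self k C.carrier)).lTensor W.carrier (coact F hF W y) := by
  refine Eq.trans ?_ (coact_const F hF W.carrier (self k C.carrier) (coact F hF W y))
  refine congrArg _ ((coact_nat F hF (rhoHom W) y).symm.trans ?_)
  rw [laxHom_coact]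

theorem coact_counit (y : (genObj F).carrier) :
    contract (genObj F).carrier (Coalgebra.counit (R := k) (A := C.carrier))
      (coact F hF (self k C.carrier) y) = y := by
  -- The counit is used as a map from the trivial comodule on the space `C` to the unit object, so
  -- that `(ε ⊗ C) ∘ Δ = id` is an identity in the comodule category to which `F` can be applied.
  let ε : const k H (self k C.carrier).carrier ⟶ triv k H :=
    constMap H (Coalgebra.counit (R := k) (A := C.carrier))
  have e : rhoHom (self k C.carrier) ≫ tensMap C ε (𝟙 (self k C.carrier)) ≫
      (tensUnit C (self k C.carrier)).hom = 𝟙 (self k C.carrier) :=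
    hom_ext fun (c : C.carrier) => (Bicomod.unit C).isLeft.counit c
  have e' : coactHom F hF (self k C.carrier) ≫ tensMap D ε (𝟙 (genObj F)) ≫
      (tensUnit D (genObj F)).hom = 𝟙 (genObj F) := by
    rw [← laxHom_unit, reassoc_of% (laxHom_left F ε (self k C.carrier)),
      reassoc_of% (coactHom_laxHom F hF (self k C.carrier)), ← F.map_comp, ← F.map_comp, e,
      F.map_id]
  exact LinearMap.congr_fun (congrArg Hom.lin e') y

/-- The bicomodule `F(C)`. -/
noncomputable def genBicomod : Bicomod C D where
  carrier := (genObj F).carrier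
  act := genActAlg F
  lam := coact F hF (self k C.carrier)
  rho := (genObj F).rho
  isLeft := ⟨coact_coassoc F hF (self k C.carrier), coact_counit F hF⟩
  isRight := (genObj F).isRight
  commuting m := (congrArg (TensorProduct.assoc k C.carrier (genObj F).carrier D.carrier)
    (rcolin_coact F hF (self k C.carrier) m).symm).trans (LinearEquiv.apply_symm_apply _ _)
  -- Naturality of the coaction along the action `H ⊗ C → C`, then its compatibility with the
  -- structure morphism at `X = H`.
  lam_act h m := by
    refine (coact_nat F hF (actHom C) _).trans ?_
    refine (congrArg _ (coact_lax F hF (self k H) (self k C.carrier)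
      (show H ⊗[k] _ from h ⊗ₜ m))).trans ?_
    exact actHom_amb C (genActAlg F) h (coact F hF (self k C.carrier) m)
  -- The action `H ⊗ F(C) → F(C)` is a morphism of right `D`-comodules, with the diagonal coaction
  -- on its source.
  rho_act h m := by
    refine ((genAct F).rho (show H ⊗[k] _ from h ⊗ₜ m)).trans ?_
    rw [genAct_eq, diag_apply]
    show (TensorProduct.lift (genActAlg F).toLinearMap).rTensor D.carrier
      ((TensorProduct.lift D.act.toLinearMap).lTensor (H ⊗[k] (genObj F).carrier)
        (TensorProduct.tensorTensorTensorComm k H H (genObj F).carrier D.carrier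
          (Coalgebra.comul h ⊗ₜ (genObj F).rho m))) = _
    rw [← LinearMap.comp_apply (LinearMap.rTensor _ _), LinearMap.rTensor_comp_lTensor]

/-- The comparison morphism `F(W) ⟶ W □_C F(C)`. -/
noncomputable def genHom (W : RComod k C.carrier) : F.obj W ⟶ cotObj W (genBicomod F hF) :=
  cotCod (M := genBicomod F hF) (coact F hF W) (fun y => Bicomod.mem_cot.2 (coact_coassoc F hF W y))
    (rcolin_coact F hF W)

theorem cotIncl_genHom (W : RComod k C.carrier) (y : (F.obj W).carrier) :
    cotIncl W (genBicomod F hF) ((genHom F hF W).lin y) = coact F hF W y := rfl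

theorem genHom_nat {V W : RComod k C.carrier} (g : V ⟶ W) :
    F.map g ≫ genHom F hF W = genHom F hF V ≫ cotMap₂ g (𝟙 (genBicomod F hF)) :=
  cot_hom_ext fun y => coact_nat F hF g y

/-- Embedded in `(X ⊗ W) ⊗ F(C)`, this is `coact_lax`, because the structure morphism of the
cotensor functor is a restriction of `amb`. -/
theorem genHom_lax (X : RComod k H) (W : RComod k C.carrier) :
    tensMap D (𝟙 X) (genHom F hF W) ≫ cotLax X W (genBicomod F hF) =
      laxHom F X W ≫ genHom F hF (tens C X W) :=
  cot_hom_ext (W := tens C X W) fun (t : X.carrier ⊗[k] (F.obj W).carrier) => by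
    refine Eq.trans ?_ (coact_lax F hF X W t).symm
    refine congrArg (amb W.carrier (genActAlg F) X.rho) ?_
    exact (LinearMap.lTensor_comp_apply X.carrier (cotIncl W (genBicomod F hF))
      (genHom F hF W).lin t).symm

/-- The difference of the two colinear maps `W ⊗ C → W ⊗ C ⊗ C`. -/
noncomputable def barDiff (W : RComod k C.carrier) :
    tens C (const k H W.carrier) (self k C.carrier) ⟶
      tens C (const k H (W.carrier ⊗[k] C.carrier)) (self k C.carrier) :=
  tensMap C (constMap H W.rho) (𝟙 _) - rhoHom (tens C (const k H W.carrier) (self k C.carrier))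

theorem rhoHom_barDiff (W : RComod k C.carrier) : rhoHom W ≫ barDiff W = 0 :=
  (Preadditive.comp_sub _ _ _).trans (sub_eq_zero.2 (rhoHom_nat (rhoHom W)).symm)

/-- Up to bracketing, `barDiff W` is the map whose kernel defines `W □_C C`; hence its kernel is
`W`. -/
theorem barDiff_lin (W : RComod k C.carrier) (x : W.carrier ⊗[k] C.carrier) :
    TensorProduct.assoc k W.carrier C.carrier C.carrier ((barDiff W).lin x) =
      Bicomod.cotDiff W.rho (Coalgebra.comul (R := k) (A := C.carrier)) x := by
  have e : (barDiff W).lin x = W.rho.rTensor C.carrier x -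
      outR W.carrier (Coalgebra.comul (R := k) (A := C.carrier)) x := by
    rw [← tensRho_const (H := H)]
    rfl
  refine (congrArg (TensorProduct.assoc k W.carrier C.carrier C.carrier) e).trans ?_
  rw [map_sub]
  exact congrArg (_ - ·) (LinearEquiv.apply_symm_apply _ _)

/-- `W` is the kernel of `W ⊗ C → W ⊗ C ⊗ C`. -/
noncomputable def isLimitRhoHom (W : RComod k C.carrier) :
    IsLimit (KernelFork.ofι (rhoHom W) (rhoHom_barDiff W)) :=
  isLimitKernelFork _ _ _ (rho_injective W) fun (x : W.carrier ⊗[k] C.carrier) hx =>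
    have h : Bicomod.cotDiff W.rho (Bicomod.unit C).lam x = 0 := by
      refine (barDiff_lin W x).symm.trans ?_
      exact (congrArg _ hx).trans (map_zero _)
    ⟨(cotObjUnit W).hom.lin ⟨x, h⟩, congrArg (cotIncl W (Bicomod.unit C))
      (LinearMap.congr_fun (congrArg Hom.lin (cotObjUnit W).hom_inv_id) ⟨x, h⟩)⟩

/-- Write `θ : W ⊗ F(C) ≅ F(W ⊗ C)` for the structure morphism. Left exactness makes `F(W)` the
kernel of `F(barDiff W)`, embedded by `θ` composed with the coaction of `F(W)`. This gives
injectivity. For surjectivity, `θ` carries `W □_C F(C)` into that kernel. -/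
theorem genHom_bijective [PreservesFiniteLimits F] (W : RComod k C.carrier) :
    Function.Bijective (genHom F hF W).lin := by
  obtain ⟨h1, h2⟩ := of_isLimit_kernelFork (isLimitMapConeForkEquiv' F (rhoHom_barDiff W)
    (isLimitOfPreserves F (isLimitRhoHom W)))
  constructor
  · intro x y hxy
    apply h1
    rw [← laxHom_coact F hF, ← laxHom_coact F hF, ← cotIncl_genHom, ← cotIncl_genHom, hxy]
  · intro t
    have hθ : Function.Injective (laxHom F (const k H W.carrier) (self k C.carrier)).lin := by
      have := isIso_laxHom_const F hF W.carrier (self k C.carrier)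
      refine Function.LeftInverse.injective
        (g := (inv (laxHom F (const k H W.carrier) (self k C.carrier))).lin) fun x => ?_
      exact LinearMap.congr_fun (congrArg Hom.lin
        (IsIso.hom_inv_id (laxHom F (const k H W.carrier) (self k C.carrier)))) x
    let s : W.carrier ⊗[k] (genObj F).carrier := cotIncl W (genBicomod F hF) t
    let x := (laxHom F (const k H W.carrier) (self k C.carrier)).lin s
    -- By additivity this is an equality of two terms. Naturality of the structure morphism rewrites
    -- the first through the coaction of `W`; `coact_const` rewrites the second through the left
    -- coaction of `F(C)`. Their equality is the cotensor condition on `t`.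
    have e : (F.map (barDiff W)).lin x = 0 := by
      refine (LinearMap.congr_fun (congrArg Hom.lin (F.map_sub (f := tensMap C (constMap H W.rho)
        (𝟙 (self k C.carrier))))) x).trans (sub_eq_zero.2 ?_)
      have e1 := LinearMap.congr_fun (congrArg Hom.lin
        (laxHom_left F (constMap H W.rho) (self k C.carrier))) s
      refine e1.symm.trans (Eq.trans ?_ (laxHom_coact F hF
        (tens C (const k H W.carrier) (self k C.carrier)) x))
      refine congrArg (laxHom F (const k H (W.carrier ⊗[k] C.carrier)) (self k C.carrier)).lin ?_
      apply (TensorProduct.assoc k W.carrier C.carrier (genObj F).carrier).injective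
      exact (Bicomod.mem_cot.1 (cotDiff_cotIncl t)).trans
        (coact_const F hF W.carrier (self k C.carrier) s).symm
    obtain ⟨y, hy⟩ := h2 x e
    refine ⟨y, cotIncl_inj _ _ (hθ ?_)⟩
    exact (laxHom_coact F hF W y).trans hy

end Reconstruction

end HopfModCat

namespace HopfModCat

open MonoidalCategory MonoidalLeftAction Functor.LaxLeftLinear Limits

/-! ### Equivalence on categories of 1-cells -/

section LocalEquivalence

open RComod

variable {k : Type u} [Field k] {H : Type u} [Ring H] [Bialgebra k H] {C D : HCoalg k H}

/-- A lax module functor between categories of comodules. -/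
def LaxFun.ofFunctor (F : RComod k C.carrier ⥤ RComod k D.carrier) [hA : F.Additive]
    [hk : F.Linear k] [hl : F.LaxLeftLinear (RComod k H)] : LaxFun (comodCat C) (comodCat D) where
  functor := F
  additive := hA
  linear := hk
  lax := hl

/-- The comparison of `F` with `- □_C F(C)`. -/
noncomputable def genNat (F : RComod k C.carrier ⥤ RComod k D.carrier) [F.Additive] [F.Linear k]
    [F.LaxLeftLinear (RComod k H)] (hF : ∀ J : Type u, PreservesColimitsOfShape (Discrete J) F) :
    ModNat (LaxFun.ofFunctor F) (cotensorFunctor (genBicomod F hF)) where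
  nat := { app := genHom F hF, naturality := fun _ _ g => genHom_nat F hF g }
  comm X W := genHom_lax F hF X W

/-- The comparison of `F` with `- □_C F(C)` is invertible. -/
noncomputable def genIso (F : RComod k C.carrier ⥤ RComod k D.carrier) [F.Additive] [F.Linear k]
    [F.LaxLeftLinear (RComod k H)] (hF : ∀ J : Type u, PreservesColimitsOfShape (Discrete J) F)
    [PreservesFiniteLimits F] :
    LaxFun.ofFunctor F ≅ cotensorFunctor (genBicomod F hF) :=
  let e (W : RComod k C.carrier) : F.obj W ≅ cotObj W (genBicomod F hF) :=
    RComod.isoOf (LinearEquiv.ofBijective _ (genHom_bijective F hF W)) (genHom F hF W).rho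
  ModNat.iso (genNat F hF) (fun W => (e W).inv) (fun W => (e W).hom_inv_id)
    (fun W => (e W).inv_hom_id)

theorem LaxFun.exists_iso_cotensorFunctor (G : LaxFun (comodCat C) (comodCat D)) (hG : G.TypeL) :
    ∃ M : Bicomod C D, Nonempty (cotensorFunctor M ≅ G) :=
  let F : RComod k C.carrier ⥤ RComod k D.carrier := G.functor
  letI : F.Additive := G.additive
  letI : F.Linear k := G.linear
  letI : F.LaxLeftLinear (RComod k H) := G.lax
  have : PreservesFiniteLimits F := hG.leftExact
  ⟨genBicomod F hG.coproducts, ⟨(genIso F hG.coproducts).symm⟩⟩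

theorem comodPseudo_mapFunctor_isEquivalence
    (hL : ∀ {C D : HCoalg k H} (M : C ⟶ D), (cotensorFunctor M).TypeL) (C D : HCoalg k H) :
    ((comodPseudo hL).mapFunctor C D).IsEquivalence where
  faithful := ⟨fun {M N f g} h => cotensorNat_injective h⟩
  full := ⟨fun {M N} α => ⟨ModNat.toHom α, (ModNat.eq_cotensorNat α).symm⟩⟩
  essSurj := ⟨fun G => by
    obtain ⟨M, ⟨e⟩⟩ := LaxFun.exists_iso_cotensorFunctor (HMod.Hom.val G) (HMod.Hom.typeL G)
    exact ⟨M, ⟨HMod.isoOf (F := (comodPrelax hL).map M) (G := G) e⟩⟩⟩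

end LocalEquivalence

/-! ### Essential surjectivity on 0-cells -/

section EssSurj

variable {k : Type u} [Field k] {H : Type u} [Ring H] [Bialgebra k H] {M N : ModCat k H}

/-- The natural isomorphism underlying an isomorphism of lax module functors. -/
def LaxFun.natIso {F G : LaxFun M N} (e : F ≅ G) : F.functor ≅ G.functor where
  hom := ModNat.nat e.hom
  inv := ModNat.nat e.inv
  hom_inv_id := congrArg ModNat.nat e.hom_inv_id
  inv_hom_id := congrArg ModNat.nat e.inv_hom_id

/-- An equivalence of module categories is of type `𝓛`. -/
theorem LaxFun.typeL_of_equivalence (F : LaxFun M N) (G : LaxFun N M)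
    (e₁ : F.comp G ≅ LaxFun.id M) (e₂ : G.comp F ≅ LaxFun.id N) : F.TypeL := by
  have : F.functor.IsEquivalence := (CategoryTheory.Equivalence.mk F.functor G.functor
    (LaxFun.natIso e₁).symm (LaxFun.natIso e₂)).isEquivalence_functor
  exact ⟨inferInstance, fun J => inferInstance⟩

theorem HMod.exists_equivalence (c : HMod k H) :
    ∃ C : HCoalg k H, Nonempty (Bicategory.Equivalence (comodHMod C) c) := by
  obtain ⟨C, F, G, ⟨e₁⟩, ⟨e₂⟩⟩ := c.equiv_comod
  let f : comodHMod C ⟶ c := ⟨G, LaxFun.typeL_of_equivalence G F e₂ e₁⟩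
  let g : c ⟶ comodHMod C := ⟨F, LaxFun.typeL_of_equivalence F G e₁ e₂⟩
  -- The two given isomorphisms need not satisfy a triangle identity, so the counit is replaced by a
  -- corrected one that does.
  exact ⟨C, ⟨Bicategory.Equivalence.mkOfAdjointifyCounit
    (HMod.isoOf (F := 𝟙 (comodHMod C)) (G := f ≫ g) e₂.symm)
    (HMod.isoOf (F := g ≫ f) (G := 𝟙 c) e₁)⟩⟩

end EssSurj

end HopfModCat

/-- The functors `- □_C M` are of type `𝓛`, and `C ↦ 𝔐^C`, `M ↦ - □_C M` extends to a pseudofunctor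
which is a biequivalence. -/
theorem mainTheorem6 (k : Type u) [Field k] (H : Type u) [Ring H] [Bialgebra k H] :
    ∃ hL : ∀ {C D : HopfModCat.HCoalg k H} (M : C ⟶ D), (HopfModCat.cotensorFunctor M).TypeL,
      ∃ F : Pseudofunctor (HopfModCat.HCoalg k H) (HopfModCat.HMod k H),
        F.toPrelaxFunctor = HopfModCat.comodPrelax hL ∧ HopfModCat.IsBiequivalence F := by
  exact ⟨fun M => HopfModCat.cotensorFunctor_typeL M,
    HopfModCat.comodPseudo fun M => HopfModCat.cotensorFunctor_typeL M, rfl,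
    ⟨HopfModCat.comodPseudo_mapFunctor_isEquivalence _, HopfModCat.HMod.exists_equivalence⟩⟩
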